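/- Let $m>0$, $\kappa>0$, $\beta\in\mathbb R$ and consider the dimer FPUT lattice $$m_j\ddot u_j=\mathcal V_j'(u_{j+1}-u_j)-\mathcal V_{j-1}'(u_j-u_{j-1}),\qquad j\in\mathbb Z,$$ where $m_j=1$ for odd $j$ and $m_j=m$ for even $j$, the potentials $\mathcal V_j\in C^\infty(\mathbb R)$ satisfy $\mathcal V_{j+2}=\mathcal V_j$, and, as $r\to0$, $\mathcal V_j'(r)=r+r^2+O(r^3)$ for odd $j$ and $\mathcal V_j'(r)=\kappa r+\beta r^2+O(r^3)$ for even $j$. Assume that $1/m>1$ or $\kappa>1$. Put $w:=1/m$, $$c_\star:=\sqrt{\frac{4\kappa w}{(1+\kappa)(1+w)}},\qquad \lambda_+(K):=\frac{(1+\kappa)(1+w)}2+\frac12\sqrt{(1+w)^2(1-\kappa)^2+4\kappa\big((1-w)^2+4w\cos^2K\big)},$$ and let $c\in\mathbb R$ with $|c|>c_\star$. Then there is a (necessarily unique) critical frequency $\omega_c>0$ such that, for real $K$, $c^2K^2=\lambda_+(K)$ if and only if $K=\pm\omega_c$. Let $$\boldsymbol\nu_1^c(x):=\frac{e^{-ix}}{N_c}\begin{pmatrix}e^{-i\omega_c}+\kappa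 e^{i\omega_c}\\1+\kappa-c^2\omega_c^2\end{pmatrix}+\frac{e^{ix}}{N_c}\begin{pmatrix}e^{i\omega_c}+\kappa e^{-i\omega_c}\\1+\kappa-c^2\omega_c^2\end{pmatrix}=\frac2{N_c}\begin{pmatrix}\cos(x+\omega_c)+\kappa\cos(x-\omega_c)\\(1+\kappa-c^2\omega_c^2)\cos x\end{pmatrix},$$ $$N_c:=\sqrt2\,\Big((1-\kappa)^2+4\kappa\cos^2\omega_c+(1+\kappa-c^2\omega_c^2)^2\Big)^{1/2}.$$ For $2\pi$-periodic $\boldsymbol\phi,\boldsymbol\eta:\mathbb R\to\mathbb R^2$ write $\langle\boldsymbol\phi,\boldsymbol\eta\rangle_{L^2_{\rm per}}:=\frac1{2\pi}\int_{-\pi}^{\pi}\boldsymbol\phi\cdot\boldsymbol\eta\,dx$, $\hat{\boldsymbol\phi}(k):=\frac1{\sqrt{2\pi}}\int_{-\pi}^{\pi}e^{-ikx}\boldsymbol\phi(x)\,dx$ and $\|\boldsymbol\phi\|_{H^r_{\rm per}}:=\big(\sum_{k\in\mathbb Z}(1+k^2)^r|\hat{\boldsymbol\phi}(k)|^2\big)^{1/2}$.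 Then $\boldsymbol\nu_1^c$ is smooth and $2\pi$-periodic, and there is $a_c>0$ such that for every $a$ with $|a|\le a_c$ there are $\omega_c^a,\xi_c^a\in\mathbb R$ and a smooth, $2\pi$-periodic $\boldsymbol\psi_c^a:\mathbb R\to\mathbb R^2$ for which $$\mathbf p_c^a(X)=a\,\boldsymbol\nu_1^c(\omega_c^aX)+a^2\boldsymbol\psi_c^a(\omega_c^aX)$$ is a solution $\mathbf p=(p_1,p_2)$ of $$\begin{cases}c^2p_1''(X)=\mathcal V_1'\big(p_2(X+1)-p_1(X)\big)-\mathcal V_2'\big(p_1(X)-p_2(X-1)\big)\\ c^2m\,p_2''(X)=\mathcal V_2'\big(p_1(X+1)-p_2(X)\big)-\mathcal V_1'\big(p_2(X)-p_1(X-1)\big),\end{cases}$$ so that $u_j(t)=p_1(j-ct)$ for odd $j$, $u_j(t)=p_2(j-ct)$ for even $j$, solves the equations of motion. Moreover: 1. $\langle\boldsymbol\nu_1^c,\boldsymbol\psi_c^a\rangle_{L^2_{\rm per}}=0$ for $|a|\le a_c$, and $\sup_{|a|\le a_c}\|\boldsymbol\psi_c^a\|_{H^r_{\rm per}}<\infty$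 for every real $r\ge0$; 2. $\omega_c^a=\omega_c+a\,\xi_c^a$ for $|a|\le a_c$, and $\sup_{|a|\le a_c}|\xi_c^a|<\infty$. -/

import Mathlib

open scoped ContDiff Topology ENNReal

noncomputable section

namespace Dimer

/-- The masses `mass j` and spring potentials `V j` (the spring `j` joins the particles `j` and
`j + 1`) form a nondimensionalized dimer lattice with parameters `m`, `κ`, `β`. -/
structure IsDimer (m κ β : ℝ) (mass : ℤ → ℝ) (V : ℤ → ℝ → ℝ) : Prop where
  mass_odd : ∀ j, Odd j → mass j = 1
  mass_even : ∀ j, Even j → mass j = m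
  periodic : ∀ j, V (j + 2) = V j
  smooth : ∀ j, ContDiff ℝ ∞ (V j)
  force_odd : ∀ j, Odd j →
    Asymptotics.IsBigO (𝓝 0) (fun r : ℝ => deriv (V j) r - (r + r ^ 2)) (fun r : ℝ => r ^ 3)
  force_even : ∀ j, Even j →
    Asymptotics.IsBigO (𝓝 0) (fun r : ℝ => deriv (V j) r - (κ * r + β * r ^ 2))
      (fun r : ℝ => r ^ 3)

/-- Newton's second law for the displacements `u j t`. -/
def EquationsOfMotion (mass : ℤ → ℝ) (V : ℤ → ℝ → ℝ) (u : ℤ → ℝ → ℝ) : Prop :=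
  ∀ (j : ℤ) (t : ℝ), mass j * iteratedDeriv 2 (u j) t =
    deriv (V j) (u (j + 1) t - u j t) - deriv (V (j - 1)) (u j t - u (j - 1) t)

/-- The traveling wave ansatz; the components `p₁`, `p₂` of the profile are `p · 0`, `p · 1`. -/
def travelingWave (c : ℝ) (p : ℝ → Fin 2 → ℝ) (j : ℤ) (t : ℝ) : ℝ :=
  if Odd j then p (j - c * t) 0 else p (j - c * t) 1

/-- The advance-delay system for the traveling wave profile. -/
def TravelingWaveSystem (m : ℝ) (V₁ V₂ : ℝ → ℝ) (c : ℝ) (p : ℝ → Fin 2 → ℝ) : Prop :=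
  ∀ X : ℝ,
    c ^ 2 * iteratedDeriv 2 (fun Y => p Y 0) X =
        deriv V₁ (p (X + 1) 1 - p X 0) - deriv V₂ (p X 0 - p (X - 1) 1) ∧
    c ^ 2 * m * iteratedDeriv 2 (fun Y => p Y 1) X =
        deriv V₂ (p (X + 1) 0 - p X 1) - deriv V₁ (p X 1 - p (X - 1) 0)

/-- The lattice's speed of sound. -/
def soundSpeed (m κ : ℝ) : ℝ :=
  √(4 * κ * (1 / m) / ((1 + κ) * (1 + 1 / m)))

def rho (m κ K : ℝ) : ℝ :=
  √((1 + 1 / m) ^ 2 * (1 - κ) ^ 2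
    + 4 * κ * ((1 - 1 / m) ^ 2 + 4 * (1 / m) * Real.cos K ^ 2))

/-- The larger eigenvalue of the dispersion matrix at wave number `K`. -/
def lambdaPlus (m κ K : ℝ) : ℝ :=
  (1 + κ) * (1 + 1 / m) / 2 + rho m κ K / 2

/-- `Ω` is the critical frequency at wave speed `c`; at most one `Ω` has this property. -/
def IsCriticalFrequency (m κ c Ω : ℝ) : Prop :=
  0 < Ω ∧ ∀ K : ℝ, c ^ 2 * K ^ 2 = lambdaPlus m κ K ↔ K = Ω ∨ K = -Ω

/-- The constant that makes `nu1` a unit vector in `L²_per`; here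
`(1 - κ) ^ 2 + 4 * κ * cos Ω ^ 2 = |exp (i Ω) + κ exp (-i Ω)| ^ 2`. -/
def nuNorm (κ c Ω : ℝ) : ℝ :=
  √2 * √(((1 - κ) ^ 2 + 4 * κ * Real.cos Ω ^ 2) + (1 + κ - c ^ 2 * Ω ^ 2) ^ 2)

/-- The leading order profile, in real form. -/
def nu1 (κ c Ω : ℝ) (x : ℝ) : Fin 2 → ℝ :=
  ![2 / nuNorm κ c Ω * (Real.cos (x + Ω) + κ * Real.cos (x - Ω)),
    2 / nuNorm κ c Ω * ((1 + κ - c ^ 2 * Ω ^ 2) * Real.cos x)]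

/-- The complex exponential form of `nu1`. -/
theorem nu1_eq_exp (κ c Ω x : ℝ) :
    (fun i => (nu1 κ c Ω x i : ℂ)) =
      (Complex.exp (-(Complex.I * x)) / nuNorm κ c Ω) •
          ![Complex.exp (-(Complex.I * Ω)) + κ * Complex.exp (Complex.I * Ω),
            1 + κ - (c : ℂ) ^ 2 * Ω ^ 2]
        + (Complex.exp (Complex.I * x) / nuNorm κ c Ω) •
          ![Complex.exp (Complex.I * Ω) + κ * Complex.exp (-(Complex.I * Ω)),
            1 + κ - (c : ℂ) ^ 2 * Ω ^ 2] := by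
  have h1 : ∀ y : ℂ, Complex.exp (Complex.I * y) = Complex.cos y + Complex.sin y * Complex.I := by
    intro y; rw [mul_comm, Complex.exp_mul_I]
  have h2 : ∀ y : ℂ,
      Complex.exp (-(Complex.I * y)) = Complex.cos y - Complex.sin y * Complex.I := by
    intro y
    rw [← mul_neg, h1, Complex.cos_neg, Complex.sin_neg]; ring
  have hI : Complex.I ^ 2 = -1 := Complex.I_sq
  funext i
  fin_cases i
  · simp only [nu1, h1, h2, Fin.zero_eta, Matrix.cons_val_zero, Pi.add_apply, Pi.smul_apply,
      smul_eq_mul]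
    push_cast
    rw [Complex.cos_add, Complex.cos_sub]
    ring_nf
    rw [hI]
    ring
  · simp only [nu1, h1, h2, Fin.mk_one, Matrix.cons_val_one, Matrix.cons_val_fin_one,
      Pi.add_apply, Pi.smul_apply, smul_eq_mul]
    push_cast
    ring

/-- The `L²_per` inner product of `ℝ²`-valued functions. -/
def innerPer (φ η : ℝ → Fin 2 → ℝ) : ℝ :=
  1 / (2 * Real.pi) * ∫ x in (-Real.pi)..Real.pi, ∑ i, φ x i * η x i

/-- The `k`-th Fourier coefficient. -/
def fourierPer (φ : ℝ → Fin 2 → ℝ) (k : ℤ) (i : Fin 2) : ℂ :=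
  1 / (√(2 * Real.pi) : ℂ) *
    ∫ x in (-Real.pi)..Real.pi, Complex.exp (-(Complex.I * k * x)) * (φ x i : ℂ)

/-- The norm of the periodic Sobolev space `H^r_per`, with the value `∞` outside that space. -/
def sobolevNorm (r : ℝ) (φ : ℝ → Fin 2 → ℝ) : ℝ≥0∞ :=
  (∑' k : ℤ, ENNReal.ofReal ((1 + (k : ℝ) ^ 2) ^ r * ∑ i, ‖fourierPer φ k i‖ ^ 2)) ^ (1 / 2 : ℝ)

end Dimer

end

/-! Rescaling x = ωX fixes the period at 2π and turns the frequency into the spacing θ of the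
shifts: c²θ²φ₁'' = F₁(φ), c²mθ²φ₂'' = F₂(φ). For the linearization at zero with θ = Ω critical,
Fourier mode k is governed by a Hermitian 2×2 matrix with determinant m·`symbolDet` at K = kΩ. This
factors as m(c²K² - λ₊)(c²K² - λ₊ + ρ), hence is positive for |k| ≥ 2 and zero for k = 0, ±1. The
kernel is spanned by the common constants, the critical mode ν and its derivative ν'.

Inverting mode by mode, with a rank-one pseudoinverse on the singular modes, gives a bounded
operator G on pairs of continuous functions (`exists_generalizedInverse`). With φ = aν + a²Gf and θ
= Ω + aξ the equation becomes f = a⁻¹D(aξ)ν + D(aξ)Gf + (a²θ²)⁻¹F_W(aν + a²Gf), where D(t) =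
(Ω+t)⁻²L_{Ω+t} - Ω⁻²L_Ω is the detuning of the linearized forces L and W is the part of the forces
vanishing to second order. For small a ≠ 0 and ξ in a fixed interval the right side contracts a
ball: the nonlinear term is bounded uniformly in a, and D(t)G → 0 in operator norm. Translations are
only strongly continuous on continuous functions, but G smooths.

Three solvability conditions remain. The one for the constants is Newton's third law. The one along
ν is the bifurcation equation ℓ(f) = 0, solved for ξ by the intermediate value theorem
(`exists_bifurcating_solutions`): ℓ(a⁻¹D(aξ)ν) ≈ μξ, and μ > 0 (`exists_hasDerivAt_detuning`) is the
supersonic estimate `transversality` again. The one along ν' holds automatically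
(`isDeriv_of_projected`): tested against φ', the inertial terms are exact derivatives and the forces
do no net work over a period, so the residual has to vanish.

A bootstrap with bounds uniform in a (`uniformlyCn_correction`) gives smoothness and the Sobolev
estimates. -/

noncomputable section

namespace Dimer

/-! ### Dispersion relation and critical frequency. -/

section Dispersion

variable {m κ c : ℝ}

theorem rho_radicand_eq (m κ K : ℝ) :
    (1 + 1 / m) ^ 2 * (1 - κ) ^ 2 + 4 * κ * ((1 - 1 / m) ^ 2 + 4 * (1 / m) * Real.cos K ^ 2) =
      ((1 + κ) * (1 + 1 / m)) ^ 2 - 16 * κ * (1 / m) * Real.sin K ^ 2 := by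
  rw [Real.sin_sq]; ring

theorem rho_radicand_nonneg (hm : 0 < m) (hκ : 0 < κ) (K : ℝ) :
    0 ≤ (1 + 1 / m) ^ 2 * (1 - κ) ^ 2
      + 4 * κ * ((1 - 1 / m) ^ 2 + 4 * (1 / m) * Real.cos K ^ 2) := by positivity

theorem rho_sq (hm : 0 < m) (hκ : 0 < κ) (K : ℝ) :
    rho m κ K ^ 2 = ((1 + κ) * (1 + 1 / m)) ^ 2 - 16 * κ * (1 / m) * Real.sin K ^ 2 := by
  rw [rho, Real.sq_sqrt (rho_radicand_nonneg hm hκ K), rho_radicand_eq]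

/-- The radicand is symmetric in κ and 1/m; this is its form with the two exchanged, needed in
`IsCriticalFrequency.gap`. -/
theorem rho_sq' (hm : 0 < m) (hκ : 0 < κ) (K : ℝ) :
    rho m κ K ^ 2 = (1 + κ) ^ 2 * (1 - 1 / m) ^ 2
      + 4 * (1 / m) * ((1 - κ) ^ 2 + 4 * κ * Real.cos K ^ 2) := by
  rw [rho_sq hm hκ, Real.sin_sq]; ring

theorem rho_nonneg (m κ K : ℝ) : 0 ≤ rho m κ K := Real.sqrt_nonneg _

/-- With S = (1 + κ)(1 + 1/m), ρ² = S² - 16κ(1/m) sin²K, and 16κ/m ≤ S² by the arithmetic-geometric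
mean inequality. -/
theorem rho_ge (hm : 0 < m) (hκ : 0 < κ) (K : ℝ) :
    (1 + κ) * (1 + 1 / m) * |Real.cos K| ≤ rho m κ K := by
  have hw : 0 < 1 / m := by positivity
  apply abs_le_of_sq_le_sq' _ (rho_nonneg _ _ _) |>.2
  rw [rho_sq hm hκ, mul_pow, sq_abs, Real.cos_sq']
  have h1 : 4 * κ ≤ (1 + κ) ^ 2 := by nlinarith [sq_nonneg (1 - κ)]
  have h2 : 4 * (1 / m) ≤ (1 + 1 / m) ^ 2 := by nlinarith [sq_nonneg (1 - 1 / m)]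
  have h3 : 16 * κ * (1 / m) ≤ ((1 + κ) * (1 + 1 / m)) ^ 2 := by
    rw [mul_pow]
    calc 16 * κ * (1 / m) = 4 * κ * (4 * (1 / m)) := by ring
      _ ≤ _ := by gcongr
  nlinarith [sq_nonneg (Real.sin K)]

theorem rho_pos (hm : 0 < m) (hκ : 0 < κ) (hhet : 1 / m > 1 ∨ κ > 1) (K : ℝ) :
    0 < rho m κ K := by
  rw [rho, Real.sqrt_pos]
  have hw : 0 < 1 / m := by positivity
  rcases hhet with h | h
  · have : 0 < (1 - 1 / m) ^ 2 := by
      have : 1 - 1 / m ≠ 0 := by linarith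
      positivity
    positivity
  · have : 0 < (1 - κ) ^ 2 := by
      have : 1 - κ ≠ 0 := by linarith
      positivity
    positivity

theorem soundSpeed_sq_lt (hm : 0 < m) (hκ : 0 < κ) (hc : |c| > soundSpeed m κ) :
    4 * κ * (1 / m) < c ^ 2 * ((1 + κ) * (1 + 1 / m)) := by
  have hw : 0 < 1 / m := by positivity
  have h0 : 0 ≤ soundSpeed m κ := Real.sqrt_nonneg _
  have h1 : soundSpeed m κ ^ 2 < |c| ^ 2 := by gcongr
  rw [soundSpeed, Real.sq_sqrt (by positivity), sq_abs] at h1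
  rwa [div_lt_iff₀ (by positivity)] at h1

theorem speed_sq_pos (hc : |c| > soundSpeed m κ) : 0 < c ^ 2 := by
  have := (Real.sqrt_nonneg _ : 0 ≤ soundSpeed m κ).trans_lt hc
  have := abs_pos.1 this
  positivity

/-- Up to the factor 2/ρ this is the derivative of c²K² - λ₊(K). Only the second term can be
negative; |sin K| ≤ K and `rho_ge` make both terms comparable with K|cos K|, and the supersonic
condition lets the first one win. -/
theorem transversality (hm : 0 < m) (hκ : 0 < κ) (hhet : 1 / m > 1 ∨ κ > 1)
    (hc : |c| > soundSpeed m κ) {K : ℝ} (hK : 0 < K) :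
    0 < c ^ 2 * K * rho m κ K + 4 * κ * (1 / m) * (Real.cos K * Real.sin K) := by
  have hc2 := speed_sq_pos hc
  have hw : 0 < 1 / m := by positivity
  -- The comparison with K|cos K| is not strict where cos K = 0; there ρ > 0 suffices.
  by_cases h : Real.cos K = 0
  · have := rho_pos hm hκ hhet K
    rw [h]; simp; positivity
  have h1 : 0 < |Real.cos K| := abs_pos.2 h
  have h2 : |Real.cos K * Real.sin K| ≤ |Real.cos K| * K := by
    rw [abs_mul]
    gcongr
    have := Real.abs_sin_le_abs (x := K)
    rwa [abs_of_pos hK] at this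
  have h3 := (abs_le.1 h2).1
  have h4 : c ^ 2 * K * ((1 + κ) * (1 + 1 / m) * |Real.cos K|) ≤ c ^ 2 * K * rho m κ K := by
    gcongr
    exact rho_ge hm hκ K
  have h5 : 4 * κ * (1 / m) * (|Real.cos K| * K)
      < c ^ 2 * ((1 + κ) * (1 + 1 / m)) * (|Real.cos K| * K) :=
    mul_lt_mul_of_pos_right (soundSpeed_sq_lt hm hκ hc) (by positivity)
  have h6 : 4 * κ * (1 / m) * (-(|Real.cos K| * K))
      ≤ 4 * κ * (1 / m) * (Real.cos K * Real.sin K) := by gcongr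
  nlinarith

theorem hasDerivAt_rho (hm : 0 < m) (hκ : 0 < κ) (hhet : 1 / m > 1 ∨ κ > 1) (K : ℝ) :
    HasDerivAt (rho m κ) (-(16 * κ * (1 / m) * (Real.cos K * Real.sin K)) / rho m κ K) K := by
  have hr := rho_pos hm hκ hhet K
  have hne : (1 + 1 / m) ^ 2 * (1 - κ) ^ 2
      + 4 * κ * ((1 - 1 / m) ^ 2 + 4 * (1 / m) * Real.cos K ^ 2) ≠ 0 :=
    (Real.sqrt_pos.1 hr).ne'
  have h := ((((((Real.hasDerivAt_cos K).pow 2).const_mul (4 * (1 / m))).const_add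
    ((1 - 1 / m) ^ 2)).const_mul (4 * κ)).const_add ((1 + 1 / m) ^ 2 * (1 - κ) ^ 2)).sqrt hne
  refine h.congr_deriv ?_
  change _ / (2 * rho m κ K) = _
  rw [div_eq_div_iff (by positivity) (by positivity)]
  push_cast
  ring

theorem hasDerivAt_dispersion (hm : 0 < m) (hκ : 0 < κ) (hhet : 1 / m > 1 ∨ κ > 1) (K : ℝ) :
    HasDerivAt (fun K => c ^ 2 * K ^ 2 - lambdaPlus m κ K)
      (2 / rho m κ K * (c ^ 2 * K * rho m κ K + 4 * κ * (1 / m) * (Real.cos K * Real.sin K))) K := by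
  have hr := rho_pos hm hκ hhet K
  have h := (((hasDerivAt_id K).pow 2).const_mul (c ^ 2)).sub
    (((hasDerivAt_rho hm hκ hhet K).div_const 2).const_add ((1 + κ) * (1 + 1 / m) / 2))
  refine h.congr_deriv ?_
  simp only [id]
  field_simp
  push_cast
  ring

theorem dispersion_strictMonoOn (hm : 0 < m) (hκ : 0 < κ) (hhet : 1 / m > 1 ∨ κ > 1)
    (hc : |c| > soundSpeed m κ) :
    StrictMonoOn (fun K => c ^ 2 * K ^ 2 - lambdaPlus m κ K) (Set.Ici 0) := by
  have hd := hasDerivAt_dispersion (c := c) hm hκ hhet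
  apply strictMonoOn_of_deriv_pos (convex_Ici 0)
  · exact fun K _ => (hd K).continuousAt.continuousWithinAt
  · intro K hK
    rw [interior_Ici, Set.mem_Ioi] at hK
    rw [(hd K).deriv]
    have := rho_pos hm hκ hhet K
    have := transversality hm hκ hhet hc hK
    positivity

theorem lambdaPlus_neg (m κ K : ℝ) : lambdaPlus m κ (-K) = lambdaPlus m κ K := by
  simp [lambdaPlus, rho]

theorem lambdaPlus_pos (hm : 0 < m) (hκ : 0 < κ) (K : ℝ) : 0 < lambdaPlus m κ K := by
  have := rho_nonneg m κ K
  unfold lambdaPlus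
  positivity

theorem lambdaPlus_le (hm : 0 < m) (hκ : 0 < κ) (K : ℝ) :
    lambdaPlus m κ K ≤ (1 + κ) * (1 + 1 / m) := by
  have h : rho m κ K ≤ (1 + κ) * (1 + 1 / m) := by
    apply abs_le_of_sq_le_sq' _ (by positivity) |>.2
    rw [rho_sq hm hκ]
    have : 0 ≤ 16 * κ * (1 / m) * Real.sin K ^ 2 := by positivity
    linarith
  unfold lambdaPlus
  linarith

theorem exists_criticalFrequency (hm : 0 < m) (hκ : 0 < κ) (hhet : 1 / m > 1 ∨ κ > 1)
    (hc : |c| > soundSpeed m κ) : ∃ Ω, IsCriticalFrequency m κ c Ω := by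
  set f := fun K => c ^ 2 * K ^ 2 - lambdaPlus m κ K with hf
  have hd := hasDerivAt_dispersion (c := c) hm hκ hhet
  have hc2 := speed_sq_pos hc
  have hmono := dispersion_strictMonoOn hm hκ hhet hc
  have hf0 : f 0 < 0 := by
    have := lambdaPlus_pos hm hκ 0
    simp [hf, this]
  -- λ₊ never exceeds (1 + κ)(1 + 1/m), so the function is nonnegative where c²K² reaches this
  -- value.
  set K₁ := √(((1 + κ) * (1 + 1 / m)) / c ^ 2) with hK₁
  have hf1 : 0 ≤ f K₁ := by
    have h := lambdaPlus_le hm hκ K₁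
    have : c ^ 2 * K₁ ^ 2 = (1 + κ) * (1 + 1 / m) := by
      rw [hK₁, Real.sq_sqrt (by positivity), mul_div_cancel₀ _ hc2.ne']
    simp only [hf]; linarith
  have hcont : ContinuousOn f (Set.Icc 0 K₁) :=
    fun K _ => (hd K).continuousAt.continuousWithinAt
  obtain ⟨Ω, hΩ, hfΩ⟩ := intermediate_value_Icc (Real.sqrt_nonneg _) hcont ⟨hf0.le, hf1⟩
  have hpos : 0 < Ω := by
    rcases hΩ.1.lt_or_eq with h | h
    · exact h
    · rw [← h] at hfΩ; linarith
  have huniq : ∀ K, 0 ≤ K → f K = 0 → K = Ω := fun K hK h =>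
    hmono.injOn (Set.mem_Ici.2 hK) (Set.mem_Ici.2 hpos.le) (h.trans hfΩ.symm)
  have hΩ0 : c ^ 2 * Ω ^ 2 = lambdaPlus m κ Ω := by simp only [hf] at hfΩ; linarith
  refine ⟨Ω, hpos, fun K => ⟨fun h => ?_, ?_⟩⟩
  · rcases le_total 0 K with hK | hK
    · exact Or.inl (huniq K hK (by simp only [hf]; linarith))
    · refine Or.inr ?_
      have := huniq (-K) (by linarith) (by simp only [hf, lambdaPlus_neg, neg_sq]; linarith)
      linarith
  · rintro (rfl | rfl)
    · exact hΩ0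
    · rw [lambdaPlus_neg, neg_sq, hΩ0]

/-- The determinant of the dispersion matrix, up to the factor `m`. -/
def symbolDet (m κ c K : ℝ) : ℝ :=
  (c ^ 2 * K ^ 2) ^ 2 - (1 + κ) * (1 + 1 / m) * (c ^ 2 * K ^ 2) + 4 * κ * (1 / m) * Real.sin K ^ 2

/-- As a quadratic in c²K² the determinant has the two eigenvalues λ₊ and λ₊ - ρ as roots: their sum
is (1 + κ)(1 + 1/m), their product 4κ(1/m) sin²K. -/
theorem symbolDet_eq (hm : 0 < m) (hκ : 0 < κ) (K : ℝ) :
    symbolDet m κ c K = (c ^ 2 * K ^ 2 - lambdaPlus m κ K) *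
      (c ^ 2 * K ^ 2 - lambdaPlus m κ K + rho m κ K) := by
  have := rho_sq hm hκ K
  simp only [symbolDet, lambdaPlus]
  linear_combination (1 / 4) * this

variable {Ω : ℝ}

theorem IsCriticalFrequency.speed_eq (h : IsCriticalFrequency m κ c Ω) :
    c ^ 2 * Ω ^ 2 = lambdaPlus m κ Ω := (h.2 Ω).2 (Or.inl rfl)

theorem IsCriticalFrequency.symbolDet_eq_zero (h : IsCriticalFrequency m κ c Ω)
    (hm : 0 < m) (hκ : 0 < κ) : symbolDet m κ c Ω = 0 := by
  rw [symbolDet_eq hm hκ, h.speed_eq]; ring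

theorem IsCriticalFrequency.rho_eq (h : IsCriticalFrequency m κ c Ω) :
    rho m κ Ω = 2 * (c ^ 2 * Ω ^ 2) - (1 + κ) * (1 + 1 / m) := by
  rw [h.speed_eq, lambdaPlus]; ring

theorem IsCriticalFrequency.symbolDet_pos (h : IsCriticalFrequency m κ c Ω)
    (hm : 0 < m) (hκ : 0 < κ) (hhet : 1 / m > 1 ∨ κ > 1) (hc : |c| > soundSpeed m κ)
    {K : ℝ} (hK : Ω < |K|) : 0 < symbolDet m κ c K := by
  have h1 := dispersion_strictMonoOn hm hκ hhet hc (Set.mem_Ici.2 h.1.le)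
    (Set.mem_Ici.2 (abs_nonneg K)) hK
  have h2 : lambdaPlus m κ |K| = lambdaPlus m κ K := by
    rcases abs_choice K with e | e <;> rw [e]
    exact lambdaPlus_neg _ _ _
  simp only [h.speed_eq, sub_self, h2, sq_abs] at h1
  rw [symbolDet_eq hm hκ]
  have := rho_pos hm hκ hhet K
  positivity

/-- Equivalent to (1 + κ)(1 - 1/m) < ρ. For 1/m > 1 the left side is negative; for κ > 1 its square
is strictly below `rho_sq'`. This keeps the second component of the critical mode nonzero and fixes
the sign of μ. -/
theorem IsCriticalFrequency.gap (h : IsCriticalFrequency m κ c Ω)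
    (hm : 0 < m) (hκ : 0 < κ) (hhet : 1 / m > 1 ∨ κ > 1) :
    1 + κ - c ^ 2 * Ω ^ 2 < 0 := by
  have hw : 0 < 1 / m := by positivity
  have hr := rho_sq' hm hκ Ω
  have hr0 := rho_nonneg m κ Ω
  rw [h.speed_eq, lambdaPlus]
  suffices (1 + κ) * (1 - 1 / m) < rho m κ Ω by linarith
  rcases hhet with hw1 | hk
  · have h1 : (1 + κ) * (1 - 1 / m) < 0 := by nlinarith
    linarith
  · have h1 : 0 < (1 - κ) ^ 2 := by
      have : 1 - κ ≠ 0 := by linarith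
      positivity
    have h2 : 0 < 4 * (1 / m) * ((1 - κ) ^ 2 + 4 * κ * Real.cos Ω ^ 2) := by positivity
    refine lt_of_pow_lt_pow_left₀ 2 hr0 ?_
    rw [hr, mul_pow]; linarith

end Dispersion

end Dimer

/-! ### Contractions depending on a parameter. -/

/-- A family of contractions of a closed ball depending continuously on a real parameter has a
fixed point on which a given functional vanishes, provided that this functional takes values of
opposite sign at the fixed points for the two extreme parameters. -/
theorem exists_fixedPoint_of_sign_change {E : Type*} [NormedAddCommGroup E] [CompleteSpace E]
    {F : ℝ → E → E} {ℓ : E → ℝ} {a b R : ℝ} (hab : a ≤ b) (hR : 0 ≤ R)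
    (hmaps : ∀ ξ ∈ Set.Icc a b, ∀ h, ‖h‖ ≤ R → ‖F ξ h‖ ≤ R)
    (hlip : ∀ ξ ∈ Set.Icc a b, ∀ h h', ‖h‖ ≤ R → ‖h'‖ ≤ R → ‖F ξ h - F ξ h'‖ ≤ 1 / 2 * ‖h - h'‖)
    (hcont : ∀ h, ‖h‖ ≤ R → ContinuousOn (fun ξ => F ξ h) (Set.Icc a b))
    (hℓ : Continuous ℓ)
    (ha : ∀ h, ‖h‖ ≤ R → F a h = h → ℓ h ≤ 0) (hb : ∀ h, ‖h‖ ≤ R → F b h = h → 0 ≤ ℓ h) :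
    ∃ ξ ∈ Set.Icc a b, ∃ h, ‖h‖ ≤ R ∧ F ξ h = h ∧ ℓ h = 0 := by
  have hfix : ∀ ξ ∈ Set.Icc a b, ∃ h, ‖h‖ ≤ R ∧ F ξ h = h := by
    intro ξ hξ
    have hball : ∀ h : E, h ∈ Metric.closedBall (0 : E) R ↔ ‖h‖ ≤ R := fun h => by simp
    have hmt : Set.MapsTo (F ξ) (Metric.closedBall 0 R) (Metric.closedBall 0 R) :=
      fun h hh => (hball _).2 (hmaps ξ hξ h ((hball h).1 hh))
    have hcontr : ContractingWith (1 / 2) (hmt.restrict (F ξ) _ _) := by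
      refine ⟨by rw [one_div]; exact inv_lt_one_of_one_lt₀ (by norm_num), ?_⟩
      refine LipschitzWith.of_dist_le_mul fun x y => ?_
      have := hlip ξ hξ x y ((hball _).1 x.2) ((hball _).1 y.2)
      rw [Subtype.dist_eq, Subtype.dist_eq, dist_eq_norm, dist_eq_norm]
      simpa using this
    obtain ⟨h, hh, hfix, -⟩ := hcontr.exists_fixedPoint' Metric.isClosed_closedBall.isComplete hmt
      ((hball 0).2 (by simpa using hR)) (edist_ne_top _ _)
    exact ⟨h, (hball h).1 hh, hfix⟩
  choose! H hHR hHF using hfix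
  -- The contraction constant 1/2 gives ‖H ζ - H ξ‖ ≤ 2‖F ζ (H ξ) - F ξ (H ξ)‖, so continuity of F
  -- in the parameter at each fixed h is enough.
  have hH : ContinuousOn H (Set.Icc a b) := by
    intro ξ hξ
    have h1 := hcont (H ξ) (hHR ξ hξ) ξ hξ
    rw [ContinuousWithinAt, tendsto_iff_norm_sub_tendsto_zero] at h1 ⊢
    refine squeeze_zero' (Filter.Eventually.of_forall fun _ => norm_nonneg _) ?_
      (by simpa using h1.const_mul 2)
    filter_upwards [self_mem_nhdsWithin] with ζ hζ
    have h2 := hlip ζ hζ (H ζ) (H ξ) (hHR ζ hζ) (hHR ξ hξ)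
    have h3 := norm_add_le (F ζ (H ζ) - F ζ (H ξ)) (F ζ (H ξ) - F ξ (H ξ))
    rw [sub_add_sub_cancel, hHF ζ hζ, hHF ξ hξ] at h3
    rw [hHF ζ hζ] at h2
    rw [hHF ξ hξ]
    linarith
  obtain ⟨ξ, hξ, h0⟩ := intermediate_value_Icc hab (hℓ.comp_continuousOn hH)
    (Set.mem_Icc.2 ⟨ha _ (hHR a ⟨le_rfl, hab⟩) (hHF a ⟨le_rfl, hab⟩),
      hb _ (hHR b ⟨hab, le_rfl⟩) (hHF b ⟨hab, le_rfl⟩)⟩)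
  exact ⟨ξ, hξ, H ξ, hHR ξ hξ, hHF ξ hξ, h0⟩

/-! ### Fourier coefficients, translations and multipliers on the circle. -/

open MeasureTheory

instance factTwoPiPos : Fact (0 < 2 * Real.pi) := ⟨Real.two_pi_pos⟩

/-- The circle of length `2π`. -/
abbrev Circ := AddCircle (2 * Real.pi)

/-- Continuous real functions on the circle. -/
abbrev PerFun := C(Circ, ℝ)

namespace PerFun

open AddCircle

theorem integrable_fourier_mul (u : PerFun) (k : ℤ) :
    Integrable (fun x : Circ => fourier k x * (u x : ℂ)) haarAddCircle :=
  Continuous.integrable_of_hasCompactSupport (by fun_prop) (HasCompactSupport.of_compactSpace _)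

/-- The `k`-th Fourier coefficient, as a functional on real continuous functions. -/
def coeff (k : ℤ) : PerFun →L[ℝ] ℂ :=
  LinearMap.mkContinuous
    { toFun := fun u => fourierCoeff (fun x : Circ => (u x : ℂ)) k
      map_add' := fun u v => by
        simp only [fourierCoeff, ContinuousMap.add_apply, Complex.ofReal_add, smul_eq_mul, mul_add]
        exact integral_add (integrable_fourier_mul u _) (integrable_fourier_mul v _)
      map_smul' := fun r u => by
        simp only [fourierCoeff, ContinuousMap.smul_apply, smul_eq_mul, Complex.ofReal_mul,
          RingHom.id_apply, Complex.real_smul]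
        rw [← integral_const_mul]
        congr 1; ext x; ring } 1 fun u => by
    refine (norm_integral_le_of_norm_le_const (C := ‖u‖) ?_).trans (by simp)
    refine Filter.Eventually.of_forall fun x => ?_
    simp only [smul_eq_mul, norm_mul, fourier_apply, Circle.norm_coe, one_mul, Complex.norm_real]
    exact u.norm_coe_le_norm x

theorem coeff_apply (k : ℤ) (u : PerFun) :
    coeff k u = fourierCoeff (fun x : Circ => (u x : ℂ)) k := rfl

theorem norm_coeff_le (k : ℤ) (u : PerFun) : ‖coeff k u‖ ≤ ‖u‖ := by
  simpa using (LinearMap.mkContinuous_norm_le _ zero_le_one _ : ‖coeff k‖ ≤ 1) |>.trans' le_rfl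
    |> (coeff k).le_of_opNorm_le (x := u)

theorem coeff_neg (k : ℤ) (u : PerFun) : coeff (-k) u = (starRingEnd ℂ) (coeff k u) := by
  rw [coeff_apply, coeff_apply, fourierCoeff, fourierCoeff, ← integral_conj]
  congr 1; ext x
  rw [smul_eq_mul, smul_eq_mul, map_mul, ← fourier_neg, Complex.conj_ofReal]

theorem coeff_eq_intervalIntegral (k : ℤ) (u : PerFun) (a : ℝ) :
    coeff k u = (1 / (2 * Real.pi) : ℝ) •
      ∫ x in a..a + 2 * Real.pi, Complex.exp (-(Complex.I * k * x)) * (u (x : Circ) : ℂ) := by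
  rw [coeff_apply, fourierCoeff_eq_intervalIntegral _ k a]
  congr 2; ext x
  rw [smul_eq_mul, fourier_coe_apply]
  congr 2
  have : (Real.pi : ℂ) ≠ 0 := by exact_mod_cast Real.pi_ne_zero
  push_cast
  field_simp

/-- The zero sequence is summable, so the Fourier series converges to the function. -/
theorem eq_zero_of_coeff_eq_zero {u : PerFun} (h : ∀ k, coeff k u = 0) : u = 0 := by
  set f : C(Circ, ℂ) := ⟨fun x => (u x : ℂ), by fun_prop⟩ with hf
  have h0 : fourierCoeff f = 0 := funext h
  have h1 := hasSum_fourier_series_of_summable (f := f) (by rw [h0]; exact summable_zero)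
  simp only [h0, Pi.zero_apply, zero_smul] at h1
  have h2 : f = 0 := h1.unique hasSum_zero
  ext x
  have := DFunLike.congr_fun h2 x
  simpa [hf] using this

theorem ext_coeff {u v : PerFun} (h : ∀ k, coeff k u = coeff k v) : u = v :=
  sub_eq_zero.1 (eq_zero_of_coeff_eq_zero fun k => by rw [map_sub, h, sub_self])

/-- The function `x ↦ Re (γ e^{ikx})`. -/
def reMode (k : ℤ) : ℂ →L[ℝ] PerFun :=
  LinearMap.mkContinuous
    { toFun := fun γ => ⟨fun x => (γ * fourier k x).re, by fun_prop⟩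
      map_add' := fun γ δ => by ext x; simp [add_mul]
      map_smul' := fun r γ => by ext x; simp [mul_assoc] } 1 fun γ => by
    rw [one_mul, ContinuousMap.norm_le _ (norm_nonneg _)]
    intro x
    refine (Complex.abs_re_le_norm _).trans ?_
    rw [norm_mul, fourier_apply, Circle.norm_coe, mul_one]

theorem reMode_apply (k : ℤ) (γ : ℂ) (x : Circ) : reMode k γ x = (γ * fourier k x).re := rfl

theorem reMode_coe (k : ℤ) (γ : ℂ) (x : ℝ) :
    reMode k γ (x : Circ) = (γ * Complex.exp (Complex.I * k * x)).re := by
  rw [reMode_apply, fourier_coe_apply]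
  congr 3
  have : (Real.pi : ℂ) ≠ 0 := by exact_mod_cast Real.pi_ne_zero
  push_cast
  field_simp

theorem norm_reMode_le (k : ℤ) (γ : ℂ) : ‖reMode k γ‖ ≤ ‖γ‖ := by
  simpa using (reMode k).le_of_opNorm_le (LinearMap.mkContinuous_norm_le _ zero_le_one _) γ

/-- Taking the real part splits γe^{ikx} evenly between the modes k and -k; for k = 0 both terms
contribute and leave Re γ. -/
theorem coeff_reMode (j k : ℤ) (γ : ℂ) :
    coeff j (reMode k γ) =
      ((if j = k then γ else 0) + (if j = -k then (starRingEnd ℂ) γ else 0)) / 2 := by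
  have h : (fun x : Circ => ((reMode k γ x : ℝ) : ℂ)) =
      (γ / 2) • (fourier k : Circ → ℂ) +
        ((starRingEnd ℂ) γ / 2) • (fourier (-k) : Circ → ℂ) := by
    ext x
    rw [reMode_apply, Complex.re_eq_add_conj, map_mul, ← fourier_neg]
    simp only [Pi.add_apply, Pi.smul_apply, smul_eq_mul]
    ring
  have hint : ∀ (δ : ℂ) (n : ℤ), Integrable (δ • (fourier n : Circ → ℂ)) haarAddCircle :=
    fun δ n => Continuous.integrable_of_hasCompactSupport
      (by simpa [Pi.smul_def] using (map_continuous (fourier n)).const_smul δ)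
      (HasCompactSupport.of_compactSpace _)
  rw [coeff_apply, h, fourierCoeff.add (hint _ _) (hint _ _), Pi.add_apply,
    fourierCoeff.const_smul, fourierCoeff.const_smul, fourierCoeff_fourier, fourierCoeff_fourier]
  simp only [Pi.single_apply, smul_eq_mul, mul_ite, mul_one, mul_zero]
  split_ifs <;> ring

/-- The translation `u ↦ u (· + t)`. -/
def shift (t : ℝ) : PerFun →L[ℝ] PerFun :=
  LinearMap.mkContinuous
    { toFun := fun u => u.comp ⟨fun x : Circ => x + (t : Circ), by fun_prop⟩
      map_add' := fun _ _ => rfl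
      map_smul' := fun _ _ => rfl } 1 fun u => by
    rw [one_mul, ContinuousMap.norm_le _ (norm_nonneg _)]
    exact fun x => u.norm_coe_le_norm _

theorem shift_apply (t : ℝ) (u : PerFun) (x : Circ) : shift t u x = u (x + (t : Circ)) := rfl

theorem shift_coe (t : ℝ) (u : PerFun) (x : ℝ) : shift t u (x : Circ) = u ((x + t : ℝ) : Circ) := by
  rw [shift_apply, AddCircle.coe_add]

theorem norm_shift_le (t : ℝ) (u : PerFun) : ‖shift t u‖ ≤ ‖u‖ := by
  simpa using (shift t).le_of_opNorm_le (LinearMap.mkContinuous_norm_le _ zero_le_one _) u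

theorem shift_add (s t : ℝ) (u : PerFun) : shift s (shift t u) = shift (s + t) u := by
  ext x; simp [shift_apply, add_assoc]

theorem shift_reMode (t : ℝ) (k : ℤ) (γ : ℂ) :
    shift t (reMode k γ) = reMode k (Complex.exp (Complex.I * k * t) * γ) := by
  ext x
  induction x using QuotientAddGroup.induction_on with
  | H x =>
    change shift t (reMode k γ) (x : Circ) = reMode k _ (x : Circ)
    rw [shift_coe, reMode_coe, reMode_coe]
    push_cast
    rw [mul_add, Complex.exp_add]
    ring_nf

theorem coeff_shift (k : ℤ) (t : ℝ) (u : PerFun) :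
    coeff k (shift t u) = Complex.exp (Complex.I * k * t) * coeff k u := by
  rw [coeff_apply, coeff_apply, fourierCoeff, fourierCoeff, ← integral_const_mul]
  refine Eq.trans ?_ (integral_add_right_eq_self _ (t : Circ))
  congr 1
  ext x
  have h : Complex.exp (Complex.I * k * t) * fourier (-k) (t : Circ) = 1 := by
    rw [fourier_coe_apply, ← Complex.exp_add, ← Complex.exp_zero]
    congr 1
    have : (Real.pi : ℂ) ≠ 0 := by exact_mod_cast Real.pi_ne_zero
    push_cast
    field_simp
    ring
  have h2 : fourier (-k) (x + (t : Circ)) = fourier (-k) x * fourier (-k) (t : Circ) := by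
    simp only [fourier_apply, smul_add, toCircle_add, Circle.coe_mul]
  rw [smul_eq_mul, smul_eq_mul, h2, shift_apply]
  linear_combination (- fourier (-k) x * (u (x + (t : Circ)) : ℂ)) * h

theorem continuous_shift (u : PerFun) : Continuous fun t : ℝ => shift t u := by
  have hc : Continuous fun p : ℝ × Circ => u (p.2 + (p.1 : Circ)) :=
    u.continuous.comp (continuous_snd.add ((AddCircle.continuous_mk' _).comp continuous_fst))
  exact (ContinuousMap.curry ⟨_, hc⟩).continuous

/-- The single-mode operator `u ↦ Re (a û(k) e^{ikx})`. -/
def modeOp (a : ℂ) (k : ℤ) : PerFun →L[ℝ] PerFun :=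
  (reMode k).comp ((ContinuousLinearMap.mul ℝ ℂ a).comp (coeff k))

theorem modeOp_apply (a : ℂ) (k : ℤ) (u : PerFun) :
    modeOp a k u = reMode k (a * coeff k u) := rfl

theorem norm_modeOp_le (a : ℂ) (k : ℤ) : ‖modeOp a k‖ ≤ ‖a‖ := by
  refine ContinuousLinearMap.opNorm_le_bound _ (norm_nonneg _) fun u => ?_
  refine (norm_reMode_le _ _).trans ?_
  change ‖a * coeff k u‖ ≤ _
  rw [norm_mul]
  gcongr
  exact norm_coeff_le _ _

/-- The operator with Fourier symbol `α`, for summable `α` with `α (-k) = conj (α k)`. -/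
def multiplier (α : ℤ → ℂ) : PerFun →L[ℝ] PerFun :=
  ∑' k : ℤ, modeOp (α k) k

variable {α : ℤ → ℂ}

theorem summable_modeOp (hα : Summable fun k => ‖α k‖) : Summable fun k => modeOp (α k) k :=
  Summable.of_norm_bounded (E := PerFun →L[ℝ] PerFun) hα fun k => norm_modeOp_le (α k) k

theorem norm_multiplier_le (hα : Summable fun k => ‖α k‖) :
    ‖multiplier α‖ ≤ ∑' k, ‖α k‖ :=
  tsum_of_norm_bounded (E := PerFun →L[ℝ] PerFun) hα.hasSum fun k => norm_modeOp_le (α k) k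

theorem hasSum_multiplier (hα : Summable fun k => ‖α k‖) (u : PerFun) :
    HasSum (fun k => modeOp (α k) k u) (multiplier α u) :=
  (summable_modeOp hα).hasSum.mapL (ContinuousLinearMap.apply ℝ PerFun u)

/-- Mode j receives one half from the summand k = j and one half from k = -j; the conjugation
symmetry of α makes the halves equal. -/
theorem coeff_multiplier (hα : Summable fun k => ‖α k‖)
    (hconj : ∀ k, α (-k) = (starRingEnd ℂ) (α k)) (j : ℤ) (u : PerFun) :
    coeff j (multiplier α u) = α j * coeff j u := by
  have h1 := (hasSum_multiplier hα u).mapL (coeff j)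
  have h2 : ∀ k, coeff j (modeOp (α k) k u) =
      (if k = j then α j * coeff j u / 2 else 0) + (if k = -j then α j * coeff j u / 2 else 0) := by
    intro k
    rw [modeOp_apply, coeff_reMode, add_div]
    congr 1
    · by_cases h : k = j
      · simp [h]
      · simp [h, Ne.symm h]
    · by_cases h : k = -j
      · subst h; simp [hconj, coeff_neg]
      · have : ¬ j = -k := fun e => h (by rw [e, neg_neg])
        simp [h, this]
  have h3 := (hasSum_ite_eq j (α j * coeff j u / 2)).add
    (hasSum_ite_eq (-j) (α j * coeff j u / 2))
  rw [add_halves] at h3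
  simp_rw [h2] at h1
  exact h1.unique h3

/-- Behind a summable symbol, translation becomes continuous in operator norm: the difference has
symbol (e^{ikt} - 1)α k, and the ℓ¹ norm of this tends to zero by dominated convergence. -/
theorem norm_shift_multiplier_sub_le (hα : Summable fun k => ‖α k‖)
    (hconj : ∀ k, α (-k) = (starRingEnd ℂ) (α k)) {ε : ℝ} (hε : 0 < ε) :
    ∀ᶠ t in 𝓝 (0 : ℝ), ∀ u, ‖shift t (multiplier α u) - multiplier α u‖ ≤ ε * ‖u‖ := by
  set β : ℝ → ℤ → ℂ := fun t k => (Complex.exp (Complex.I * k * t) - 1) * α k with hβ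
  have hb : ∀ t k, ‖β t k‖ ≤ 2 * ‖α k‖ := by
    intro t k
    rw [hβ, norm_mul]
    gcongr
    refine (norm_sub_le _ _).trans ?_
    rw [show Complex.I * k * t = ((k * t : ℝ) : ℂ) * Complex.I by push_cast; ring,
      Complex.norm_exp_ofReal_mul_I]
    norm_num
  have hsum : ∀ t, Summable fun k => ‖β t k‖ := fun t =>
    Summable.of_nonneg_of_le (fun _ => norm_nonneg _) (hb t) (hα.mul_left 2)
  have hβconj : ∀ t k, β t (-k) = (starRingEnd ℂ) (β t k) := by
    intro t k
    simp only [hβ, map_mul, map_sub, map_one, hconj, ← Complex.exp_conj, Complex.conj_I,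
      Complex.conj_ofReal, map_intCast]
    push_cast
    ring_nf
  have heq : ∀ t u, shift t (multiplier α u) - multiplier α u = multiplier (β t) u := by
    intro t u
    refine ext_coeff fun k => ?_
    rw [map_sub, coeff_shift, coeff_multiplier hα hconj, coeff_multiplier (hsum t) (hβconj t)]
    ring
  have hlim : Filter.Tendsto (fun t => ∑' k, ‖β t k‖) (𝓝 0) (𝓝 (∑' k : ℤ, (0 : ℝ))) := by
    refine tendsto_tsum_of_dominated_convergence (hα.mul_left 2) (fun k => ?_)
      (Filter.Eventually.of_forall fun t k => by rw [norm_norm]; exact hb t k)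
    have hc : Continuous fun t => ‖β t k‖ := by simp only [hβ]; fun_prop
    simpa [hβ] using hc.tendsto 0
  rw [tsum_zero] at hlim
  filter_upwards [hlim.eventually (gt_mem_nhds hε)] with t ht u
  rw [heq]
  exact ((multiplier (β t)).le_of_opNorm_le ((norm_multiplier_le (hsum t)).trans ht.le)) u

end PerFun

/-! ### Differentiation read off from Fourier coefficients. -/

namespace PerFun

open AddCircle

/-- The function on the circle with a given continuous periodic lift. -/
def ofPeriodic (f : ℝ → ℝ) (hf : Continuous f) (hp : Function.Periodic f (2 * Real.pi)) : PerFun :=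
  ⟨hp.lift, hf.quotient_liftOn' _⟩

@[simp] theorem ofPeriodic_coe {f : ℝ → ℝ} (hf : Continuous f)
    (hp : Function.Periodic f (2 * Real.pi)) (x : ℝ) : ofPeriodic f hf hp (x : Circ) = f x := rfl

theorem continuous_lift (u : PerFun) : Continuous fun x : ℝ => u (x : Circ) :=
  u.continuous.comp (AddCircle.continuous_mk' _)

theorem periodic_lift (u : PerFun) : Function.Periodic (fun x : ℝ => u (x : Circ)) (2 * Real.pi) :=
  fun x => by simp only [AddCircle.coe_add_period]

theorem abs_lift_le (u : PerFun) (x : ℝ) : |u (x : Circ)| ≤ ‖u‖ := u.norm_coe_le_norm _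

theorem coeff_eq_integral (k : ℤ) (u : PerFun) :
    coeff k u = (1 / (2 * Real.pi) : ℝ) •
      ∫ x in (-Real.pi)..Real.pi, Complex.exp (-(Complex.I * k * x)) * (u (x : Circ) : ℂ) := by
  rw [coeff_eq_intervalIntegral k u (-Real.pi)]
  congr 3
  ring

theorem coeff_zero_eq_integral (u : PerFun) :
    coeff 0 u = ((1 / (2 * Real.pi) * ∫ x in (-Real.pi)..Real.pi, u (x : Circ) : ℝ) : ℂ) := by
  rw [coeff_eq_integral]
  simp only [Int.cast_zero, mul_zero, zero_mul, neg_zero, Complex.exp_zero, one_mul]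
  rw [intervalIntegral.integral_ofReal, Complex.real_smul]
  push_cast
  ring

theorem coeff_zero_reMode_self (u : PerFun) : coeff 0 (reMode 0 (coeff 0 u)) = coeff 0 u := by
  have hc := coeff_neg 0 u
  rw [neg_zero] at hc
  rw [coeff_reMode, neg_zero, if_pos rfl, if_pos rfl, ← hc]
  ring

theorem integral_reMode_mul (k : ℤ) (γ : ℂ) (u : PerFun) :
    ∫ x in (-Real.pi)..Real.pi, reMode k γ (x : Circ) * u (x : Circ) =
      2 * Real.pi * (γ * coeff (-k) u).re := by
  have hi : IntervalIntegrable (fun x : ℝ => γ * (Complex.exp (-(Complex.I * ((-k : ℤ) : ℂ) * x)) *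
      (u (x : Circ) : ℂ))) MeasureTheory.volume (-Real.pi) Real.pi := by
    have := continuous_lift u
    exact Continuous.intervalIntegrable (by fun_prop) _ _
  have h := Complex.reCLM.intervalIntegral_comp_comm hi
  rw [coeff_eq_integral, mul_smul_comm, Complex.real_smul, Complex.re_ofReal_mul,
    ← intervalIntegral.integral_const_mul]
  simp only [Complex.reCLM_apply] at h
  rw [← h, ← mul_assoc, mul_one_div_cancel (by positivity), one_mul]
  congr 1
  ext x
  rw [reMode_coe, ← mul_assoc, Complex.re_mul_ofReal]
  push_cast
  ring_nf

/-- Integration by parts over a period, where the boundary terms cancel. -/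
theorem coeff_of_hasDerivAt {u g : PerFun}
    (h : ∀ x : ℝ, HasDerivAt (fun y : ℝ => u (y : Circ)) (g (x : Circ)) x) (k : ℤ) :
    coeff k g = Complex.I * k * coeff k u := by
  set e : ℝ → ℂ := fun x => Complex.exp (-(Complex.I * k * x)) with he
  have hu := continuous_lift u
  have hg := continuous_lift g
  have hec : Continuous e := by simp only [he]; fun_prop
  have hed : ∀ x : ℝ, HasDerivAt e (-(Complex.I * k) * e x) x := by
    intro x
    have h1 : HasDerivAt (fun x : ℂ => Complex.exp (-(Complex.I * k * x)))
        (Complex.exp (-(Complex.I * k * x)) * -(Complex.I * k * 1)) (x : ℂ) :=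
      ((hasDerivAt_id (x : ℂ)).const_mul (Complex.I * k)).neg.cexp
    exact h1.comp_ofReal.congr_deriv (by simp only [he]; ring)
  have hprod : ∀ x : ℝ, HasDerivAt (fun x : ℝ => e x * (u (x : Circ) : ℂ))
      (-(Complex.I * k) * (e x * (u (x : Circ) : ℂ)) + e x * (g (x : Circ) : ℂ)) x := by
    intro x
    exact ((hed x).mul (h x).ofReal_comp).congr_deriv (by ring)
  have hint := intervalIntegral.integral_eq_sub_of_hasDerivAt (a := -Real.pi) (b := Real.pi)
    (fun x _ => hprod x) (Continuous.intervalIntegrable (by fun_prop) _ _)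
  have hends : e Real.pi * (u (Real.pi : Circ) : ℂ) - e (-Real.pi) * (u ((-Real.pi : ℝ) : Circ) : ℂ)
      = 0 := by
    have h1 : u (Real.pi : Circ) = u ((-Real.pi : ℝ) : Circ) := by
      have := periodic_lift u (-Real.pi)
      simp only at this
      rw [← this]; congr 2; ring
    have h2 : e Real.pi = e (-Real.pi) := by
      simp only [he]
      rw [Complex.exp_eq_exp_iff_exists_int]
      exact ⟨-k, by push_cast; ring⟩
    rw [h1, h2, sub_self]
  rw [hends, intervalIntegral.integral_add (Continuous.intervalIntegrable (by fun_prop) _ _)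
    (Continuous.intervalIntegrable (by fun_prop) _ _), intervalIntegral.integral_const_mul] at hint
  rw [coeff_eq_integral, coeff_eq_integral, mul_smul_comm]
  congr 1
  linear_combination hint

/-- Zero mean is what makes the primitive periodic; subtracting its own mean normalizes it. -/
theorem exists_antideriv {g : PerFun} (hg : coeff 0 g = 0) :
    ∃ v : PerFun, coeff 0 v = 0 ∧
      ∀ x : ℝ, HasDerivAt (fun y : ℝ => v (y : Circ)) (g (x : Circ)) x := by
  have hgc := continuous_lift g
  set f : ℝ → ℝ := fun x => ∫ y in (0 : ℝ)..x, g (y : Circ) with hf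
  have hd : ∀ x : ℝ, HasDerivAt f (g (x : Circ)) x := fun x =>
    intervalIntegral.integral_hasDerivAt_right (hgc.intervalIntegrable _ _)
      (hgc.stronglyMeasurableAtFilter _ _) hgc.continuousAt
  have hzero : ∫ x in (-Real.pi)..Real.pi, g (x : Circ) = 0 := by
    rw [coeff_zero_eq_integral, Complex.ofReal_eq_zero] at hg
    exact (mul_eq_zero.1 hg).resolve_left (by positivity)
  have hp : Function.Periodic f (2 * Real.pi) := by
    intro x
    have h1 := (periodic_lift g).intervalIntegral_add_eq x (-Real.pi)
    rw [show -Real.pi + 2 * Real.pi = Real.pi by ring, hzero] at h1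
    simp only [hf]
    rw [← intervalIntegral.integral_add_adjacent_intervals (hgc.intervalIntegrable 0 x)
      (hgc.intervalIntegrable x (x + 2 * Real.pi)), h1, add_zero]
  set v₀ := ofPeriodic f (continuous_iff_continuousAt.2 fun x => (hd x).continuousAt) hp with hv₀
  refine ⟨v₀ - reMode 0 (coeff 0 v₀), ?_, fun x => ?_⟩
  · rw [map_sub, coeff_zero_reMode_self, sub_self]
  · have : (fun y : ℝ => (v₀ - reMode 0 (coeff 0 v₀)) (y : Circ)) =
        fun y => f y - (coeff 0 v₀).re := by
      ext y
      simp [hv₀, reMode_coe]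
    rw [this]
    exact (hd x).sub_const _

/-- The periodic primitive of g has the same coefficients as u except possibly the mean, and a
constant does not affect the derivative. -/
theorem hasDerivAt_of_coeff {u g : PerFun} (h : ∀ k, coeff k g = Complex.I * k * coeff k u)
    (x : ℝ) : HasDerivAt (fun y : ℝ => u (y : Circ)) (g (x : Circ)) x := by
  obtain ⟨v, hv0, hv⟩ := exists_antideriv (g := g) (by rw [h]; simp)
  have hu : u = v + reMode 0 (coeff 0 u) := by
    refine ext_coeff fun k => ?_
    rw [map_add, coeff_reMode]
    rcases eq_or_ne k 0 with rfl | hk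
    · rw [hv0, ← coeff_reMode, coeff_zero_reMode_self, zero_add]
    · have h1 := coeff_of_hasDerivAt hv k
      rw [h] at h1
      have : Complex.I * (k : ℂ) ≠ 0 := by simp [hk]
      simp [hk, mul_left_cancel₀ this h1]
  have : (fun y : ℝ => u (y : Circ)) = fun y : ℝ => v (y : Circ) + (coeff 0 u).re := by
    ext y
    conv_lhs => rw [hu]
    simp [reMode_coe]
  rw [this]
  exact (hv x).add_const _

/-- A distributional second derivative that is continuous is a classical one. -/
theorem exists_deriv_of_coeff {u g : PerFun} (h : ∀ k : ℤ, coeff k g = -(k : ℂ) ^ 2 * coeff k u) :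
    ∃ v : PerFun, (∀ x : ℝ, HasDerivAt (fun y : ℝ => u (y : Circ)) (v (x : Circ)) x) ∧
      ∀ x : ℝ, HasDerivAt (fun y : ℝ => v (y : Circ)) (g (x : Circ)) x := by
  obtain ⟨v, hv0, hv⟩ := exists_antideriv (g := g) (by rw [h]; simp)
  refine ⟨v, hasDerivAt_of_coeff fun k => ?_, hv⟩
  rcases eq_or_ne k 0 with rfl | hk
  · simp [hv0]
  · have h1 := coeff_of_hasDerivAt hv k
    have h2 : Complex.I * (k : ℂ) ≠ 0 := by simp [hk]
    refine mul_left_cancel₀ h2 ?_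
    rw [← h1, h]
    linear_combination (- (k : ℂ) ^ 2 * coeff k u) * Complex.I_sq

end PerFun

/-! ### The linearized operator and its generalized inverse. -/

namespace Dimer

open PerFun

/-- The off-diagonal entry of the dispersion matrix. -/
def coupling (κ K : ℝ) : ℂ := Complex.exp (Complex.I * K) + κ * Complex.exp (-(Complex.I * K))

theorem conj_coupling (κ K : ℝ) : (starRingEnd ℂ) (coupling κ K) = coupling κ (-K) := by
  simp only [coupling, map_add, map_mul, ← Complex.exp_conj, map_neg, Complex.conj_I,
    Complex.conj_ofReal]
  push_cast
  ring_nf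

theorem coupling_mul_neg (κ K : ℝ) :
    coupling κ K * coupling κ (-K) = (((1 + κ) ^ 2 - 4 * κ * Real.sin K ^ 2 : ℝ) : ℂ) := by
  have h1 : Complex.exp (Complex.I * K) = Complex.cos K + Complex.sin K * Complex.I := by
    rw [mul_comm, Complex.exp_mul_I]
  have h2 : Complex.exp (-(Complex.I * K)) = Complex.cos K - Complex.sin K * Complex.I := by
    rw [← mul_neg, mul_comm, Complex.exp_mul_I, Complex.cos_neg, Complex.sin_neg]; ring
  simp only [coupling, Complex.ofReal_neg, mul_neg, neg_neg, h1, h2]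
  push_cast
  linear_combination (1 + κ) ^ 2 * Complex.cos_sq_add_sin_sq (K : ℂ)
    - (1 - κ) ^ 2 * Complex.sin (K : ℂ) ^ 2 * Complex.I_sq

theorem norm_coupling_le {κ : ℝ} (hκ : 0 < κ) (K : ℝ) : ‖coupling κ K‖ ≤ 1 + κ := by
  have h : ∀ y : ℝ, ‖Complex.exp (Complex.I * y)‖ = 1 := fun y => by
    rw [mul_comm, Complex.norm_exp_ofReal_mul_I]
  refine (norm_add_le _ _).trans ?_
  have h2 : -(Complex.I * (K : ℂ)) = Complex.I * ((-K : ℝ) : ℂ) := by push_cast; ring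
  rw [norm_mul, h2, h, h, Complex.norm_real, Real.norm_of_nonneg hκ.le, mul_one]

/-- First component of the linearized forces, for lattice spacing `t`. -/
def linForce₁ (κ t : ℝ) (φ : PerFun × PerFun) : PerFun :=
  shift t φ.2 + κ • shift (-t) φ.2 - (1 + κ) • φ.1

/-- Second component of the linearized forces, for lattice spacing `t`. -/
def linForce₂ (κ t : ℝ) (φ : PerFun × PerFun) : PerFun :=
  κ • shift t φ.1 + shift (-t) φ.1 - (1 + κ) • φ.2

theorem coeff_linForce₁ (κ t : ℝ) (φ : PerFun × PerFun) (k : ℤ) :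
    coeff k (linForce₁ κ t φ) = coupling κ (k * t) * coeff k φ.2 - (1 + κ) * coeff k φ.1 := by
  simp only [linForce₁, map_sub, map_add, map_smul, coeff_shift, coupling, Complex.real_smul]
  push_cast
  ring_nf

theorem coeff_linForce₂ (κ t : ℝ) (φ : PerFun × PerFun) (k : ℤ) :
    coeff k (linForce₂ κ t φ) = coupling κ (-(k * t)) * coeff k φ.1 - (1 + κ) * coeff k φ.2 := by
  simp only [linForce₂, map_sub, map_add, map_smul, coeff_shift, coupling, Complex.real_smul]
  push_cast
  ring_nf

section Symbol

variable (m κ c Ω : ℝ)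

/-- In mode k, the system c²ψ₁'' = f₁ + Ω⁻²L₁ψ, c²mψ₂'' = f₂ + Ω⁻²L₂ψ reads Ω²f + Mψ = 0, with M
Hermitian, diagonal entries `diag₁`, `diag₂` and off-diagonal entries `coupling κ (±kΩ)`. -/
def diag₁ (k : ℤ) : ℝ := c ^ 2 * (k * Ω) ^ 2 - (1 + κ)

def diag₂ (k : ℤ) : ℝ := c ^ 2 * m * (k * Ω) ^ 2 - (1 + κ)

/-- An entry of the symbol of the generalized inverse: on the modes `0` and `±1`, where the
symbol of the linearization is a Hermitian matrix of rank one, it is the entry `x` of that matrix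
over the square of its trace, and otherwise the entry `y` of the adjugate over the determinant. -/
def invSymbol (x y : ℤ → ℂ) (k : ℤ) : ℂ :=
  -(Ω : ℂ) ^ 2 * if |k| ≤ 1 then x k / ((diag₁ κ c Ω k + diag₂ m κ c Ω k : ℝ) : ℂ) ^ 2
    else y k / ((m * symbolDet m κ c (k * Ω) : ℝ) : ℂ)

variable {m κ c Ω}

theorem det_eq (hm : 0 < m) (k : ℤ) :
    (diag₁ κ c Ω k * diag₂ m κ c Ω k : ℂ) - coupling κ (k * Ω) * coupling κ (-(k * Ω)) =
      ((m * symbolDet m κ c (k * Ω) : ℝ) : ℂ) := by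
  rw [coupling_mul_neg]
  norm_cast
  simp only [diag₁, diag₂, symbolDet]
  field_simp
  ring

theorem diag₁_neg (k : ℤ) : diag₁ κ c Ω (-k) = diag₁ κ c Ω k := by
  simp [diag₁]

theorem diag₂_neg (k : ℤ) : diag₂ m κ c Ω (-k) = diag₂ m κ c Ω k := by
  simp [diag₂]

theorem invSymbol_neg {x y : ℤ → ℂ} (hx : ∀ k, x (-k) = (starRingEnd ℂ) (x k))
    (hy : ∀ k, y (-k) = (starRingEnd ℂ) (y k)) (k : ℤ) :
    invSymbol m κ c Ω x y (-k) = (starRingEnd ℂ) (invSymbol m κ c Ω x y k) := by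
  simp only [invSymbol, abs_neg, hx, hy, diag₁_neg, diag₂_neg, map_mul, map_neg, map_pow,
    Complex.conj_ofReal]
  congr 1
  split_ifs
  · rw [map_div₀, map_pow, Complex.conj_ofReal]
  · rw [map_div₀, Complex.conj_ofReal]
    simp [symbolDet]

/-- The determinant grows like k⁴ and the numerator at most like k², so the symbol is O(1/k²). -/
theorem summable_invSymbol (hm : 0 < m) (hκ : 0 < κ) (hc : 0 < c ^ 2) (hΩ : 0 < Ω)
    (x y : ℤ → ℂ) {C : ℝ} (hC : 0 ≤ C) (hy : ∀ k, k ≠ 0 → ‖y k‖ ≤ C * (k : ℝ) ^ 2) :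
    Summable fun k => ‖invSymbol m κ c Ω x y k‖ := by
  set l := c ^ 2 * Ω ^ 2 with hl
  have hl0 : 0 < l := by positivity
  set S := (1 + κ) * (1 + 1 / m) with hS
  have hsum : Summable fun k : ℤ => Ω ^ 2 * (2 * C / (m * l ^ 2)) * (1 / (k : ℝ) ^ 2) :=
    (Real.summable_one_div_int_pow.2 one_lt_two).mul_left _
  have hbig : ∀ᶠ k : ℤ in Filter.cofinite, 2 * S / l ≤ (k : ℝ) ^ 2 ∧ 1 < |k| := by
    have h1 : Filter.Tendsto (fun k : ℤ => |(k : ℝ)|) Filter.cofinite Filter.atTop := by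
      exact tendsto_norm_cocompact_atTop.comp Int.tendsto_coe_cofinite
    filter_upwards [h1.eventually_ge_atTop (2 * S / l + 1), h1.eventually_gt_atTop 1]
      with k hk hk1
    constructor
    · have h0 : 0 ≤ 2 * S / l := by positivity
      rw [← sq_abs]
      nlinarith
    · exact_mod_cast hk1
  refine Summable.of_norm_bounded_eventually hsum ?_
  filter_upwards [hbig] with k ⟨hk, hk1⟩
  have hk0 : k ≠ 0 := by rintro rfl; simp at hk1
  have hkpos : (0 : ℝ) < (k : ℝ) ^ 2 := by
    have : (k : ℝ) ≠ 0 := by exact_mod_cast hk0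
    positivity
  -- Once lk² ≥ 2S, half of the quartic term absorbs the term -S·lk².
  have hdet : l ^ 2 * (k : ℝ) ^ 4 / 2 ≤ symbolDet m κ c (k * Ω) := by
    have h1 : c ^ 2 * (k * Ω) ^ 2 = l * (k : ℝ) ^ 2 := by rw [hl]; ring
    have h2 : 2 * S ≤ l * (k : ℝ) ^ 2 := by
      rw [div_le_iff₀ hl0] at hk; linarith
    have h3 : 0 ≤ 4 * κ * (1 / m) * Real.sin (k * Ω) ^ 2 := by positivity
    rw [symbolDet, h1, ← hS]
    nlinarith [mul_le_mul_of_nonneg_right h2 (by positivity : 0 ≤ l * (k : ℝ) ^ 2)]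
  have hdet0 : 0 < symbolDet m κ c (k * Ω) := lt_of_lt_of_le (by positivity) hdet
  rw [norm_norm, invSymbol, if_neg (not_le.2 hk1), norm_mul, norm_neg, norm_pow, Complex.norm_real,
    Real.norm_of_nonneg hΩ.le, norm_div, Complex.norm_real, Real.norm_of_nonneg (by positivity),
    mul_assoc]
  gcongr
  calc ‖y k‖ / (m * symbolDet m κ c (k * Ω))
      ≤ C * (k : ℝ) ^ 2 / (m * (l ^ 2 * (k : ℝ) ^ 4 / 2)) := by
        gcongr
        exact hy k hk0
    _ = _ := by field_simp

end Symbol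

variable {m κ c Ω : ℝ}

theorem IsCriticalFrequency.coupling_mul (h : IsCriticalFrequency m κ c Ω)
    (hm : 0 < m) (hκ : 0 < κ) :
    coupling κ Ω * coupling κ (-Ω) = (diag₁ κ c Ω 1 * diag₂ m κ c Ω 1 : ℂ) := by
  have := det_eq (κ := κ) (c := c) (Ω := Ω) hm 1
  simp only [Int.cast_one, one_mul, h.symbolDet_eq_zero hm hκ, mul_zero, Complex.ofReal_zero] at this
  linear_combination -this

theorem IsCriticalFrequency.diag₁_pos (h : IsCriticalFrequency m κ c Ω)
    (hm : 0 < m) (hκ : 0 < κ) (hhet : 1 / m > 1 ∨ κ > 1) : 0 < diag₁ κ c Ω 1 := by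
  have := h.gap hm hκ hhet
  simp only [diag₁, Int.cast_one, one_mul]
  linarith

/-- The product of the diagonal entries is |`coupling`|² ≥ 0 because the determinant vanishes, and
the first entry is positive. Hence the trace, by which the pseudoinverse divides, is positive. -/
theorem IsCriticalFrequency.diag₂_nonneg (h : IsCriticalFrequency m κ c Ω)
    (hm : 0 < m) (hκ : 0 < κ) (hhet : 1 / m > 1 ∨ κ > 1) : 0 ≤ diag₂ m κ c Ω 1 := by
  have h1 := h.diag₁_pos hm hκ hhet
  have h2 := h.coupling_mul hm hκ
  rw [← conj_coupling, Complex.mul_conj] at h2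
  have h3 : Complex.normSq (coupling κ Ω) = diag₁ κ c Ω 1 * diag₂ m κ c Ω 1 := by exact_mod_cast h2
  exact nonneg_of_mul_nonneg_right (h3 ▸ Complex.normSq_nonneg _) h1

section Residuals

variable {n₁ n₂ b b' x y D W p r : ℂ}

theorem adjugate_residual₁ (hD : D ≠ 0) (h : n₁ * n₂ - b * b' = D) :
    W * x + n₁ * (-W * (n₂ / D) * x + -W * (-b / D) * y)
      + b * (-W * (-b' / D) * x + -W * (n₁ / D) * y) = 0 := by
  field_simp
  linear_combination (-(W * x)) * h

theorem adjugate_residual₂ (hD : D ≠ 0) (h : n₁ * n₂ - b * b' = D) :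
    W * y + b' * (-W * (n₂ / D) * x + -W * (-b / D) * y)
      + n₂ * (-W * (-b' / D) * x + -W * (n₁ / D) * y) = 0 := by
  field_simp
  linear_combination (-(W * y)) * h

/-- A Hermitian rank-one matrix M has pseudoinverse M/(tr M)². What is left over is the projection
onto the kernel, spanned by (b, -p), whose squared length is |b|² + p² = p(p + r). -/
theorem rankOne_residual₁ (hp : p ≠ 0) (hpr : p + r ≠ 0) (h : b * b' = p * r) :
    W * x + p * (-W * (p / (p + r) ^ 2) * x + -W * (b / (p + r) ^ 2) * y)
      + b * (-W * (b' / (p + r) ^ 2) * x + -W * (r / (p + r) ^ 2) * y) =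
        W * (b * (b' * x + -p * y) / (p * (p + r))) := by
  field_simp
  linear_combination (-(2 * p + r) * W * x) * h

theorem rankOne_residual₂ (hp : p ≠ 0) (hpr : p + r ≠ 0) (h : b * b' = p * r) :
    W * y + b' * (-W * (p / (p + r) ^ 2) * x + -W * (b / (p + r) ^ 2) * y)
      + r * (-W * (b' / (p + r) ^ 2) * x + -W * (r / (p + r) ^ 2) * y) =
        W * (-p * (b' * x + -p * y) / (p * (p + r))) := by
  field_simp
  linear_combination (-W * y) * h

end Residuals

/-- A bounded generalized inverse of the linearization at the critical frequency, whose range is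
orthogonal to the critical mode. -/
theorem IsCriticalFrequency.exists_generalizedInverse (h : IsCriticalFrequency m κ c Ω)
    (hm : 0 < m) (hκ : 0 < κ) (hhet : 1 / m > 1 ∨ κ > 1) (hc : |c| > soundSpeed m κ) :
    ∃ G : PerFun × PerFun →L[ℝ] PerFun × PerFun,
      (∀ ε > 0, ∀ᶠ t in 𝓝 (0 : ℝ), ∀ f,
        ‖shift t (G f).1 - (G f).1‖ ≤ ε * ‖f‖ ∧ ‖shift t (G f).2 - (G f).2‖ ≤ ε * ‖f‖) ∧
      (∀ f, coupling κ (-Ω) * coeff 1 (G f).1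
        + ((1 + κ - c ^ 2 * Ω ^ 2 : ℝ) : ℂ) * coeff 1 (G f).2 = 0) ∧
      ∀ f : PerFun × PerFun, coeff 0 f.1 + coeff 0 f.2 = 0 →
        (coupling κ (-Ω) * coeff 1 f.1
          + ((1 + κ - c ^ 2 * Ω ^ 2 : ℝ) : ℂ) * coeff 1 f.2).re = 0 →
        ∃ s : ℝ, ∀ k : ℤ,
          coeff k ((c ^ 2)⁻¹ • (f.1 + (Ω ^ 2)⁻¹ • linForce₁ κ Ω (G f)
            - s • reMode 1 (Complex.I * coupling κ Ω))) = -(k : ℂ) ^ 2 * coeff k (G f).1 ∧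
          coeff k ((c ^ 2 * m)⁻¹ • (f.2 + (Ω ^ 2)⁻¹ • linForce₂ κ Ω (G f)
            - s • reMode 1 (Complex.I * ((1 + κ - c ^ 2 * Ω ^ 2 : ℝ) : ℂ)))) =
              -(k : ℂ) ^ 2 * coeff k (G f).2 := by
  have hc2 := speed_sq_pos hc
  have hΩ := h.1
  set n₁ : ℤ → ℂ := fun k => (diag₁ κ c Ω k : ℂ) with hn₁
  set n₂ : ℤ → ℂ := fun k => (diag₂ m κ c Ω k : ℂ) with hn₂
  set b : ℤ → ℂ := fun k => coupling κ (k * Ω) with hb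
  set b' : ℤ → ℂ := fun k => coupling κ (-(k * Ω)) with hb'
  have hn₁c : ∀ k, n₁ (-k) = (starRingEnd ℂ) (n₁ k) := fun k => by
    simp only [hn₁, diag₁_neg, Complex.conj_ofReal]
  have hn₂c : ∀ k, n₂ (-k) = (starRingEnd ℂ) (n₂ k) := fun k => by
    simp only [hn₂, diag₂_neg, Complex.conj_ofReal]
  have hbc : ∀ k, b (-k) = (starRingEnd ℂ) (b k) := fun k => by
    simp only [hb, conj_coupling]; push_cast; rw [neg_mul]
  have hbc' : ∀ k, b' (-k) = (starRingEnd ℂ) (b' k) := fun k => by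
    simp only [hb', conj_coupling]; push_cast; rw [neg_mul]
  have hnegc : ∀ {x : ℤ → ℂ}, (∀ k, x (-k) = (starRingEnd ℂ) (x k)) →
      ∀ k, (-x) (-k) = (starRingEnd ℂ) ((-x) k) := fun {x} hx k => by
    simp [hx]
  have hsq : ∀ k : ℤ, k ≠ 0 → 1 ≤ (k : ℝ) ^ 2 := fun k hk => by
    have : (1 : ℤ) ≤ k ^ 2 := by have := sq_pos_of_ne_zero hk; omega
    exact_mod_cast this
  have hs : ∀ (x y : ℤ → ℂ) (p q : ℝ), 0 ≤ p → 0 ≤ q → (∀ k, ‖y k‖ ≤ p * (k : ℝ) ^ 2 + q) →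
      Summable fun k => ‖invSymbol m κ c Ω x y k‖ := fun x y p q hp hq hy =>
    summable_invSymbol hm hκ hc2 hΩ x y (add_nonneg hp hq) fun k hk =>
      (hy k).trans (by have := hsq k hk; nlinarith)
  have hs₁₁ := hs n₁ n₂ (c ^ 2 * m * Ω ^ 2) (1 + κ) (by positivity) (by positivity) fun k => by
    simp only [hn₂, diag₂, Complex.norm_real]
    refine (abs_sub _ _).trans (le_of_eq ?_)
    rw [abs_of_nonneg (by positivity), abs_of_pos (by positivity)]; ring
  have hs₂₂ := hs n₂ n₁ (c ^ 2 * Ω ^ 2) (1 + κ) (by positivity) (by positivity) fun k => by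
    simp only [hn₁, diag₁, Complex.norm_real]
    refine (abs_sub _ _).trans (le_of_eq ?_)
    rw [abs_of_nonneg (by positivity), abs_of_pos (by positivity)]; ring
  have hs₁₂ := hs b (-b) 0 (1 + κ) le_rfl (by positivity) fun k => by
    simpa using norm_coupling_le hκ _
  have hs₂₁ := hs b' (-b') 0 (1 + κ) le_rfl (by positivity) fun k => by
    simpa using norm_coupling_le hκ _
  have hc₁₁ := invSymbol_neg (m := m) (κ := κ) (c := c) (Ω := Ω) hn₁c hn₂c
  have hc₂₂ := invSymbol_neg (m := m) (κ := κ) (c := c) (Ω := Ω) hn₂c hn₁c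
  have hc₁₂ := invSymbol_neg (m := m) (κ := κ) (c := c) (Ω := Ω) hbc (hnegc hbc)
  have hc₂₁ := invSymbol_neg (m := m) (κ := κ) (c := c) (Ω := Ω) hbc' (hnegc hbc')
  set α₁₁ := invSymbol m κ c Ω n₁ n₂
  set α₁₂ := invSymbol m κ c Ω b (-b)
  set α₂₁ := invSymbol m κ c Ω b' (-b')
  set α₂₂ := invSymbol m κ c Ω n₂ n₁
  set G : PerFun × PerFun →L[ℝ] PerFun × PerFun :=
    ((multiplier α₁₁).coprod (multiplier α₁₂)).prod ((multiplier α₂₁).coprod (multiplier α₂₂))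
    with hG
  have hG₁ : ∀ f, (G f).1 = multiplier α₁₁ f.1 + multiplier α₁₂ f.2 := fun f => rfl
  have hG₂ : ∀ f, (G f).2 = multiplier α₂₁ f.1 + multiplier α₂₂ f.2 := fun f => rfl
  have hGc₁ : ∀ f k, coeff k (G f).1 = α₁₁ k * coeff k f.1 + α₁₂ k * coeff k f.2 := fun f k => by
    rw [hG₁, map_add, coeff_multiplier hs₁₁ hc₁₁, coeff_multiplier hs₁₂ hc₁₂]
  have hGc₂ : ∀ f k, coeff k (G f).2 = α₂₁ k * coeff k f.1 + α₂₂ k * coeff k f.2 := fun f k => by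
    rw [hG₂, map_add, coeff_multiplier hs₂₁ hc₂₁, coeff_multiplier hs₂₂ hc₂₂]
  have hp := h.diag₁_pos hm hκ hhet
  have hr := h.diag₂_nonneg hm hκ hhet
  have hbb := h.coupling_mul hm hκ
  have hγ : 1 + κ - c ^ 2 * Ω ^ 2 = -diag₁ κ c Ω 1 := by simp [diag₁]
  set p := diag₁ κ c Ω 1 with hpdef
  set r := diag₂ m κ c Ω 1 with hrdef
  have hpC : (p : ℂ) ≠ 0 := by exact_mod_cast hp.ne'
  have hτ : (p : ℂ) + r ≠ 0 := by
    have : p + r ≠ 0 := by positivity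
    exact_mod_cast this
  have hΩC : (Ω : ℂ) ≠ 0 := by exact_mod_cast hΩ.ne'
  have hcC : (c : ℂ) ≠ 0 := by
    have : c ≠ 0 := by rintro rfl; simp at hc2
    exact_mod_cast this
  have hmC : (m : ℂ) ≠ 0 := by exact_mod_cast hm.ne'
  have hb1 : b 1 = coupling κ Ω := by simp [hb]
  have hb1' : b' 1 = coupling κ (-Ω) := by simp [hb']
  have h11 : ∀ x y, invSymbol m κ c Ω x y 1 = -(Ω : ℂ) ^ 2 * (x 1 / (p + r) ^ 2) := fun x y => by
    simp [invSymbol, hpdef, hrdef]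
  have e₁₁ : α₁₁ 1 = -(Ω : ℂ) ^ 2 * (p / (p + r) ^ 2) := h11 _ _
  have e₁₂ : α₁₂ 1 = -(Ω : ℂ) ^ 2 * (coupling κ Ω / (p + r) ^ 2) := by rw [← hb1]; exact h11 _ _
  have e₂₁ : α₂₁ 1 = -(Ω : ℂ) ^ 2 * (coupling κ (-Ω) / (p + r) ^ 2) := by
    rw [← hb1']; exact h11 _ _
  have e₂₂ : α₂₂ 1 = -(Ω : ℂ) ^ 2 * (r / (p + r) ^ 2) := h11 _ _
  rw [hγ]
  refine ⟨G, fun ε hε => ?_, fun f => ?_, fun f hf0 hf1 => ?_⟩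
  · filter_upwards [norm_shift_multiplier_sub_le hs₁₁ hc₁₁ (half_pos hε),
      norm_shift_multiplier_sub_le hs₁₂ hc₁₂ (half_pos hε),
      norm_shift_multiplier_sub_le hs₂₁ hc₂₁ (half_pos hε),
      norm_shift_multiplier_sub_le hs₂₂ hc₂₂ (half_pos hε)] with t h1 h2 h3 h4 f
    have key : ∀ A B : PerFun →L[ℝ] PerFun, (∀ u, ‖shift t (A u) - A u‖ ≤ ε / 2 * ‖u‖) →
        (∀ u, ‖shift t (B u) - B u‖ ≤ ε / 2 * ‖u‖) →
        ‖shift t (A f.1 + B f.2) - (A f.1 + B f.2)‖ ≤ ε * ‖f‖ := by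
      intro A B hA hB
      rw [map_add, add_sub_add_comm]
      calc _ ≤ ε / 2 * ‖f.1‖ + ε / 2 * ‖f.2‖ := (norm_add_le _ _).trans (add_le_add (hA _) (hB _))
        _ ≤ ε / 2 * ‖f‖ + ε / 2 * ‖f‖ := by gcongr <;> [exact norm_fst_le f; exact norm_snd_le f]
        _ = _ := by ring
    exact ⟨key _ _ h1 h2, key _ _ h3 h4⟩
  · rw [hGc₁, hGc₂, e₁₁, e₁₂, e₂₁, e₂₂]
    push_cast
    linear_combination (-(Ω : ℂ) ^ 2 * coeff 1 f.2 / (p + r) ^ 2) * hbb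
  -- z pairs mode 1 of f with the kernel vector. Its real part vanishes by hypothesis; its imaginary
  -- part is the component along the derivative of the critical mode, which s records.
  · set z := coupling κ (-Ω) * coeff 1 f.1 + ((-p : ℝ) : ℂ) * coeff 1 f.2 with hz
    have hzI : z = Complex.I * z.im := by
      conv_lhs => rw [← Complex.re_add_im z, hf1]
      simp [mul_comm]
    have hconj : ∀ (u v : PerFun) (k : ℤ), coeff k u = -(k : ℂ) ^ 2 * coeff k v →
        coeff (-k) u = -((-k : ℤ) : ℂ) ^ 2 * coeff (-k) v := by
      intro u v k huv
      rw [coeff_neg, coeff_neg, huv]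
      simp
    -- The residual is the kernel vector times z/(p(p + r)); the factor 2 appears because `reMode 1
    -- γ` has coefficient γ/2 in mode 1.
    refine ⟨2 * z.im / (p * (p + r)), fun k => ?_⟩
    set s := 2 * z.im / (p * (p + r)) with hs_def
    set R₁ := reMode 1 (Complex.I * coupling κ Ω) with hR₁
    set R₂ := reMode 1 (Complex.I * ((-p : ℝ) : ℂ)) with hR₂
    -- All functions are real, so negative modes follow by conjugation.
    suffices H : ∀ k : ℤ, 0 ≤ k →
        ((Ω : ℂ) ^ 2 * coeff k f.1 + n₁ k * coeff k (G f).1 + b k * coeff k (G f).2 =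
          (Ω : ℂ) ^ 2 * (s * coeff k R₁)) ∧
        ((Ω : ℂ) ^ 2 * coeff k f.2 + b' k * coeff k (G f).1 + n₂ k * coeff k (G f).2 =
          (Ω : ℂ) ^ 2 * (s * coeff k R₂)) by
      have H' : ∀ k : ℤ, 0 ≤ k →
          coeff k ((c ^ 2)⁻¹ • (f.1 + (Ω ^ 2)⁻¹ • linForce₁ κ Ω (G f) - s • R₁)) =
            -(k : ℂ) ^ 2 * coeff k (G f).1 ∧
          coeff k ((c ^ 2 * m)⁻¹ • (f.2 + (Ω ^ 2)⁻¹ • linForce₂ κ Ω (G f) - s • R₂)) =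
            -(k : ℂ) ^ 2 * coeff k (G f).2 := by
        intro k hk
        obtain ⟨H₁, H₂⟩ := H k hk
        simp only [map_smul, map_sub, map_add, coeff_linForce₁, coeff_linForce₂, Complex.real_smul]
        simp only [hn₁, hn₂, hb, hb', diag₁, diag₂] at H₁ H₂
        push_cast at H₁ H₂ ⊢
        constructor
        · field_simp
          linear_combination H₁
        · field_simp
          linear_combination H₂
      rcases le_total 0 k with hk | hk
      · exact H' k hk
      · have := H' (-k) (by omega)
        have h1 := hconj _ _ _ this.1
        have h2 := hconj _ _ _ this.2
        rw [neg_neg] at h1 h2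
        exact ⟨h1, h2⟩
    intro k hk
    rw [hGc₁, hGc₂, hR₁, hR₂, coeff_reMode, coeff_reMode]
    obtain rfl | rfl | hk2 : k = 0 ∨ k = 1 ∨ 1 < k := by omega
    -- The matrix of mode 0 is (1 + κ) times ((-1, 1), (1, -1)), whose range consists of the pairs
    -- with sum zero.
    · have hy : coeff 0 f.2 = -coeff 0 f.1 := by linear_combination hf0
      have h1κ : (1 + κ : ℂ) ≠ 0 := by
        have : 1 + κ ≠ 0 := by positivity
        exact_mod_cast this
      have hc0 : coupling κ 0 = 1 + κ := by simp [coupling]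
      rw [hy]
      have h0 : ∀ x y : ℤ → ℂ,
          invSymbol m κ c Ω x y 0 = -(Ω : ℂ) ^ 2 * (x 0 / (4 * (1 + κ) ^ 2)) := by
        intro x y
        have : (((diag₁ κ c Ω 0 + diag₂ m κ c Ω 0 : ℝ) : ℂ)) ^ 2 = 4 * (1 + κ) ^ 2 := by
          simp only [diag₁, diag₂]; push_cast; ring
        rw [invSymbol, this]
        simp
      have hn₁0 : n₁ 0 = -(1 + κ) := by simp [hn₁, diag₁]
      have hn₂0 : n₂ 0 = -(1 + κ) := by simp [hn₂, diag₂]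
      have hb0 : b 0 = 1 + κ := by simp [hb, hc0]
      have hb0' : b' 0 = 1 + κ := by simp [hb', hc0]
      simp only [α₁₁, α₁₂, α₂₁, α₂₂, h0, hn₁0, hn₂0, hb0, hb0', zero_ne_one, if_false,
        show ¬ ((0 : ℤ) = -1) by norm_num, add_zero, zero_div, mul_zero]
      constructor <;> field_simp <;> ring
    · have hsC : (s : ℂ) * (p * (p + r)) = 2 * z.im := by
        rw [hs_def]; push_cast; field_simp
      have hsz : (s : ℂ) * Complex.I * (p * (p + r)) = 2 * z := by
        rw [hzI]; linear_combination Complex.I * hsC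
      have hsz' : (s : ℂ) * Complex.I = 2 * z / (p * (p + r)) := by
        field_simp
        linear_combination hsz
      have hn₁1 : n₁ 1 = p := rfl
      have hn₂1 : n₂ 1 = r := rfl
      rw [e₁₁, e₁₂, e₂₁, e₂₂, hb1, hb1', hn₁1, hn₂1]
      simp only [if_true, show ¬ ((1 : ℤ) = -1) by norm_num, if_false, add_zero]
      push_cast at hz ⊢
      constructor
      · have : (s : ℂ) * (Complex.I * coupling κ Ω / 2) = coupling κ Ω * z / (p * (p + r)) := by
          linear_combination coupling κ Ω / 2 * hsz'
        rw [this, hz]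
        exact rankOne_residual₁ hpC hτ hbb
      · have : (s : ℂ) * (Complex.I * -(p : ℂ) / 2) = -p * z / (p * (p + r)) := by
          linear_combination -p / 2 * hsz'
        rw [this, hz]
        exact rankOne_residual₂ hpC hτ hbb
    · have hdet := det_eq (κ := κ) (c := c) (Ω := Ω) hm k
      have hpos : 0 < symbolDet m κ c (k * Ω) := by
        refine h.symbolDet_pos hm hκ hhet hc ?_
        rw [abs_mul, abs_of_pos hΩ]
        have : (1 : ℝ) < |(k : ℝ)| := by
          rw [abs_of_nonneg (by exact_mod_cast hk)]; exact_mod_cast hk2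
        nlinarith
      have hD : ((m * symbolDet m κ c (k * Ω) : ℝ) : ℂ) ≠ 0 := by
        have : m * symbolDet m κ c (k * Ω) ≠ 0 := by positivity
        exact_mod_cast this
      have hk' : ¬ |k| ≤ 1 := by rw [abs_of_nonneg hk]; omega
      have hkn : ¬ k = -1 := by omega
      have hkn' : ¬ k = 1 := by omega
      have hdet' : n₁ k * n₂ k - b k * b' k = ((m * symbolDet m κ c (k * Ω) : ℝ) : ℂ) := hdet
      simp only [α₁₁, α₁₂, α₂₁, α₂₂, invSymbol, if_neg hk', if_neg hkn, if_neg hkn', Pi.neg_apply]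
      set D := ((m * symbolDet m κ c (k * Ω) : ℝ) : ℂ)
      simp only [add_zero, zero_div, mul_zero]
      exact ⟨adjugate_residual₁ hD hdet', adjugate_residual₂ hD hdet'⟩

end Dimer

/-! ### Abstract bifurcation from a simple crossing. -/

/-- Passes from independent small parameters (a, t) to the scaled regime t = aξ with ξ in a fixed
compact interval. -/
theorem Filter.Eventually.forall_mul_mem_Icc {P : ℝ → ℝ → Prop}
    (h : ∀ᶠ p in 𝓝 ((0 : ℝ), (0 : ℝ)), P p.1 p.2) (Ξ : ℝ) :
    ∀ᶠ a in 𝓝 (0 : ℝ), ∀ ξ ∈ Set.Icc (-Ξ) Ξ, P a (a * ξ) := by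
  obtain ⟨δ, hδ, hP⟩ := Metric.eventually_nhds_iff.1 h
  have h1 : ∀ᶠ a in 𝓝 (0 : ℝ), |a| * (|Ξ| + 1) < δ := by
    have : Filter.Tendsto (fun a : ℝ => |a| * (|Ξ| + 1)) (𝓝 0) (𝓝 (|0| * (|Ξ| + 1))) :=
      (continuous_abs.mul continuous_const).tendsto 0
    rw [abs_zero, zero_mul] at this
    exact this.eventually (gt_mem_nhds hδ)
  filter_upwards [h1] with a ha ξ hξ
  have hΞ : |ξ| ≤ |Ξ| := (abs_le.2 hξ).trans (le_abs_self _)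
  refine hP (y := (a, a * ξ)) ?_
  rw [Prod.dist_eq, Real.dist_eq, Real.dist_eq]
  simp only [sub_zero, abs_mul]
  refine max_lt ?_ ?_
  · nlinarith [abs_nonneg a, abs_nonneg Ξ]
  · nlinarith [abs_nonneg a, mul_le_mul_of_nonneg_left hΞ (abs_nonneg a)]

/-- Lyapunov–Schmidt reduction with an intermediate value argument for the bifurcation equation:
no differentiability in the parameters is needed for the nonlinearity. -/
theorem exists_bifurcating_solutions {E : Type*} [NormedAddCommGroup E] [NormedSpace ℝ E]
    [CompleteSpace E] {A : ℝ → E} {B : ℝ → E →ₗ[ℝ] E} {N : ℝ → ℝ → E → E} (ℓ : E →L[ℝ] ℝ)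
    {C K μ : ℝ}
    (hA : ∀ᶠ t in 𝓝 (0 : ℝ), ‖A t‖ ≤ C * |t|) (hμ : 0 < μ)
    (hAℓ : HasDerivAt (fun t => ℓ (A t)) μ 0)
    (hB : ∀ ε > 0, ∀ᶠ t in 𝓝 (0 : ℝ), ∀ h, ‖B t h‖ ≤ ε * ‖h‖)
    (hN : ∀ R, ∀ᶠ p in 𝓝 ((0 : ℝ), (0 : ℝ)), p.1 ≠ 0 → ∀ h, ‖h‖ ≤ R → ‖N p.1 p.2 h‖ ≤ K)
    (hNlip : ∀ R, ∀ᶠ p in 𝓝 ((0 : ℝ), (0 : ℝ)), p.1 ≠ 0 →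
      ∀ h h', ‖h‖ ≤ R → ‖h'‖ ≤ R → ‖N p.1 p.2 h - N p.1 p.2 h'‖ ≤ 1 / 4 * ‖h - h'‖)
    (hAc : ∀ᶠ t in 𝓝 (0 : ℝ), ContinuousAt A t)
    (hBc : ∀ᶠ t in 𝓝 (0 : ℝ), ∀ h, ContinuousAt (fun t => B t h) t)
    (hNc : ∀ᶠ t in 𝓝 (0 : ℝ), ∀ a h, ContinuousAt (fun t => N a t h) t) :
    ∃ Ξ R : ℝ, ∀ᶠ a in 𝓝 (0 : ℝ), a ≠ 0 → ∃ ξ, |ξ| ≤ Ξ ∧ ∃ h, ‖h‖ ≤ R ∧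
      a⁻¹ • A (a * ξ) + B (a * ξ) h + N a (a * ξ) h = h ∧ ℓ h = 0 := by
  -- The bound `hN` speaks only of a ≠ 0, so it is evaluated at some small nonzero a.
  have hK : 0 ≤ K := by
    have h1 : ∀ᶠ a in 𝓝[≠] (0 : ℝ), ∀ ξ ∈ Set.Icc (-0 : ℝ) 0, a ≠ 0 →
        ∀ h, ‖h‖ ≤ (0 : ℝ) → ‖N a (a * ξ) h‖ ≤ K :=
      ((hN 0).forall_mul_mem_Icc (P := fun a t => a ≠ 0 → ∀ h, ‖h‖ ≤ 0 → ‖N a t h‖ ≤ K)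
        0).filter_mono nhdsWithin_le_nhds
    obtain ⟨a, ha, ha0⟩ := (h1.and self_mem_nhdsWithin).exists
    exact (norm_nonneg _).trans (ha 0 (by simp) ha0 0 (by simp))
  have hA0 : A 0 = 0 := by simpa using hA.self_of_nhds
  have hC : 0 ≤ |C| := abs_nonneg C
  -- At ξ = ±Ξ the leading term has size at least μΞ/2, exactly the bound ‖ℓ‖(1 + K) for the other
  -- terms. R then adds up the bounds |C|Ξ, 1 and K of the three terms. There is no circularity,
  -- since K in `hN` is the same for every R.
  set Ξ : ℝ := 2 * (‖ℓ‖ * (1 + K)) / μ with hΞ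
  have hΞ0 : 0 ≤ Ξ := by positivity
  set R : ℝ := |C| * Ξ + 1 + K with hR
  have hR0 : 0 < R := by positivity
  have hR1 : 1 ≤ R := by
    have : 0 ≤ |C| * Ξ := by positivity
    linarith
  refine ⟨Ξ, R, ?_⟩
  have lift : ∀ {P : ℝ → Prop}, (∀ᶠ t in 𝓝 (0 : ℝ), P t) →
      ∀ᶠ p in 𝓝 ((0 : ℝ), (0 : ℝ)), P p.2 := fun hP =>
    (continuous_snd.tendsto ((0 : ℝ), (0 : ℝ))).eventually hP
  have hlin : ∀ᶠ t in 𝓝 (0 : ℝ), |ℓ (A t) - μ * t| ≤ μ / 2 * |t| := by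
    have := (hasDerivAt_iff_isLittleO.1 hAℓ).bound (half_pos hμ)
    filter_upwards [this] with t ht
    simpa [hA0, mul_comm] using ht
  -- The 1/4 joins the Lipschitz constant 1/4 of N to give 1/2; the 1/R bounds the B-term by 1 on
  -- the ball.
  have hεB : 0 < min (1 / 4) (1 / R) := by positivity
  have hall := (((lift hA).and (lift hlin)).and (((lift (hB _ hεB)).and
    ((hN R).and (hNlip R))).and ((lift hAc).and ((lift hBc).and (lift hNc))))).forall_mul_mem_Icc
    (P := fun a t => ((‖A t‖ ≤ C * |t|) ∧ |ℓ (A t) - μ * t| ≤ μ / 2 * |t|) ∧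
      (((∀ h, ‖B t h‖ ≤ min (1 / 4) (1 / R) * ‖h‖) ∧
        ((a ≠ 0 → ∀ h, ‖h‖ ≤ R → ‖N a t h‖ ≤ K) ∧
        (a ≠ 0 → ∀ h h', ‖h‖ ≤ R → ‖h'‖ ≤ R → ‖N a t h - N a t h'‖ ≤ 1 / 4 * ‖h - h'‖))) ∧
        (ContinuousAt A t ∧ ((∀ h, ContinuousAt (fun t => B t h) t) ∧
          (∀ a h, ContinuousAt (fun t => N a t h) t))))) Ξ
  filter_upwards [hall] with a ha ha0
  have hBR : ∀ ξ ∈ Set.Icc (-Ξ) Ξ, ∀ h, ‖h‖ ≤ R → ‖B (a * ξ) h‖ ≤ 1 := by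
    intro ξ hξ h hh
    obtain ⟨-, ⟨h3, -⟩, -⟩ := ha ξ hξ
    calc ‖B (a * ξ) h‖ ≤ 1 / R * R :=
          (h3 h).trans (mul_le_mul (min_le_right _ _) hh (norm_nonneg _) (by positivity))
      _ = 1 := by field_simp
  have hAR : ∀ ξ ∈ Set.Icc (-Ξ) Ξ, ‖a⁻¹ • A (a * ξ)‖ ≤ |C| * Ξ := by
    intro ξ hξ
    obtain ⟨⟨h1, -⟩, -⟩ := ha ξ hξ
    have hξ' : |ξ| ≤ Ξ := abs_le.2 hξ
    rw [norm_smul, norm_inv, Real.norm_eq_abs, inv_mul_le_iff₀ (abs_pos.2 ha0)]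
    calc ‖A (a * ξ)‖ ≤ |C| * |a * ξ| := h1.trans (by gcongr; exact le_abs_self C)
      _ = |a| * (|C| * |ξ|) := by rw [abs_mul]; ring
      _ ≤ _ := by gcongr
  have hsmall : ∀ ξ ∈ Set.Icc (-Ξ) Ξ, ∀ h, ‖h‖ ≤ R →
      |ℓ (B (a * ξ) h + N a (a * ξ) h)| ≤ ‖ℓ‖ * (1 + K) := by
    intro ξ hξ h hh
    obtain ⟨-, ⟨-, h4, -⟩, -⟩ := ha ξ hξ
    refine (ℓ.le_opNorm _).trans ?_
    gcongr
    exact (norm_add_le _ _).trans (add_le_add (hBR ξ hξ h hh) (h4 ha0 h hh))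
  have hmain : ∀ ξ ∈ Set.Icc (-Ξ) Ξ, |ℓ (a⁻¹ • A (a * ξ)) - μ * ξ| ≤ μ / 2 * |ξ| := by
    intro ξ hξ
    obtain ⟨⟨-, h2⟩, -⟩ := ha ξ hξ
    have : ℓ (a⁻¹ • A (a * ξ)) - μ * ξ = a⁻¹ * (ℓ (A (a * ξ)) - μ * (a * ξ)) := by
      rw [map_smul, smul_eq_mul]; field_simp
    rw [this, abs_mul, abs_inv, inv_mul_le_iff₀ (abs_pos.2 ha0)]
    rw [abs_mul] at h2
    linarith
  have hΞμ : μ / 2 * Ξ = ‖ℓ‖ * (1 + K) := by rw [hΞ]; field_simp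
  have hΞm : Ξ ∈ Set.Icc (-Ξ) Ξ := ⟨by linarith, le_rfl⟩
  have hΞm' : -Ξ ∈ Set.Icc (-Ξ) Ξ := ⟨le_rfl, by linarith⟩
  refine Exists.imp (fun ξ ⟨hξ, h, hh, hF, hℓ⟩ => ⟨abs_le.2 hξ, h, hh, hF, hℓ⟩)
    (exists_fixedPoint_of_sign_change
    (F := fun ξ h => a⁻¹ • A (a * ξ) + B (a * ξ) h + N a (a * ξ) h) (ℓ := ℓ) (a := -Ξ) (b := Ξ)
    (R := R) (by linarith) hR0.le ?_ ?_ ?_ ℓ.continuous ?_ ?_)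
  · intro ξ hξ h hh
    obtain ⟨-, ⟨-, h4, -⟩, -⟩ := ha ξ hξ
    exact (norm_add₃_le).trans
      (add_le_add (add_le_add (hAR ξ hξ) (hBR ξ hξ h hh)) (h4 ha0 h hh))
  · intro ξ hξ h h' hh hh'
    obtain ⟨-, ⟨h3, -, h5⟩, -⟩ := ha ξ hξ
    have e : a⁻¹ • A (a * ξ) + B (a * ξ) h + N a (a * ξ) h -
        (a⁻¹ • A (a * ξ) + B (a * ξ) h' + N a (a * ξ) h') =
        B (a * ξ) (h - h') + (N a (a * ξ) h - N a (a * ξ) h') := by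
      rw [map_sub]; abel
    change ‖a⁻¹ • A (a * ξ) + B (a * ξ) h + N a (a * ξ) h -
        (a⁻¹ • A (a * ξ) + B (a * ξ) h' + N a (a * ξ) h')‖ ≤ _
    rw [e]
    have h6 : ‖B (a * ξ) (h - h')‖ ≤ 1 / 4 * ‖h - h'‖ :=
      (h3 _).trans (mul_le_mul_of_nonneg_right (min_le_left _ _) (norm_nonneg _))
    linarith [norm_add_le (B (a * ξ) (h - h')) (N a (a * ξ) h - N a (a * ξ) h'),
      h5 ha0 h h' hh hh']
  · intro h hh ξ hξ
    obtain ⟨-, -, h6, h7, h8⟩ := ha ξ hξ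
    have hm : ContinuousAt (fun ξ => a * ξ) ξ := by fun_prop
    exact ((((h6.comp (f := fun ξ => a * ξ) hm).const_smul a⁻¹).add
      ((h7 h).comp (f := fun ξ => a * ξ) hm)).add
      ((h8 a h).comp (f := fun ξ => a * ξ) hm)).continuousWithinAt
  · intro h hh hfix
    rw [← hfix, add_assoc, map_add]
    have h1 := (abs_le.1 (hmain _ hΞm')).2
    have h2 := (abs_le.1 (hsmall _ hΞm' h hh)).2
    rw [abs_neg, abs_of_nonneg hΞ0] at h1
    linarith
  · intro h hh hfix
    rw [← hfix, add_assoc, map_add]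
    have h1 := (abs_le.1 (hmain _ hΞm)).1
    have h2 := (abs_le.1 (hsmall _ hΞm h hh)).1
    rw [abs_of_nonneg hΞ0] at h1
    linarith

/-! ### Superposition operators and estimates for the forces. -/

/-- A function vanishing to second order at the origin has Lipschitz constant `O(d)` on
`[-d, d]`. -/
theorem exists_lipschitz_of_flat {W : ℝ → ℝ} (hW : ContDiff ℝ 2 W) (h0 : deriv W 0 = 0) :
    ∃ C, 0 ≤ C ∧ (∀ x, |x| ≤ 1 → |deriv W x| ≤ C * |x|) ∧
      ∀ d ≤ 1, ∀ r s, |r| ≤ d → |s| ≤ d → |W r - W s| ≤ C * d * |r - s| := by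
  have h1 : ContDiff ℝ 1 (deriv W) := hW.deriv' (n := 1)
  have h2 : Continuous (deriv (deriv W)) := h1.continuous_deriv le_rfl
  obtain ⟨C, hC⟩ := (isCompact_Icc (a := (-1 : ℝ)) (b := 1)).exists_bound_of_continuousOn
    h2.continuousOn
  have hC0 : 0 ≤ C := (norm_nonneg _).trans (hC 0 (by norm_num))
  have hd : ∀ x, |x| ≤ 1 → |deriv W x| ≤ C * |x| := by
    intro x hx
    have := (convex_Icc (-1 : ℝ) 1).norm_image_sub_le_of_norm_deriv_le
      (fun y _ => (h1.differentiable one_ne_zero).differentiableAt) hC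
      (show (0 : ℝ) ∈ Set.Icc (-1) 1 by norm_num) (abs_le.1 hx)
    simpa [h0] using this
  refine ⟨C, hC0, hd, fun d hd1 r s hr hs => ?_⟩
  refine (convex_Icc (-d) d).norm_image_sub_le_of_norm_deriv_le (𝕜 := ℝ)
    (fun y _ => (hW.differentiable two_ne_zero).differentiableAt) (fun y hy => ?_)
    (abs_le.1 hs) (abs_le.1 hr)
  have hy' : |y| ≤ d := abs_le.2 hy
  exact (hd y (hy'.trans hd1)).trans (by gcongr)

namespace PerFun

/-- The superposition operator. -/
def nem (W : C(ℝ, ℝ)) (u : PerFun) : PerFun := W.comp u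

theorem nem_apply (W : C(ℝ, ℝ)) (u : PerFun) (x : Circ) : nem W u x = W (u x) := rfl

theorem continuous_nem (W : C(ℝ, ℝ)) : Continuous (nem W) := W.continuous_postcomp

theorem norm_nem_sub_le {W : C(ℝ, ℝ)} {C d : ℝ} (hC : 0 ≤ C) (hd : 0 ≤ d)
    (hW : ∀ r s, |r| ≤ d → |s| ≤ d → |W r - W s| ≤ C * d * |r - s|) {u v : PerFun}
    (hu : ‖u‖ ≤ d) (hv : ‖v‖ ≤ d) : ‖nem W u - nem W v‖ ≤ C * d * ‖u - v‖ := by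
  rw [ContinuousMap.norm_le _ (by positivity)]
  intro x
  refine (hW _ _ ((u.norm_coe_le_norm x).trans hu) ((v.norm_coe_le_norm x).trans hv)).trans ?_
  gcongr
  exact (u - v).norm_coe_le_norm x

/-- In `force` the translated function itself depends on the spacing, so continuity is needed
jointly in both arguments. -/
theorem continuous_shift_map {X : Type*} [TopologicalSpace X] {f : X → ℝ} {g : X → PerFun}
    (hf : Continuous f) (hg : Continuous g) : Continuous fun x => shift (f x) (g x) := by
  have hc : Continuous fun p : ℝ × Circ => p.2 + (p.1 : Circ) :=
    continuous_snd.add ((AddCircle.continuous_mk' _).comp continuous_fst)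
  have h1 : Continuous fun t : ℝ => (⟨fun x : Circ => x + (t : Circ), by fun_prop⟩ : C(Circ, Circ)) :=
    (ContinuousMap.curry ⟨_, hc⟩).continuous
  exact hg.compCM (h1.comp hf)

end PerFun

namespace Dimer

open PerFun

/-- The linearized forces, for lattice spacing `t`. -/
def linForce (κ t : ℝ) : PerFun × PerFun →ₗ[ℝ] PerFun × PerFun where
  toFun φ := (linForce₁ κ t φ, linForce₂ κ t φ)
  map_add' φ η := by
    simp only [linForce₁, linForce₂, Prod.fst_add, Prod.snd_add, map_add, smul_add, Prod.mk_add_mk,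
      Prod.mk.injEq]
    constructor <;> abel
  map_smul' r φ := by
    simp only [linForce₁, linForce₂, Prod.smul_fst, Prod.smul_snd, map_smul, RingHom.id_apply,
      Prod.smul_mk, smul_sub, smul_add, smul_comm κ r, smul_comm (1 + κ) r]

theorem linForce_apply (κ t : ℝ) (φ : PerFun × PerFun) :
    linForce κ t φ = (linForce₁ κ t φ, linForce₂ κ t φ) := rfl

/-- The stretch of the first kind of springs. -/
def strain₁ (t : ℝ) (φ : PerFun × PerFun) : PerFun := shift t φ.2 - φ.1

/-- The stretch of the second kind of springs. -/
def strain₂ (t : ℝ) (φ : PerFun × PerFun) : PerFun := shift t φ.1 - φ.2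

/-- The forces on the particles when the springs exert the forces `W₁`, `W₂`. -/
def force (W₁ W₂ : C(ℝ, ℝ)) (t : ℝ) (φ : PerFun × PerFun) : PerFun × PerFun :=
  (nem W₁ (strain₁ t φ) - shift (-t) (nem W₂ (strain₂ t φ)),
    nem W₂ (strain₂ t φ) - shift (-t) (nem W₁ (strain₁ t φ)))

theorem norm_strain₁_le (t : ℝ) (φ : PerFun × PerFun) : ‖strain₁ t φ‖ ≤ 2 * ‖φ‖ := by
  have := norm_sub_le (shift t φ.2) φ.1
  have := norm_shift_le t φ.2
  have := norm_fst_le φ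
  have := norm_snd_le φ
  unfold strain₁
  linarith

theorem norm_strain₂_le (t : ℝ) (φ : PerFun × PerFun) : ‖strain₂ t φ‖ ≤ 2 * ‖φ‖ := by
  have := norm_sub_le (shift t φ.1) φ.2
  have := norm_shift_le t φ.1
  have := norm_fst_le φ
  have := norm_snd_le φ
  unfold strain₂
  linarith

theorem strain₁_sub (t : ℝ) (φ η : PerFun × PerFun) :
    strain₁ t φ - strain₁ t η = strain₁ t (φ - η) := by
  simp only [strain₁, Prod.fst_sub, Prod.snd_sub, map_sub]; abel

theorem strain₂_sub (t : ℝ) (φ η : PerFun × PerFun) :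
    strain₂ t φ - strain₂ t η = strain₂ t (φ - η) := by
  simp only [strain₂, Prod.fst_sub, Prod.snd_sub, map_sub]; abel

/-- The factor 4 is 2 · 2: strains at most double the norm, and each particle feels two springs. -/
theorem norm_force_sub_le {W₁ W₂ : C(ℝ, ℝ)} {C d : ℝ} (hC : 0 ≤ C) (hd : 0 ≤ d)
    (hW₁ : ∀ r s, |r| ≤ d → |s| ≤ d → |W₁ r - W₁ s| ≤ C * d * |r - s|)
    (hW₂ : ∀ r s, |r| ≤ d → |s| ≤ d → |W₂ r - W₂ s| ≤ C * d * |r - s|)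
    (t : ℝ) {φ η : PerFun × PerFun} (hφ : 2 * ‖φ‖ ≤ d) (hη : 2 * ‖η‖ ≤ d) :
    ‖force W₁ W₂ t φ - force W₁ W₂ t η‖ ≤ 4 * C * d * ‖φ - η‖ := by
  have h1 : ‖nem W₁ (strain₁ t φ) - nem W₁ (strain₁ t η)‖ ≤ C * d * (2 * ‖φ - η‖) := by
    refine (norm_nem_sub_le hC hd hW₁ ((norm_strain₁_le _ _).trans hφ)
      ((norm_strain₁_le _ _).trans hη)).trans ?_
    gcongr
    rw [strain₁_sub]
    exact norm_strain₁_le _ _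
  have h2 : ‖nem W₂ (strain₂ t φ) - nem W₂ (strain₂ t η)‖ ≤ C * d * (2 * ‖φ - η‖) := by
    refine (norm_nem_sub_le hC hd hW₂ ((norm_strain₂_le _ _).trans hφ)
      ((norm_strain₂_le _ _).trans hη)).trans ?_
    gcongr
    rw [strain₂_sub]
    exact norm_strain₂_le _ _
  have key : ∀ u u' v v' : PerFun, ‖u - u'‖ ≤ C * d * (2 * ‖φ - η‖) →
      ‖v - v'‖ ≤ C * d * (2 * ‖φ - η‖) →
      ‖(u - shift (-t) v) - (u' - shift (-t) v')‖ ≤ 4 * C * d * ‖φ - η‖ := by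
    intro u u' v v' hu hv
    have e : (u - shift (-t) v) - (u' - shift (-t) v') = (u - u') - shift (-t) (v - v') := by
      rw [map_sub]; abel
    rw [e]
    have := norm_sub_le (u - u') (shift (-t) (v - v'))
    have := norm_shift_le (-t) (v - v')
    linarith
  exact norm_prod_le_iff.2 ⟨key _ _ _ _ h1 h2, key _ _ _ _ h2 h1⟩

theorem force_zero {W₁ W₂ : C(ℝ, ℝ)} (h₁ : W₁ 0 = 0) (h₂ : W₂ 0 = 0) (t : ℝ) :
    force W₁ W₂ t 0 = 0 := by
  have hs₁ : strain₁ t 0 = 0 := by simp [strain₁]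
  have hs₂ : strain₂ t 0 = 0 := by simp [strain₂]
  have e₁ : nem W₁ 0 = 0 := by ext x; simpa [nem_apply] using h₁
  have e₂ : nem W₂ 0 = 0 := by ext x; simpa [nem_apply] using h₂
  simp [force, hs₁, hs₂, e₁, e₂]

theorem continuous_force (W₁ W₂ : C(ℝ, ℝ)) (φ : PerFun × PerFun) :
    Continuous fun t => force W₁ W₂ t φ := by
  have h₁ : Continuous fun t => nem W₁ (strain₁ t φ) :=
    (continuous_nem W₁).comp ((continuous_shift φ.2).sub continuous_const)
  have h₂ : Continuous fun t => nem W₂ (strain₂ t φ) :=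
    (continuous_nem W₂).comp ((continuous_shift φ.1).sub continuous_const)
  exact (h₁.sub (continuous_shift_map continuous_neg h₂)).prodMk
    (h₂.sub (continuous_shift_map continuous_neg h₁))

theorem continuous_linForce (κ : ℝ) (φ : PerFun × PerFun) :
    Continuous fun t => linForce κ t φ := by
  have h : ∀ u : PerFun, Continuous fun t : ℝ => shift (-t) u := fun u =>
    (continuous_shift u).comp continuous_neg
  exact (((continuous_shift φ.2).add ((h φ.2).const_smul κ)).sub continuous_const).prodMk
    ((((continuous_shift φ.1).const_smul κ).add (h φ.1)).sub continuous_const)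

theorem norm_linForce_le {κ : ℝ} (hκ : 0 < κ) (t : ℝ) (φ : PerFun × PerFun) :
    ‖linForce κ t φ‖ ≤ 2 * (1 + κ) * ‖φ‖ := by
  have h₁ := norm_fst_le φ
  have h₂ := norm_snd_le φ
  have hs : ∀ s u, ‖u‖ ≤ ‖φ‖ → ‖shift s u‖ ≤ ‖φ‖ := fun s u hu => (norm_shift_le s u).trans hu
  have hκs : ∀ u : PerFun, ‖u‖ ≤ ‖φ‖ → ‖κ • u‖ ≤ κ * ‖φ‖ := fun u hu => by
    rw [norm_smul, Real.norm_of_nonneg hκ.le]; gcongr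
  have hκs' : ∀ u : PerFun, ‖u‖ ≤ ‖φ‖ → ‖(1 + κ) • u‖ ≤ (1 + κ) * ‖φ‖ := fun u hu => by
    rw [norm_smul, Real.norm_of_nonneg (by positivity)]; gcongr
  refine norm_prod_le_iff.2 ⟨?_, ?_⟩
  · refine (norm_sub_le _ _).trans ?_
    have := norm_add_le (shift t φ.2) (κ • shift (-t) φ.2)
    linarith [hs t _ h₂, hκs _ (hs (-t) _ h₂), hκs' _ h₁]
  · refine (norm_sub_le _ _).trans ?_
    have := norm_add_le (κ • shift t φ.1) (shift (-t) φ.1)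
    linarith [hs (-t) _ h₁, hκs _ (hs t _ h₁), hκs' _ h₂]

/-- By the group law, and since translations do not increase norms, changing the spacing by t costs
no more than translating φ by ±t. It is applied to φ in the range of G, where this is uniformly
small. -/
theorem norm_linForce_sub_le {κ : ℝ} (hκ : 0 < κ) {s t ε : ℝ} {φ : PerFun × PerFun}
    (h : ‖shift t φ.1 - φ.1‖ ≤ ε ∧ ‖shift t φ.2 - φ.2‖ ≤ ε)
    (h' : ‖shift (-t) φ.1 - φ.1‖ ≤ ε ∧ ‖shift (-t) φ.2 - φ.2‖ ≤ ε) :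
    ‖linForce κ (s + t) φ - linForce κ s φ‖ ≤ (1 + κ) * ε := by
  have hs : ∀ u r q, ‖shift q u - u‖ ≤ ε → ‖shift (r + q) u - shift r u‖ ≤ ε := fun u r q hu => by
    rw [← shift_add, ← map_sub]
    exact (norm_shift_le _ _).trans hu
  have hκs : ∀ u : PerFun, ‖u‖ ≤ ε → ‖κ • u‖ ≤ κ * ε := fun u hu => by
    rw [norm_smul, Real.norm_of_nonneg hκ.le]; gcongr
  refine norm_prod_le_iff.2 ⟨?_, ?_⟩
  · have e : (linForce κ (s + t) φ - linForce κ s φ).1 = (shift (s + t) φ.2 - shift s φ.2) +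
        κ • (shift (-s + -t) φ.2 - shift (-s) φ.2) := by
      simp only [linForce_apply, linForce₁, Prod.fst_sub, smul_sub, neg_add]
      abel
    rw [e]
    have := norm_add_le (shift (s + t) φ.2 - shift s φ.2)
      (κ • (shift (-s + -t) φ.2 - shift (-s) φ.2))
    linarith [hs _ s t h.2, hκs _ (hs _ (-s) (-t) h'.2)]
  · have e : (linForce κ (s + t) φ - linForce κ s φ).2 = κ • (shift (s + t) φ.1 - shift s φ.1) +
        (shift (-s + -t) φ.1 - shift (-s) φ.1) := by
      simp only [linForce_apply, linForce₂, Prod.snd_sub, smul_sub, neg_add]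
      abel
    rw [e]
    have := norm_add_le (κ • (shift (s + t) φ.1 - shift s φ.1))
      (shift (-s + -t) φ.1 - shift (-s) φ.1)
    linarith [hs _ (-s) (-t) h'.1, hκs _ (hs _ s t h.1)]

end Dimer

/-! ### The critical mode and the transversal crossing. -/

namespace Dimer

open PerFun

variable {m κ c Ω : ℝ}

/-- The leading order profile as a pair of functions on the circle. -/
def criticalMode (κ c Ω : ℝ) : PerFun × PerFun :=
  (reMode 1 (2 / nuNorm κ c Ω * coupling κ Ω),
    reMode 1 (2 / nuNorm κ c Ω * ((1 + κ - c ^ 2 * Ω ^ 2 : ℝ) : ℂ)))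

/-- The component along the critical mode. -/
def criticalFunctional (κ c Ω : ℝ) : PerFun × PerFun →L[ℝ] ℝ :=
  Complex.reCLM.comp
    (((ContinuousLinearMap.mul ℝ ℂ (coupling κ (-Ω))).comp (coeff 1)).coprod
      ((ContinuousLinearMap.mul ℝ ℂ ((1 + κ - c ^ 2 * Ω ^ 2 : ℝ) : ℂ)).comp (coeff 1)))

theorem criticalFunctional_apply (κ c Ω : ℝ) (f : PerFun × PerFun) :
    criticalFunctional κ c Ω f = (coupling κ (-Ω) * coeff 1 f.1
      + ((1 + κ - c ^ 2 * Ω ^ 2 : ℝ) : ℂ) * coeff 1 f.2).re := rfl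

theorem IsCriticalFrequency.nuNorm_pos (h : IsCriticalFrequency m κ c Ω)
    (hm : 0 < m) (hκ : 0 < κ) (hhet : 1 / m > 1 ∨ κ > 1) : 0 < nuNorm κ c Ω := by
  have h1 : 0 < (1 + κ - c ^ 2 * Ω ^ 2) ^ 2 := by
    have := (h.gap hm hκ hhet).ne
    positivity
  have : 0 < √((1 - κ) ^ 2 + 4 * κ * Real.cos Ω ^ 2 + (1 + κ - c ^ 2 * Ω ^ 2) ^ 2) :=
    Real.sqrt_pos.2 (by positivity)
  unfold nuNorm
  positivity

theorem coeff_one_reMode (γ : ℂ) : coeff 1 (reMode 1 γ) = γ / 2 := by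
  rw [coeff_reMode, if_pos rfl, if_neg (by norm_num), add_zero]

theorem coupling_neg_mul (κ Ω θ : ℝ) : (coupling κ (-Ω) * coupling κ θ).re =
    (1 + κ ^ 2) * Real.cos (θ - Ω) + 2 * κ * Real.cos (θ + Ω) := by
  have he : ∀ x y : ℝ, (Complex.exp (Complex.I * x) * Complex.exp (Complex.I * y)).re =
      Real.cos (x + y) := fun x y => by
    rw [← Complex.exp_add, ← mul_add, ← Complex.ofReal_add, mul_comm, Complex.exp_ofReal_mul_I_re]
  have h : coupling κ (-Ω) * coupling κ θ =
      Complex.exp (Complex.I * (-Ω : ℝ)) * Complex.exp (Complex.I * θ)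
      + (κ : ℂ) * (Complex.exp (Complex.I * (-Ω : ℝ)) * Complex.exp (Complex.I * (-θ : ℝ)))
      + (κ : ℂ) * (Complex.exp (Complex.I * Ω) * Complex.exp (Complex.I * θ))
      + ((κ ^ 2 : ℝ) : ℂ) * (Complex.exp (Complex.I * Ω) * Complex.exp (Complex.I * (-θ : ℝ))) := by
    simp only [coupling]
    push_cast
    ring_nf
  rw [h]
  simp only [Complex.add_re, Complex.re_ofReal_mul, he]
  rw [show -Ω + -θ = -(θ + Ω) by ring, Real.cos_neg, show Ω + -θ = -(θ - Ω) by ring, Real.cos_neg,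
    show -Ω + θ = θ - Ω by ring, show Ω + θ = θ + Ω by ring]
  ring

/-- Only mode 1 enters, so the dependence on the spacing reduces to two cosines and can be
differentiated by hand. -/
theorem criticalFunctional_linForce (κ c Ω θ : ℝ) :
    criticalFunctional κ c Ω (linForce κ θ (criticalMode κ c Ω)) =
      (nuNorm κ c Ω)⁻¹ * (2 * (1 + κ - c ^ 2 * Ω ^ 2) *
          ((1 + κ ^ 2) * Real.cos (θ - Ω) + 2 * κ * Real.cos (θ + Ω))
        - (1 + κ) * ((1 + κ) ^ 2 - 4 * κ * Real.sin Ω ^ 2 + (1 + κ - c ^ 2 * Ω ^ 2) ^ 2)) := by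
  set γ := 1 + κ - c ^ 2 * Ω ^ 2 with hγ
  set n := nuNorm κ c Ω with hn
  have h1 : coeff 1 (criticalMode κ c Ω).1 = (n⁻¹ : ℝ) * coupling κ Ω := by
    rw [criticalMode, coeff_one_reMode]; push_cast; ring
  have h2 : coeff 1 (criticalMode κ c Ω).2 = (n⁻¹ : ℝ) * γ := by
    rw [criticalMode, coeff_one_reMode, ← hγ, ← hn]; push_cast; ring
  rw [criticalFunctional_apply, linForce_apply, coeff_linForce₁, coeff_linForce₂, h1, h2,
    Int.cast_one, one_mul]
  have e : coupling κ (-Ω) * (coupling κ θ * ((n⁻¹ : ℝ) * γ) -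
        (1 + κ) * ((n⁻¹ : ℝ) * coupling κ Ω)) +
      (γ : ℂ) * (coupling κ (-θ) * ((n⁻¹ : ℝ) * coupling κ Ω) - (1 + κ) * ((n⁻¹ : ℝ) * γ)) =
      ((n⁻¹ * γ : ℝ) : ℂ) * (coupling κ (-Ω) * coupling κ θ + coupling κ (-θ) * coupling κ Ω)
      - ((n⁻¹ * (1 + κ) : ℝ) : ℂ) * (coupling κ Ω * coupling κ (-Ω) + ((γ ^ 2 : ℝ) : ℂ)) := by
    push_cast
    ring
  rw [e, coupling_mul_neg]
  simp only [Complex.sub_re, Complex.re_ofReal_mul, Complex.add_re, coupling_neg_mul,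
    Complex.ofReal_re]
  rw [show Ω - θ = -(θ - Ω) by ring, Real.cos_neg, add_comm Ω θ]
  ring

/-- The variation of the linearized forces on the critical mode with the frequency. -/
def detuning (κ Ω t : ℝ) : PerFun × PerFun →ₗ[ℝ] PerFun × PerFun :=
  ((Ω + t) ^ 2)⁻¹ • linForce κ (Ω + t) - (Ω ^ 2)⁻¹ • linForce κ Ω

theorem detuning_apply (κ Ω t : ℝ) (φ : PerFun × PerFun) : detuning κ Ω t φ =
    ((Ω + t) ^ 2)⁻¹ • linForce κ (Ω + t) φ - (Ω ^ 2)⁻¹ • linForce κ Ω φ := rfl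

/-- The critical eigenvalue crosses zero with nonzero speed. -/
theorem IsCriticalFrequency.exists_hasDerivAt_detuning (h : IsCriticalFrequency m κ c Ω)
    (hm : 0 < m) (hκ : 0 < κ) (hhet : 1 / m > 1 ∨ κ > 1) (hc : |c| > soundSpeed m κ) :
    ∃ μ > 0, HasDerivAt
      (fun t => criticalFunctional κ c Ω (detuning κ Ω t (criticalMode κ c Ω))) μ 0 := by
  have hΩ := h.1
  have hn := h.nuNorm_pos hm hκ hhet
  have htr := transversality hm hκ hhet hc hΩ
  have hgap := h.gap hm hκ hhet
  have hdet := h.symbolDet_eq_zero hm hκ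
  have hrho := h.rho_eq
  set γ := 1 + κ - c ^ 2 * Ω ^ 2 with hγ
  set n := nuNorm κ c Ω with hn'
  set Q : ℝ → ℝ := fun θ => n⁻¹ * (2 * γ *
          ((1 + κ ^ 2) * Real.cos (θ - Ω) + 2 * κ * Real.cos (θ + Ω))
        - (1 + κ) * ((1 + κ) ^ 2 - 4 * κ * Real.sin Ω ^ 2 + γ ^ 2)) with hQ
  have hQd : HasDerivAt (fun t => Q (Ω + t)) (n⁻¹ * (2 * γ * (2 * κ * -Real.sin (Ω + Ω)))) 0 := by
    have h1 : HasDerivAt (fun t : ℝ => Ω + t - Ω) 1 0 := by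
      simpa using ((hasDerivAt_id (0 : ℝ)).const_add Ω).sub_const Ω
    have h2 : HasDerivAt (fun t : ℝ => Ω + t + Ω) 1 0 := by
      simpa using ((hasDerivAt_id (0 : ℝ)).const_add Ω).add_const Ω
    have h3 := (((((h1.cos.const_mul (1 + κ ^ 2)).add (h2.cos.const_mul (2 * κ))).const_mul
      (2 * γ)).sub_const ((1 + κ) * ((1 + κ) ^ 2 - 4 * κ * Real.sin Ω ^ 2 + γ ^ 2))).const_mul n⁻¹)
    refine h3.congr_deriv ?_
    simp
  have hinv : HasDerivAt (fun t : ℝ => ((Ω + t) ^ 2)⁻¹) (-(2 * Ω) / (Ω ^ 2) ^ 2) 0 := by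
    have h1 := (((hasDerivAt_id (0 : ℝ)).const_add Ω).pow 2).inv (by simp [hΩ.ne'])
    refine h1.congr_deriv ?_
    simp
  have hfun : (fun t => criticalFunctional κ c Ω (detuning κ Ω t (criticalMode κ c Ω))) =
      fun t => ((Ω + t) ^ 2)⁻¹ * Q (Ω + t) - (Ω ^ 2)⁻¹ * Q Ω := by
    ext t
    rw [detuning_apply, map_sub, map_smul, map_smul, criticalFunctional_linForce,
      criticalFunctional_linForce]
    simp only [smul_eq_mul, hQ, hn', hγ]
  rw [hfun]
  -- The crossing speed is a multiple of the quantity in `transversality`; the multiple is positive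
  -- because γ < 0 by `gap`.
  refine ⟨2 * -γ * m / (n * Ω ^ 2) *
    (c ^ 2 * Ω * rho m κ Ω + 4 * κ * (1 / m) * (Real.cos Ω * Real.sin Ω)), ?_, ?_⟩
  · have : 0 < -γ := by linarith
    positivity
  · refine ((hinv.mul hQd).sub_const _).congr_deriv ?_
    set l := c ^ 2 * Ω ^ 2 with hl
    set sn := Real.sin Ω with hsn
    have hmS : m * ((1 + κ) * (1 + 1 / m)) = (1 + κ) * (m + 1) := by field_simp
    have hdet' : m * l ^ 2 - (1 + κ) * (m + 1) * l + 4 * κ * sn ^ 2 = 0 := by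
      rw [symbolDet, ← hl, ← hsn] at hdet
      have h1 : m * (4 * κ * (1 / m) * sn ^ 2) = 4 * κ * sn ^ 2 := by field_simp
      linear_combination m * hdet + l * hmS - h1
    -- The vanishing determinant expresses Q Ω through ρ, after which both terms of the product rule
    -- combine.
    have hQΩ : Q Ω = n⁻¹ * (γ * l * (m * rho m κ Ω)) := by
      have hcos : Real.cos (Ω + Ω) = 1 - 2 * sn ^ 2 := by
        rw [← two_mul, Real.cos_two_mul, Real.cos_sq']; ring
      simp only [hQ, sub_self, Real.cos_zero, mul_one, hcos, hrho]
      congr 1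
      rw [hγ]
      linear_combination (-(2 * (1 + κ - l) - (1 + κ))) * hdet'
        + (1 + κ - l) * l * hmS
    rw [add_zero, hQΩ, ← two_mul, Real.sin_two_mul, ← hsn, hl]
    field_simp
    ring

end Dimer

/-! ### Estimates for the detuning and the projected equation. -/

namespace PerFun

theorem differentiable_shift_reMode (k : ℤ) (γ : ℂ) :
    Differentiable ℝ fun t : ℝ => shift t (reMode k γ) := by
  simp_rw [shift_reMode]
  have h : Differentiable ℝ fun t : ℝ => Complex.exp (Complex.I * k * (t : ℂ)) * γ :=
    (((Complex.ofRealCLM.differentiable).const_mul _).cexp).mul_const _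
  exact (reMode k).differentiable.comp h

end PerFun

namespace Dimer

open PerFun

variable {m κ c Ω : ℝ}

/-- Translation is differentiable in t on trigonometric modes, though not on general continuous
functions. -/
theorem differentiable_linForce_criticalMode (κ c Ω : ℝ) :
    Differentiable ℝ fun t => linForce κ t (criticalMode κ c Ω) := by
  have h : ∀ γ, Differentiable ℝ fun t : ℝ => shift (-t) (reMode 1 γ) := fun γ =>
    (differentiable_shift_reMode 1 γ).comp differentiable_neg
  exact (((differentiable_shift_reMode _ _).add ((h _).const_smul κ)).sub_const _).prodMk
    ((((differentiable_shift_reMode _ _).const_smul κ).add (h _)).sub_const _)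

theorem differentiableAt_detuning_criticalMode (κ c : ℝ) (hΩ : Ω ≠ 0) :
    DifferentiableAt ℝ (fun t => detuning κ Ω t (criticalMode κ c Ω)) 0 := by
  have h1 : DifferentiableAt ℝ (fun t : ℝ => ((Ω + t) ^ 2)⁻¹) 0 := by
    refine DifferentiableAt.inv (by fun_prop) (by simpa using hΩ)
  have h2 : Differentiable ℝ fun t => linForce κ (Ω + t) (criticalMode κ c Ω) :=
    (differentiable_linForce_criticalMode κ c Ω).comp (differentiable_id.const_add Ω)
  exact (h1.smul h2.differentiableAt).sub_const _

theorem eventually_norm_detuning_criticalMode_le (κ c : ℝ) (hΩ : Ω ≠ 0) :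
    ∀ᶠ t in 𝓝 (0 : ℝ), ‖detuning κ Ω t (criticalMode κ c Ω)‖ ≤
      (‖deriv (fun t => detuning κ Ω t (criticalMode κ c Ω)) 0‖ + 1) * |t| := by
  set ν := criticalMode κ c Ω with hν
  have h1 := (differentiableAt_detuning_criticalMode κ c hΩ).hasDerivAt
  have h0 : detuning κ Ω 0 ν = 0 := by simp [detuning_apply]
  filter_upwards [(hasDerivAt_iff_isLittleO.1 h1).bound one_pos] with t ht
  rw [← hν, h0, sub_zero, sub_zero, one_mul] at ht
  have := norm_add_le (detuning κ Ω t ν - t • deriv (fun t => detuning κ Ω t ν) 0)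
    (t • deriv (fun t => detuning κ Ω t ν) 0)
  rw [sub_add_cancel, norm_smul, Real.norm_eq_abs] at this
  rw [Real.norm_eq_abs] at ht
  linarith

theorem continuousAt_detuning (κ : ℝ) {t : ℝ} (ht : Ω + t ≠ 0) (φ : PerFun × PerFun) :
    ContinuousAt (fun t => detuning κ Ω t φ) t := by
  have h1 : ContinuousAt (fun t : ℝ => ((Ω + t) ^ 2)⁻¹) t :=
    ContinuousAt.inv₀ (by fun_prop) (pow_ne_zero 2 ht)
  have h2 : Continuous fun t => linForce κ (Ω + t) φ :=
    (continuous_linForce κ φ).comp (continuous_const.add continuous_id)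
  exact (h1.smul h2.continuousAt).sub continuousAt_const

/-- The change of spacing is small uniformly in f because G smooths; the change of the scalar factor
multiplies a bounded operator. Each is allotted ε/2. -/
theorem eventually_norm_detuning_le (hκ : 0 < κ) (hΩ : 0 < Ω)
    {G : PerFun × PerFun →L[ℝ] PerFun × PerFun}
    (hG : ∀ ε > 0, ∀ᶠ t in 𝓝 (0 : ℝ), ∀ f,
        ‖shift t (G f).1 - (G f).1‖ ≤ ε * ‖f‖ ∧ ‖shift t (G f).2 - (G f).2‖ ≤ ε * ‖f‖)
    {ε : ℝ} (hε : 0 < ε) :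
    ∀ᶠ t in 𝓝 (0 : ℝ), ∀ f, ‖detuning κ Ω t (G f)‖ ≤ ε * ‖f‖ := by
  have hinv : Filter.Tendsto (fun t : ℝ => ((Ω + t) ^ 2)⁻¹) (𝓝 0) (𝓝 (Ω ^ 2)⁻¹) := by
    have : ContinuousAt (fun t : ℝ => ((Ω + t) ^ 2)⁻¹) 0 :=
      ContinuousAt.inv₀ (by fun_prop) (by simpa using hΩ.ne')
    simpa [ContinuousAt] using this
  set D := 2 * (1 + κ) * (‖G‖ + 1) with hD
  have hD0 : 0 < D := by positivity
  have h1 : ∀ᶠ t in 𝓝 (0 : ℝ), |((Ω + t) ^ 2)⁻¹ - (Ω ^ 2)⁻¹| < ε / (2 * D) := by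
    have := (hinv.sub_const (Ω ^ 2)⁻¹).abs
    rw [sub_self, abs_zero] at this
    exact this.eventually (gt_mem_nhds (by positivity))
  have h2 : ∀ᶠ t in 𝓝 (0 : ℝ), ((Ω + t) ^ 2)⁻¹ < (Ω ^ 2)⁻¹ + 1 :=
    hinv.eventually (gt_mem_nhds (by linarith))
  have hδ : 0 < ε / (2 * ((Ω ^ 2)⁻¹ + 1) * (1 + κ)) := by positivity
  have h3 := hG _ hδ
  have h4 : ∀ᶠ t in 𝓝 (0 : ℝ), ∀ f,
      ‖shift (-t) (G f).1 - (G f).1‖ ≤ ε / (2 * ((Ω ^ 2)⁻¹ + 1) * (1 + κ)) * ‖f‖ ∧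
      ‖shift (-t) (G f).2 - (G f).2‖ ≤ ε / (2 * ((Ω ^ 2)⁻¹ + 1) * (1 + κ)) * ‖f‖ := by
    have : Filter.Tendsto (fun t : ℝ => -t) (𝓝 0) (𝓝 0) :=
      Continuous.tendsto' continuous_neg _ _ neg_zero
    exact this.eventually h3
  filter_upwards [h1, h2, h3, h4] with t h1 h2 h3 h4 f
  have e : detuning κ Ω t (G f) = ((Ω + t) ^ 2)⁻¹ • (linForce κ (Ω + t) (G f) - linForce κ Ω (G f))
      + (((Ω + t) ^ 2)⁻¹ - (Ω ^ 2)⁻¹) • linForce κ Ω (G f) := by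
    rw [detuning_apply]; module
  rw [e]
  refine (norm_add_le _ _).trans ?_
  rw [norm_smul, norm_smul, Real.norm_of_nonneg (by positivity : 0 ≤ ((Ω + t) ^ 2)⁻¹),
    Real.norm_eq_abs]
  have h5 := norm_linForce_sub_le (s := Ω) hκ (h3 f) (h4 f)
  have h6 : ‖linForce κ Ω (G f)‖ ≤ D * ‖f‖ := by
    refine (norm_linForce_le hκ _ _).trans ?_
    rw [hD, mul_assoc (2 * (1 + κ))]
    gcongr
    exact (G.le_opNorm f).trans (by gcongr; linarith)
  calc _ ≤ ((Ω ^ 2)⁻¹ + 1) * ((1 + κ) * (ε / (2 * ((Ω ^ 2)⁻¹ + 1) * (1 + κ)) * ‖f‖))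
        + ε / (2 * D) * (D * ‖f‖) := by gcongr
    _ = ε * ‖f‖ := by field_simp; ring

/-- Solutions of the traveling wave equation projected off the kernel of the linearization. -/
theorem IsCriticalFrequency.exists_projected_solutions (h : IsCriticalFrequency m κ c Ω)
    (hm : 0 < m) (hκ : 0 < κ) (hhet : 1 / m > 1 ∨ κ > 1) (hc : |c| > soundSpeed m κ)
    {G : PerFun × PerFun →L[ℝ] PerFun × PerFun}
    (hG : ∀ ε > 0, ∀ᶠ t in 𝓝 (0 : ℝ), ∀ f,
        ‖shift t (G f).1 - (G f).1‖ ≤ ε * ‖f‖ ∧ ‖shift t (G f).2 - (G f).2‖ ≤ ε * ‖f‖)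
    {W₁ W₂ : C(ℝ, ℝ)} (hW₁ : ContDiff ℝ 2 W₁) (hW₂ : ContDiff ℝ 2 W₂) (hW₁0 : W₁ 0 = 0)
    (hW₂0 : W₂ 0 = 0) (hW₁1 : deriv W₁ 0 = 0) (hW₂1 : deriv W₂ 0 = 0) :
    ∃ Ξ R : ℝ, ∀ᶠ a in 𝓝 (0 : ℝ), a ≠ 0 → ∃ ξ, |ξ| ≤ Ξ ∧ ∃ f, ‖f‖ ≤ R ∧
      a⁻¹ • detuning κ Ω (a * ξ) (criticalMode κ c Ω) + detuning κ Ω (a * ξ) (G f)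
        + (a ^ 2 * (Ω + a * ξ) ^ 2)⁻¹ • force W₁ W₂ (Ω + a * ξ)
            (a • criticalMode κ c Ω + a ^ 2 • G f) = f ∧
      criticalFunctional κ c Ω f = 0 := by
  have hΩ := h.1
  obtain ⟨C₁, hC₁, -, hL₁⟩ := exists_lipschitz_of_flat hW₁ hW₁1
  obtain ⟨C₂, hC₂, -, hL₂⟩ := exists_lipschitz_of_flat hW₂ hW₂1
  set C := max C₁ C₂ with hCdef
  have hC : 0 ≤ C := hC₁.trans (le_max_left _ _)
  obtain ⟨μ, hμ, hμd⟩ := h.exists_hasDerivAt_detuning hm hκ hhet hc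
  set ν := criticalMode κ c Ω with hν
  set Q := ‖ν‖ + 1 with hQ
  have hQ0 : 0 < Q := by positivity
  have hforce : ∀ d, 0 ≤ d → d ≤ 1 → ∀ t (φ η : PerFun × PerFun), 2 * ‖φ‖ ≤ d → 2 * ‖η‖ ≤ d →
      ‖force W₁ W₂ t φ - force W₁ W₂ t η‖ ≤ 4 * C * d * ‖φ - η‖ := by
    intro d hd hd1 t φ η hφ hη
    refine norm_force_sub_le hC hd (fun r s hr hs => ?_) (fun r s hr hs => ?_) t hφ hη
    · refine (hL₁ d hd1 r s hr hs).trans ?_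
      gcongr
      exact le_max_left _ _
    · refine (hL₂ d hd1 r s hr hs).trans ?_
      gcongr
      exact le_max_right _ _
  have hclose : ∀ᶠ t in 𝓝 (0 : ℝ), Ω / 2 < Ω + t := by
    have : Filter.Tendsto (fun t : ℝ => Ω + t) (𝓝 0) (𝓝 Ω) :=
      Continuous.tendsto' (by fun_prop) _ _ (by simp)
    exact this.eventually (lt_mem_nhds (by linarith))
  have hfst : ∀ {P : ℝ → Prop}, (∀ᶠ t in 𝓝 (0 : ℝ), P t) →
      ∀ᶠ p in 𝓝 ((0 : ℝ), (0 : ℝ)), P p.1 := fun hP =>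
    (continuous_fst.tendsto ((0 : ℝ), (0 : ℝ))).eventually hP
  have hsnd : ∀ {P : ℝ → Prop}, (∀ᶠ t in 𝓝 (0 : ℝ), P t) →
      ∀ᶠ p in 𝓝 ((0 : ℝ), (0 : ℝ)), P p.2 := fun hP =>
    (continuous_snd.tendsto ((0 : ℝ), (0 : ℝ))).eventually hP
  have habs : ∀ (M : ℝ) {δ : ℝ}, 0 < δ → ∀ᶠ a in 𝓝 (0 : ℝ), |a| * M < δ := by
    intro M δ hδ
    have : Filter.Tendsto (fun a : ℝ => |a| * M) (𝓝 0) (𝓝 (|0| * M)) :=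
      (continuous_abs.mul continuous_const).tendsto 0
    rw [abs_zero, zero_mul] at this
    exact this.eventually (gt_mem_nhds hδ)
  -- Once |a|‖G‖R < 1 the correction is absorbed by the +1 in Q, so the eventual bound on the
  -- nonlinear term does not depend on R.
  have hsize : ∀ R : ℝ, ∀ a f, |a| * (‖G‖ * R) < 1 → ‖f‖ ≤ R →
      ‖a • ν + a ^ 2 • G f‖ ≤ |a| * Q := by
    intro R a f ha hf
    have h1 : ‖a ^ 2 • G f‖ ≤ |a| * 1 := by
      rw [norm_smul, norm_pow, Real.norm_eq_abs, pow_two, mul_assoc]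
      gcongr
      exact (mul_le_mul_of_nonneg_left ((G.le_opNorm f).trans
        (mul_le_mul_of_nonneg_left hf (norm_nonneg _))) (abs_nonneg a)).trans ha.le
    have h2 : ‖a • ν‖ = |a| * ‖ν‖ := by rw [norm_smul, Real.norm_eq_abs]
    calc _ ≤ ‖a • ν‖ + ‖a ^ 2 • G f‖ := norm_add_le _ _
      _ ≤ |a| * ‖ν‖ + |a| * 1 := by rw [h2]; gcongr
      _ = _ := by rw [hQ]; ring
  have hinvle : ∀ a t : ℝ, a ≠ 0 → Ω / 2 < Ω + t →
      ‖(a ^ 2 * (Ω + t) ^ 2)⁻¹‖ ≤ (|a| ^ 2 * (Ω / 2) ^ 2)⁻¹ := by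
    intro a t ha ht
    have ha' : 0 < |a| := abs_pos.2 ha
    rw [Real.norm_of_nonneg (by positivity), ← sq_abs a]
    gcongr
  -- K is the force bound 4C · 2|a|Q · |a|Q times the factor 4/(|a|²Ω²) from `hinvle`.
  refine exists_bifurcating_solutions
    (A := fun t => detuning κ Ω t ν) (B := fun t => (detuning κ Ω t).comp G.toLinearMap)
    (N := fun a t f => (a ^ 2 * (Ω + t) ^ 2)⁻¹ • force W₁ W₂ (Ω + t) (a • ν + a ^ 2 • G f))
    (K := 32 * C * Q ^ 2 / Ω ^ 2) (C := ‖deriv (fun t => detuning κ Ω t ν) 0‖ + 1)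
    (criticalFunctional κ c Ω) ?_ hμ hμd (fun ε hε => eventually_norm_detuning_le hκ hΩ hG hε)
    ?_ ?_ ?_ ?_ ?_
  · exact eventually_norm_detuning_criticalMode_le κ c hΩ.ne'
  · intro R
    filter_upwards [hfst (habs (‖G‖ * R) one_pos), hfst (habs (2 * Q) one_pos), hsnd hclose]
      with p h1 h2 h3 h4 f hf
    obtain ⟨a, t⟩ := p
    simp only at h1 h2 h3 h4 ⊢
    have ha' : 0 < |a| := abs_pos.2 h4
    have h5 := hsize R a f h1 hf
    have h6 := hforce (|a| * (2 * Q)) (by positivity) h2.le (Ω + t) (a • ν + a ^ 2 • G f) 0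
      (by linarith) (by simp; positivity)
    rw [force_zero hW₁0 hW₂0, sub_zero, sub_zero] at h6
    rw [norm_smul]
    calc _ ≤ (|a| ^ 2 * (Ω / 2) ^ 2)⁻¹ * (4 * C * (|a| * (2 * Q)) * (|a| * Q)) :=
          mul_le_mul (hinvle a t h4 h3) (h6.trans (by gcongr)) (norm_nonneg _) (by positivity)
      _ = _ := by field_simp; ring
  · intro R
    filter_upwards [hfst (habs (‖G‖ * R) one_pos), hfst (habs (2 * Q) one_pos), hsnd hclose,
      hfst (habs (32 * C * Q * ‖G‖ / Ω ^ 2) (show (0 : ℝ) < 1 / 4 by norm_num))]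
      with p h1 h2 h3 h7 h4 f f' hf hf'
    obtain ⟨a, t⟩ := p
    simp only at h1 h2 h3 h4 h7 ⊢
    have ha' : 0 < |a| := abs_pos.2 h4
    have h5 := hsize R a f h1 hf
    have h5' := hsize R a f' h1 hf'
    have h6 := hforce (|a| * (2 * Q)) (by positivity) h2.le (Ω + t) (a • ν + a ^ 2 • G f)
      (a • ν + a ^ 2 • G f') (by linarith) (by linarith)
    have h8 : ‖a • ν + a ^ 2 • G f - (a • ν + a ^ 2 • G f')‖ ≤ |a| ^ 2 * (‖G‖ * ‖f - f'‖) := by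
      rw [add_sub_add_left_eq_sub, ← smul_sub, ← map_sub, norm_smul, norm_pow, Real.norm_eq_abs]
      gcongr
      exact G.le_opNorm _
    rw [← smul_sub, norm_smul]
    calc _ ≤ (|a| ^ 2 * (Ω / 2) ^ 2)⁻¹ *
            (4 * C * (|a| * (2 * Q)) * (|a| ^ 2 * (‖G‖ * ‖f - f'‖))) :=
          mul_le_mul (hinvle a t h4 h3) (h6.trans (by gcongr)) (norm_nonneg _) (by positivity)
      _ = |a| * (32 * C * Q * ‖G‖ / Ω ^ 2) * ‖f - f'‖ := by field_simp; ring
      _ ≤ _ := by gcongr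
  · filter_upwards [hclose] with t ht
    exact continuousAt_detuning κ (by linarith) ν
  · filter_upwards [hclose] with t ht f
    exact continuousAt_detuning κ (by linarith) (G f)
  · filter_upwards [hclose] with t ht a f
    by_cases ha : a = 0
    · simp [ha, continuousAt_const]
    have h1 : ContinuousAt (fun t : ℝ => (a ^ 2 * (Ω + t) ^ 2)⁻¹) t := by
      refine ContinuousAt.inv₀ (by fun_prop) ?_
      have : Ω + t ≠ 0 := by linarith
      positivity
    have h2 : Continuous fun t => force W₁ W₂ (Ω + t) (a • ν + a ^ 2 • G f) :=
      (continuous_force W₁ W₂ _).comp (continuous_const.add continuous_id)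
    exact h1.smul h2.continuousAt

end Dimer

/-! ### Conservation laws and removal of the projection. -/

namespace PerFun

/-- `v` is the derivative of `u`. -/
def IsDeriv (u v : PerFun) : Prop :=
  ∀ x : ℝ, HasDerivAt (fun y : ℝ => u (y : Circ)) (v (x : Circ)) x

namespace IsDeriv

variable {u v u' v' : PerFun}

theorem add (hu : IsDeriv u u') (hv : IsDeriv v v') : IsDeriv (u + v) (u' + v') :=
  fun x => (hu x).add (hv x)

theorem sub (hu : IsDeriv u u') (hv : IsDeriv v v') : IsDeriv (u - v) (u' - v') :=
  fun x => (hu x).sub (hv x)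

theorem smul (r : ℝ) (hu : IsDeriv u u') : IsDeriv (r • u) (r • u') :=
  fun x => (hu x).const_mul r

theorem mul (hu : IsDeriv u u') (hv : IsDeriv v v') : IsDeriv (u * v) (u' * v + u * v') :=
  fun x => (hu x).mul (hv x)

theorem shift (t : ℝ) (hu : IsDeriv u u') : IsDeriv (PerFun.shift t u) (PerFun.shift t u') := by
  intro x
  simp only [shift_coe]
  exact (hu (x + t)).comp_add_const x t

theorem nem {V W : C(ℝ, ℝ)} (hV : ∀ r, HasDerivAt V (W r) r) (hu : IsDeriv u u') :
    IsDeriv (PerFun.nem V u) (PerFun.nem W u * u') :=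
  fun x => (hV (u (x : Circ))).comp x (hu x)

theorem reMode (k : ℤ) (γ : ℂ) :
    IsDeriv (PerFun.reMode k γ) (PerFun.reMode k (Complex.I * k * γ)) := by
  refine hasDerivAt_of_coeff fun j => ?_
  rw [coeff_reMode, coeff_reMode]
  simp only [map_mul, Complex.conj_I, map_intCast]
  split_ifs with h1 h2 h2
  · subst h1
    have : j = 0 := by omega
    subst this; simp
  · subst h1; ring
  · subst h2; push_cast; ring
  · simp

theorem coeff_eq (hu : IsDeriv u u') (k : ℤ) : coeff k u' = Complex.I * k * coeff k u :=
  coeff_of_hasDerivAt hu k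

theorem coeff_zero (hu : IsDeriv u u') : coeff 0 u' = 0 := by
  rw [hu.coeff_eq]; simp

/-- u'u is half the derivative of u². With u = φ' this removes the inertial term from the work
balance. -/
theorem coeff_zero_mul_self (hu : IsDeriv u u') : coeff 0 (u' * u) = 0 := by
  have h := (hu.mul hu).coeff_zero
  rw [mul_comm u u', ← two_smul ℝ (u' * u), map_smul] at h
  simpa using h

end IsDeriv

theorem coeff_zero_shift (t : ℝ) (u : PerFun) : coeff 0 (shift t u) = coeff 0 u := by
  rw [coeff_shift]; simp

theorem shift_mul (t : ℝ) (u v : PerFun) : shift t (u * v) = shift t u * shift t v := rfl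

theorem coeff_zero_shift_neg_mul (t : ℝ) (u v : PerFun) :
    coeff 0 (shift (-t) u * v) = coeff 0 (u * shift t v) := by
  rw [← coeff_zero_shift t, shift_mul, shift_add, add_neg_cancel]
  congr 2
  ext x; simp [shift_apply]

theorem coeff_zero_reMode_mul (k : ℤ) (γ : ℂ) (u : PerFun) :
    coeff 0 (reMode k γ * u) = ((γ * coeff (-k) u).re : ℂ) := by
  rw [coeff_zero_eq_integral]
  have := integral_reMode_mul k γ u
  simp only [ContinuousMap.mul_apply, this]
  congr 1
  field_simp

end PerFun

namespace Dimer

open PerFun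

variable {m κ c Ω : ℝ}

theorem coeff_zero_linForce (κ t : ℝ) (φ : PerFun × PerFun) :
    coeff 0 (linForce κ t φ).1 + coeff 0 (linForce κ t φ).2 = 0 := by
  have h : coupling κ 0 = 1 + κ := by simp [coupling]
  rw [linForce_apply, coeff_linForce₁, coeff_linForce₂, Int.cast_zero, zero_mul, neg_zero, h]
  ring

/-- Newton's third law: each spring force occurs twice with opposite signs, and translation
preserves the mean. -/
theorem coeff_zero_force (W₁ W₂ : C(ℝ, ℝ)) (t : ℝ) (φ : PerFun × PerFun) :
    coeff 0 (force W₁ W₂ t φ).1 + coeff 0 (force W₁ W₂ t φ).2 = 0 := by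
  simp only [force, map_sub, coeff_zero_shift]
  ring

/-- Translation invariance of the potential energy. -/
theorem coeff_zero_force_mul_deriv {V₁ V₂ U₁ U₂ : C(ℝ, ℝ)} (hV₁ : ∀ r, HasDerivAt V₁ (U₁ r) r)
    (hV₂ : ∀ r, HasDerivAt V₂ (U₂ r) r) (t : ℝ) {φ φ' : PerFun × PerFun}
    (h₁ : IsDeriv φ.1 φ'.1) (h₂ : IsDeriv φ.2 φ'.2) :
    coeff 0 ((force U₁ U₂ t φ).1 * φ'.1 + (force U₁ U₂ t φ).2 * φ'.2) = 0 := by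
  -- The derivative of a spring's potential energy along the profile has mean zero. Moving the shift
  -- from the force onto φ' turns the total work into minus the sum of these two means.
  have e₁ := (((h₂.shift t).sub h₁).nem hV₁).coeff_zero
  have e₂ := (((h₁.shift t).sub h₂).nem hV₂).coeff_zero
  simp only [mul_sub, map_sub] at e₁ e₂
  simp only [force, sub_mul, map_add, map_sub, coeff_zero_shift_neg_mul]
  simp only [strain₁, strain₂]
  linear_combination -e₁ - e₂

theorem linForce_reMode (κ t : ℝ) (γ₁ γ₂ : ℂ) : linForce κ t (reMode 1 γ₁, reMode 1 γ₂) =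
    (reMode 1 (coupling κ t * γ₂ - (1 + κ) * γ₁), reMode 1 (coupling κ (-t) * γ₁ - (1 + κ) * γ₂)) := by
  simp only [linForce_apply, linForce₁, linForce₂, shift_reMode, ← map_smul, ← map_add,
    ← map_sub, coupling, Complex.real_smul]
  push_cast
  ring_nf

/-- The critical mode lies in the kernel: the first row by the choice of its second component, the
second row by the vanishing determinant. -/
theorem IsCriticalFrequency.linForce_criticalMode (h : IsCriticalFrequency m κ c Ω)
    (hm : 0 < m) (hκ : 0 < κ) : linForce κ Ω (criticalMode κ c Ω) =
      (-(c ^ 2 * Ω ^ 2) • (criticalMode κ c Ω).1, -(c ^ 2 * m * Ω ^ 2) • (criticalMode κ c Ω).2) := by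
  have hb := h.coupling_mul hm hκ
  simp only [diag₁, diag₂, Int.cast_one, one_mul] at hb
  rw [criticalMode, linForce_reMode]
  simp only [← map_smul, Complex.real_smul]
  congr 2
  · push_cast; ring
  · push_cast at hb ⊢
    linear_combination (2 / (nuNorm κ c Ω : ℂ)) * hb

theorem IsCriticalFrequency.criticalFunctional_criticalMode (h : IsCriticalFrequency m κ c Ω)
    (hm : 0 < m) (hκ : 0 < κ) (hhet : 1 / m > 1 ∨ κ > 1) :
    0 < criticalFunctional κ c Ω (criticalMode κ c Ω) := by
  have hn := h.nuNorm_pos hm hκ hhet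
  have hγ := h.gap hm hκ hhet
  have e : coupling κ (-Ω) * (2 / nuNorm κ c Ω * coupling κ Ω / 2) +
      ((1 + κ - c ^ 2 * Ω ^ 2 : ℝ) : ℂ) *
        (2 / nuNorm κ c Ω * ((1 + κ - c ^ 2 * Ω ^ 2 : ℝ) : ℂ) / 2) =
      (((nuNorm κ c Ω)⁻¹ * (1 + κ - c ^ 2 * Ω ^ 2) ^ 2 : ℝ) : ℂ)
        + ((nuNorm κ c Ω)⁻¹ : ℝ) * (coupling κ Ω * coupling κ (-Ω)) := by
    push_cast; ring
  rw [criticalFunctional_apply, criticalMode, coeff_one_reMode, coeff_one_reMode, e,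
    ← conj_coupling, Complex.mul_conj, Complex.add_re, Complex.re_ofReal_mul, Complex.ofReal_re,
    Complex.ofReal_re]
  have h1 := Complex.normSq_nonneg (coupling κ Ω)
  have h2 : 0 < (1 + κ - c ^ 2 * Ω ^ 2) ^ 2 := by have := hγ.ne; positivity
  positivity

/-- The solvability conditions hold automatically. -/
theorem IsCriticalFrequency.isDeriv_of_projected (h : IsCriticalFrequency m κ c Ω)
    (hm : 0 < m) (hκ : 0 < κ) (hhet : 1 / m > 1 ∨ κ > 1) (hc : |c| > soundSpeed m κ)
    {G : PerFun × PerFun →L[ℝ] PerFun × PerFun}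
    (hG₁ : ∀ f, coupling κ (-Ω) * coeff 1 (G f).1
        + ((1 + κ - c ^ 2 * Ω ^ 2 : ℝ) : ℂ) * coeff 1 (G f).2 = 0)
    (hG₂ : ∀ f : PerFun × PerFun, coeff 0 f.1 + coeff 0 f.2 = 0 →
        (coupling κ (-Ω) * coeff 1 f.1
          + ((1 + κ - c ^ 2 * Ω ^ 2 : ℝ) : ℂ) * coeff 1 f.2).re = 0 →
        ∃ s : ℝ, ∀ k : ℤ,
          coeff k ((c ^ 2)⁻¹ • (f.1 + (Ω ^ 2)⁻¹ • linForce₁ κ Ω (G f)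
            - s • reMode 1 (Complex.I * coupling κ Ω))) = -(k : ℂ) ^ 2 * coeff k (G f).1 ∧
          coeff k ((c ^ 2 * m)⁻¹ • (f.2 + (Ω ^ 2)⁻¹ • linForce₂ κ Ω (G f)
            - s • reMode 1 (Complex.I * ((1 + κ - c ^ 2 * Ω ^ 2 : ℝ) : ℂ)))) =
              -(k : ℂ) ^ 2 * coeff k (G f).2)
    {V₁ V₂ U₁ U₂ W₁ W₂ : C(ℝ, ℝ)} (hV₁ : ∀ r, HasDerivAt V₁ (U₁ r) r)
    (hV₂ : ∀ r, HasDerivAt V₂ (U₂ r) r) (hW₁ : ∀ r, U₁ r = r + W₁ r)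
    (hW₂ : ∀ r, U₂ r = κ * r + W₂ r) {a ξ : ℝ} (ha : a ≠ 0) (hω : Ω + a * ξ ≠ 0)
    {f : PerFun × PerFun}
    (hf : a⁻¹ • detuning κ Ω (a * ξ) (criticalMode κ c Ω) + detuning κ Ω (a * ξ) (G f)
        + (a ^ 2 * (Ω + a * ξ) ^ 2)⁻¹ • force W₁ W₂ (Ω + a * ξ)
            (a • criticalMode κ c Ω + a ^ 2 • G f) = f)
    (hf₁ : criticalFunctional κ c Ω f = 0) :
    (∃ d : PerFun × PerFun, IsDeriv (G f).1 d.1 ∧ IsDeriv (G f).2 d.2 ∧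
      IsDeriv d.1 ((c ^ 2)⁻¹ • (f.1 + (Ω ^ 2)⁻¹ • linForce₁ κ Ω (G f))) ∧
      IsDeriv d.2 ((c ^ 2 * m)⁻¹ • (f.2 + (Ω ^ 2)⁻¹ • linForce₂ κ Ω (G f)))) ∧
    ∃ d : PerFun × PerFun,
      IsDeriv (a • criticalMode κ c Ω + a ^ 2 • G f).1 d.1 ∧
      IsDeriv (a • criticalMode κ c Ω + a ^ 2 • G f).2 d.2 ∧
      IsDeriv d.1 ((c ^ 2)⁻¹ • ((Ω + a * ξ) ^ 2)⁻¹ •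
        (force U₁ U₂ (Ω + a * ξ) (a • criticalMode κ c Ω + a ^ 2 • G f)).1) ∧
      IsDeriv d.2 ((c ^ 2 * m)⁻¹ • ((Ω + a * ξ) ^ 2)⁻¹ •
        (force U₁ U₂ (Ω + a * ξ) (a • criticalMode κ c Ω + a ^ 2 • G f)).2) := by
  have hc2 := speed_sq_pos hc
  have hΩ := h.1
  set ν := criticalMode κ c Ω with hν
  set θ := Ω + a * ξ with hθ
  set φ := a • ν + a ^ 2 • G f with hφ
  set γ := 1 + κ - c ^ 2 * Ω ^ 2 with hγ
  have hmean : coeff 0 f.1 + coeff 0 f.2 = 0 := by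
    rw [← hf]
    simp only [detuning_apply, Prod.fst_add, Prod.snd_add, Prod.smul_fst, Prod.smul_snd,
      Prod.fst_sub, Prod.snd_sub, map_add, map_sub, map_smul, Complex.real_smul]
    linear_combination ((a⁻¹ : ℝ) : ℂ) * ((((θ ^ 2)⁻¹ : ℝ) : ℂ) * coeff_zero_linForce κ θ ν
        - (((Ω ^ 2)⁻¹ : ℝ) : ℂ) * coeff_zero_linForce κ Ω ν)
      + (((θ ^ 2)⁻¹ : ℝ) : ℂ) * coeff_zero_linForce κ θ (G f)
      - (((Ω ^ 2)⁻¹ : ℝ) : ℂ) * coeff_zero_linForce κ Ω (G f)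
      + (((a ^ 2 * θ ^ 2)⁻¹ : ℝ) : ℂ) * coeff_zero_force W₁ W₂ θ φ
  obtain ⟨s, hs⟩ := hG₂ f hmean hf₁
  obtain ⟨d₁, hd₁, hd₁'⟩ := exists_deriv_of_coeff fun k => (hs k).1
  obtain ⟨d₂, hd₂, hd₂'⟩ := exists_deriv_of_coeff fun k => (hs k).2
  set ρ₁ := reMode 1 (Complex.I * coupling κ Ω) with hρ₁
  set ρ₂ := reMode 1 (Complex.I * (γ : ℂ)) with hρ₂
  have hforce : force U₁ U₂ θ φ = linForce κ θ φ + force W₁ W₂ θ φ := by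
    have e₁ : nem U₁ (strain₁ θ φ) = strain₁ θ φ + nem W₁ (strain₁ θ φ) := by
      ext x; exact hW₁ _
    have e₂ : nem U₂ (strain₂ θ φ) = κ • strain₂ θ φ + nem W₂ (strain₂ θ φ) := by
      ext x; exact hW₂ _
    have e₃ : ∀ u : PerFun, shift (-θ) (shift θ u) = u := fun u => by
      rw [shift_add, neg_add_cancel]; ext x; simp [shift_apply]
    simp only [force, e₁, e₂, linForce_apply, linForce₁, linForce₂, Prod.mk_add_mk, map_add,
      map_smul]
    simp only [strain₁, strain₂, map_sub, e₃, Prod.mk.injEq]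
    constructor <;> module
  -- Multiplying the fixed-point equation by a² undoes the scaling, and the detuning of ν and of G f
  -- recombine by linearity into that of φ.
  have hfa : a ^ 2 • f = (θ ^ 2)⁻¹ • force U₁ U₂ θ φ - (Ω ^ 2)⁻¹ • linForce κ Ω φ := by
    have e1 : a ^ 2 • a⁻¹ • detuning κ Ω (a * ξ) ν = a • detuning κ Ω (a * ξ) ν := by
      rw [smul_smul]; congr 1; field_simp
    have e2 : a ^ 2 • (a ^ 2 * θ ^ 2)⁻¹ • force W₁ W₂ θ φ = (θ ^ 2)⁻¹ • force W₁ W₂ θ φ := by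
      rw [smul_smul]; congr 1; field_simp
    conv_lhs => rw [← hf]
    rw [smul_add, smul_add, e1, e2, hforce, hφ, detuning_apply, detuning_apply, map_add, map_add,
      map_smul, map_smul, map_smul, map_smul, ← hθ]
    module
  set ν' : PerFun × PerFun := (reMode 1 (Complex.I * (1 : ℤ) * (2 / nuNorm κ c Ω * coupling κ Ω)),
    reMode 1 (Complex.I * (1 : ℤ) * (2 / nuNorm κ c Ω * (γ : ℂ)))) with hν'
  have hν₁ : IsDeriv ν.1 ν'.1 := IsDeriv.reMode 1 _
  have hν₂ : IsDeriv ν.2 ν'.2 := IsDeriv.reMode 1 _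
  have hII : ∀ z : ℂ, Complex.I * (1 : ℤ) * (Complex.I * (1 : ℤ) * z) = -z := fun z => by
    rw [Int.cast_one]; linear_combination z * Complex.I_sq
  have hν₁' : IsDeriv ν'.1 (-ν.1) := by
    have := IsDeriv.reMode 1 (Complex.I * (1 : ℤ) * (2 / nuNorm κ c Ω * coupling κ Ω))
    rwa [hII, map_neg] at this
  have hν₂' : IsDeriv ν'.2 (-ν.2) := by
    have := IsDeriv.reMode 1 (Complex.I * (1 : ℤ) * (2 / nuNorm κ c Ω * (γ : ℂ)))
    rwa [hII, map_neg] at this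
  set φ' : PerFun × PerFun := (a • ν'.1 + a ^ 2 • d₁, a • ν'.2 + a ^ 2 • d₂) with hφ'
  have hφ₁ : IsDeriv φ.1 φ'.1 := (hν₁.smul a).add (IsDeriv.smul (a ^ 2) hd₁)
  have hφ₂ : IsDeriv φ.2 φ'.2 := (hν₂.smul a).add (IsDeriv.smul (a ^ 2) hd₂)
  have hcrit := h.linForce_criticalMode hm hκ
  rw [← hν] at hcrit
  -- The full profile solves the traveling wave equation up to a multiple of (ρ₁, ρ₂), which is
  -- proportional to the derivative of the critical mode.
  have hφ₁' : IsDeriv φ'.1 ((c ^ 2)⁻¹ • ((θ ^ 2)⁻¹ • (force U₁ U₂ θ φ).1 - (a ^ 2 * s) • ρ₁)) := by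
    have h1 := (hν₁'.smul a).add (IsDeriv.smul (a ^ 2) hd₁')
    have h2 : a ^ 2 • f.1 = (θ ^ 2)⁻¹ • (force U₁ U₂ θ φ).1 - (Ω ^ 2)⁻¹ • linForce₁ κ Ω φ :=
      congrArg Prod.fst hfa
    have h3 : linForce₁ κ Ω φ = a • (-(c ^ 2 * Ω ^ 2) • ν.1) + a ^ 2 • linForce₁ κ Ω (G f) := by
      have := congrArg Prod.fst (((linForce κ Ω).map_add (a • ν) (a ^ 2 • G f)))
      rw [map_smul, map_smul, hcrit] at this
      exact this
    have h4 : (Ω ^ 2)⁻¹ • a • (-(c ^ 2 * Ω ^ 2) • ν.1) = (c ^ 2 * -a) • ν.1 := by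
      rw [smul_smul, smul_smul]; congr 1; field_simp
    have h5 : (c ^ 2)⁻¹ • (c ^ 2 * -a) • ν.1 = (-a) • ν.1 := by
      rw [smul_smul, ← mul_assoc, inv_mul_cancel₀ hc2.ne', one_mul]
    have key : (c ^ 2)⁻¹ • ((θ ^ 2)⁻¹ • (force U₁ U₂ θ φ).1 - (a ^ 2 * s) • ρ₁) =
        a • -ν.1 + a ^ 2 • (c ^ 2)⁻¹ • (f.1 + (Ω ^ 2)⁻¹ • linForce₁ κ Ω (G f) - s • ρ₁) := by
      have h6 : (θ ^ 2)⁻¹ • (force U₁ U₂ θ φ).1 = a ^ 2 • f.1 + (c ^ 2 * -a) • ν.1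
          + (Ω ^ 2)⁻¹ • a ^ 2 • linForce₁ κ Ω (G f) := by
        rw [h2, h3, smul_add, h4]; abel
      rw [h6, smul_sub, smul_add, smul_add, h5]
      module
    rw [key]
    exact h1
  have hφ₂' : IsDeriv φ'.2
      ((c ^ 2 * m)⁻¹ • ((θ ^ 2)⁻¹ • (force U₁ U₂ θ φ).2 - (a ^ 2 * s) • ρ₂)) := by
    have h1 := (hν₂'.smul a).add (IsDeriv.smul (a ^ 2) hd₂')
    have h2 : a ^ 2 • f.2 = (θ ^ 2)⁻¹ • (force U₁ U₂ θ φ).2 - (Ω ^ 2)⁻¹ • linForce₂ κ Ω φ :=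
      congrArg Prod.snd hfa
    have h3 : linForce₂ κ Ω φ = a • (-(c ^ 2 * m * Ω ^ 2) • ν.2) + a ^ 2 • linForce₂ κ Ω (G f) := by
      have := congrArg Prod.snd (((linForce κ Ω).map_add (a • ν) (a ^ 2 • G f)))
      rw [map_smul, map_smul, hcrit] at this
      exact this
    have h4 : (Ω ^ 2)⁻¹ • a • (-(c ^ 2 * m * Ω ^ 2) • ν.2) = (c ^ 2 * m * -a) • ν.2 := by
      rw [smul_smul, smul_smul]; congr 1; field_simp
    have h5 : (c ^ 2 * m)⁻¹ • (c ^ 2 * m * -a) • ν.2 = (-a) • ν.2 := by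
      rw [smul_smul, ← mul_assoc, inv_mul_cancel₀ (mul_pos hc2 hm).ne', one_mul]
    have key : (c ^ 2 * m)⁻¹ • ((θ ^ 2)⁻¹ • (force U₁ U₂ θ φ).2 - (a ^ 2 * s) • ρ₂) =
        a • -ν.2 + a ^ 2 • (c ^ 2 * m)⁻¹ • (f.2 + (Ω ^ 2)⁻¹ • linForce₂ κ Ω (G f) - s • ρ₂) := by
      have h6 : (θ ^ 2)⁻¹ • (force U₁ U₂ θ φ).2 = a ^ 2 • f.2 + (c ^ 2 * m * -a) • ν.2
          + (Ω ^ 2)⁻¹ • a ^ 2 • linForce₂ κ Ω (G f) := by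
        rw [h2, h3, smul_add, h4]; abel
      rw [h6, smul_sub, smul_add, smul_add, h5]
      module
    rw [key]
    exact h1
  -- Pair the equation with φ' and average: inertial terms and forces drop out, leaving s times a
  -- number shown to be nonzero.
  have hs0 : s = 0 := by
    have k₁ := hφ₁'.coeff_zero_mul_self
    have k₂ := hφ₂'.coeff_zero_mul_self
    have k₃ := coeff_zero_force_mul_deriv hV₁ hV₂ θ hφ₁ hφ₂
    simp only [smul_mul_assoc, map_smul, sub_mul, map_sub, map_add, Complex.real_smul] at k₁ k₂ k₃
    have hcC : (c : ℂ) ≠ 0 := by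
      have : c ≠ 0 := by rintro rfl; simp at hc2
      exact_mod_cast this
    have hmC : (m : ℂ) ≠ 0 := by exact_mod_cast hm.ne'
    have hc2C : (((c ^ 2)⁻¹ : ℝ) : ℂ) ≠ 0 := by
      push_cast; exact inv_ne_zero (pow_ne_zero 2 hcC)
    have hcmC : (((c ^ 2 * m)⁻¹ : ℝ) : ℂ) ≠ 0 := by
      push_cast; exact inv_ne_zero (mul_ne_zero (pow_ne_zero 2 hcC) hmC)
    have k₁' := (mul_eq_zero.1 k₁).resolve_left hc2C
    have k₂' := (mul_eq_zero.1 k₂).resolve_left hcmC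
    have k₄ : ((a ^ 2 * s : ℝ) : ℂ) * (coeff 0 (ρ₁ * φ'.1) + coeff 0 (ρ₂ * φ'.2)) = 0 := by
      linear_combination (((θ ^ 2)⁻¹ : ℝ) : ℂ) * k₃ - k₁' - k₂'
    -- The part a²G f does not contribute, since the range of G is orthogonal to the critical mode
    -- in every phase.
    have k₅ : coeff 0 (ρ₁ * φ'.1) + coeff 0 (ρ₂ * φ'.2) =
        ((a * criticalFunctional κ c Ω ν : ℝ) : ℂ) := by
      have c₁ : Complex.I * coupling κ Ω * coeff (-1) φ'.1 =
          (starRingEnd ℂ) (coupling κ (-Ω) * coeff 1 φ.1) := by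
        rw [coeff_neg, hφ₁.coeff_eq, map_mul, map_mul, map_mul, conj_coupling, neg_neg,
          Complex.conj_I, map_intCast, Int.cast_one]
        linear_combination (-coupling κ Ω * (starRingEnd ℂ) (coeff 1 φ.1)) * Complex.I_sq
      have c₂ : Complex.I * (γ : ℂ) * coeff (-1) φ'.2 =
          (starRingEnd ℂ) ((γ : ℂ) * coeff 1 φ.2) := by
        rw [coeff_neg, hφ₂.coeff_eq, map_mul, map_mul, map_mul, Complex.conj_ofReal,
          Complex.conj_I, map_intCast, Int.cast_one]
        linear_combination (-(γ : ℂ) * (starRingEnd ℂ) (coeff 1 φ.2)) * Complex.I_sq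
      rw [hρ₁, hρ₂, coeff_zero_reMode_mul, coeff_zero_reMode_mul, c₁, c₂, Complex.conj_re,
        Complex.conj_re, ← Complex.ofReal_add, ← Complex.add_re, hγ,
        ← criticalFunctional_apply κ c Ω φ, hφ, map_add, map_smul, map_smul,
        criticalFunctional_apply κ c Ω (G f), hG₁ f]
      simp
    rw [k₅, ← Complex.ofReal_mul, Complex.ofReal_eq_zero] at k₄
    have hpos := h.criticalFunctional_criticalMode hm hκ hhet
    have hne : a * criticalFunctional κ c Ω ν ≠ 0 := mul_ne_zero ha hpos.ne'
    exact (mul_eq_zero.1 ((mul_eq_zero.1 k₄).resolve_right hne)).resolve_left (pow_ne_zero 2 ha)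
  simp only [hs0, zero_smul, mul_zero, sub_zero] at hd₁' hd₂' hφ₁' hφ₂'
  exact ⟨⟨(d₁, d₂), hd₁, hd₂, hd₁', hd₂'⟩, φ', hφ₁, hφ₂, hφ₁', hφ₂'⟩

end Dimer

/-! ### Bounds in `C^n` uniform over a family. -/

/-- The family `f` of functions is bounded in `C^n`, uniformly in the index. -/
def UniformlyCn {ι : Type*} : ℕ → (ι → ℝ → ℝ) → Prop
  | 0, f => (∀ i, Continuous (f i)) ∧ ∃ C, ∀ i x, |f i x| ≤ C
  | n + 1, f => (∃ C, ∀ i x, |f i x| ≤ C) ∧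
      ∃ g : ι → ℝ → ℝ, (∀ i x, HasDerivAt (f i) (g i x) x) ∧ UniformlyCn n g

namespace UniformlyCn

variable {ι : Type*} {n : ℕ} {f g : ι → ℝ → ℝ}

theorem bounded (h : UniformlyCn n f) : ∃ C, ∀ i x, |f i x| ≤ C := by
  cases n with
  | zero => exact h.2
  | succ n => exact h.1

theorem of_succ : ∀ {n : ℕ} {f : ι → ℝ → ℝ}, UniformlyCn (n + 1) f → UniformlyCn n f
  | 0, _, ⟨hb, _, hg, _⟩ =>
    ⟨fun i => continuous_iff_continuousAt.2 fun x => (hg i x).continuousAt, hb⟩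
  | _ + 1, _, ⟨hb, g, hg, hn⟩ => ⟨hb, g, hg, of_succ hn⟩

theorem contDiff : ∀ {n : ℕ} {f : ι → ℝ → ℝ}, UniformlyCn n f → ∀ i, ContDiff ℝ n (f i)
  | 0, _, h, i => contDiff_zero.2 (h.1 i)
  | n + 1, f, ⟨_, g, hg, hn⟩, i => by
    rw [Nat.cast_succ, contDiff_succ_iff_deriv]
    refine ⟨fun x => (hg i x).differentiableAt, by simp, ?_⟩
    rw [show deriv (f i) = g i from funext fun x => (hg i x).deriv]
    exact contDiff hn i

theorem congr (h : UniformlyCn n f) (hfg : ∀ i x, g i x = f i x) : UniformlyCn n g := by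
  rwa [show g = f from funext fun i => funext fun x => hfg i x]

theorem add : ∀ {n : ℕ} {f g : ι → ℝ → ℝ}, UniformlyCn n f → UniformlyCn n g →
    UniformlyCn n fun i x => f i x + g i x := by
  have hb : ∀ {f g : ι → ℝ → ℝ}, (∃ C, ∀ i x, |f i x| ≤ C) → (∃ C, ∀ i x, |g i x| ≤ C) →
      ∃ C, ∀ i x, |f i x + g i x| ≤ C := fun ⟨C, hC⟩ ⟨D, hD⟩ =>
    ⟨C + D, fun i x => (abs_add_le _ _).trans (add_le_add (hC i x) (hD i x))⟩
  intro n
  induction n with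
  | zero => exact fun hf hg => ⟨fun i => (hf.1 i).add (hg.1 i), hb hf.2 hg.2⟩
  | succ n ih =>
    rintro f g ⟨hf, f', hf', hfn⟩ ⟨hg, g', hg', hgn⟩
    exact ⟨hb hf hg, _, fun i x => (hf' i x).add (hg' i x), ih hfn hgn⟩

theorem mul : ∀ {n : ℕ} {f g : ι → ℝ → ℝ}, UniformlyCn n f → UniformlyCn n g →
    UniformlyCn n fun i x => f i x * g i x := by
  have hb : ∀ {f g : ι → ℝ → ℝ}, (∃ C, ∀ i x, |f i x| ≤ C) → (∃ C, ∀ i x, |g i x| ≤ C) →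
      ∃ C, ∀ i x, |f i x * g i x| ≤ C := fun ⟨C, hC⟩ ⟨D, hD⟩ =>
    ⟨C * D, fun i x => by
      rw [abs_mul]
      exact mul_le_mul (hC i x) (hD i x) (abs_nonneg _) ((abs_nonneg _).trans (hC i x))⟩
  intro n
  induction n with
  | zero => exact fun hf hg => ⟨fun i => (hf.1 i).mul (hg.1 i), hb hf.2 hg.2⟩
  | succ n ih =>
    intro f g hf hg
    have hf0 := hf.of_succ
    have hg0 := hg.of_succ
    obtain ⟨hf, f', hf', hfn⟩ := hf
    obtain ⟨hg, g', hg', hgn⟩ := hg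
    exact ⟨hb hf hg, _, fun i x => (hf' i x).mul (hg' i x), (ih hfn hg0).add (ih hf0 hgn)⟩

theorem const {s : ι → ℝ} (hs : ∃ C, ∀ i, |s i| ≤ C) : ∀ n, UniformlyCn n fun i _ => s i := by
  obtain ⟨C, hC⟩ := hs
  intro n
  induction n generalizing s C with
  | zero => exact ⟨fun i => continuous_const, C, fun i _ => hC i⟩
  | succ n ih =>
    exact ⟨⟨C, fun i _ => hC i⟩, fun _ _ => 0, fun i x => hasDerivAt_const x (s i),
      ih 0 fun i => by simp⟩

theorem const_mul {s : ι → ℝ} (hs : ∃ C, ∀ i, |s i| ≤ C) (hf : UniformlyCn n f) :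
    UniformlyCn n fun i x => s i * f i x :=
  (const hs n).mul hf

theorem const_mul' (s : ℝ) (hf : UniformlyCn n f) : UniformlyCn n fun i x => s * f i x :=
  const_mul ⟨|s|, fun _ => le_rfl⟩ hf

theorem sub (hf : UniformlyCn n f) (hg : UniformlyCn n g) :
    UniformlyCn n fun i x => f i x - g i x :=
  (hf.add (hg.const_mul' (-1))).congr fun i x => by ring

theorem translate (t : ι → ℝ) : ∀ {n : ℕ} {f : ι → ℝ → ℝ}, UniformlyCn n f →
    UniformlyCn n fun i x => f i (x + t i)
  | 0, _, ⟨hc, C, hC⟩ => ⟨fun i => (hc i).comp (by fun_prop), C, fun i _ => hC i _⟩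
  | _ + 1, _, ⟨⟨C, hC⟩, g, hg, hn⟩ =>
    ⟨⟨C, fun i _ => hC i _⟩, fun i x => g i (x + t i),
      fun i x => (hg i (x + t i)).comp_add_const x (t i), translate t hn⟩

theorem comp {n : ℕ} : ∀ {W : ℝ → ℝ} {f : ι → ℝ → ℝ}, ContDiff ℝ ∞ W → UniformlyCn n f →
    UniformlyCn n fun i x => W (f i x) := by
  have hb : ∀ {W : ℝ → ℝ} {f : ι → ℝ → ℝ}, ContDiff ℝ ∞ W → (∃ C, ∀ i x, |f i x| ≤ C) →
      ∃ C, ∀ i x, |W (f i x)| ≤ C := fun {W f} hW ⟨C, hC⟩ => by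
    obtain ⟨D, hD⟩ := (isCompact_Icc (a := -C) (b := C)).exists_bound_of_continuousOn
      hW.continuous.continuousOn
    exact ⟨D, fun i x => hD _ (abs_le.1 (hC i x))⟩
  induction n with
  | zero => exact fun hW hf => ⟨fun i => hW.continuous.comp (hf.1 i), hb hW hf.2⟩
  | succ n ih =>
    intro W f hW hf
    have hf0 := hf.of_succ
    obtain ⟨hfb, f', hf', hfn⟩ := hf
    refine ⟨hb hW hfb, fun i x => deriv W (f i x) * f' i x, fun i x => ?_,
      (ih (contDiff_infty_iff_deriv.1 hW).2 hf0).mul hfn⟩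
    exact ((hW.differentiable (by simp)).differentiableAt.hasDerivAt).comp x (hf' i x)

end UniformlyCn

theorem exists_linear_bound {W : ℝ → ℝ} (hW : ContDiff ℝ 1 W) (h0 : W 0 = 0) (M : ℝ) :
    ∃ C, 0 ≤ C ∧ ∀ r, |r| ≤ M → |W r| ≤ C * |r| := by
  obtain ⟨C, hC⟩ := (isCompact_Icc (a := -M) (b := M)).exists_bound_of_continuousOn
    (hW.continuous_deriv le_rfl).continuousOn
  refine ⟨|C|, abs_nonneg C, fun r hr => ?_⟩
  have hM : 0 ≤ M := (abs_nonneg r).trans hr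
  have := (convex_Icc (-M) M).norm_image_sub_le_of_norm_deriv_le
    (fun y _ => (hW.differentiable one_ne_zero).differentiableAt)
    (fun y hy => (hC y hy).trans (le_abs_self C))
    (show (0 : ℝ) ∈ Set.Icc (-M) M from ⟨by linarith, hM⟩) (abs_le.1 hr)
  simpa [h0] using this

theorem exists_quadratic_bound {W : ℝ → ℝ} (hW : ContDiff ℝ 2 W) (h0 : W 0 = 0)
    (h1 : deriv W 0 = 0) (M : ℝ) :
    ∃ C, 0 ≤ C ∧ ∀ r, |r| ≤ M → |W r| ≤ C * |r| ^ 2 := by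
  obtain ⟨C, hC0, hC⟩ := exists_linear_bound (hW.deriv' (n := 1)) h1 M
  refine ⟨C, hC0, fun r hr => ?_⟩
  have := (convex_Icc (-|r|) |r|).norm_image_sub_le_of_norm_deriv_le (𝕜 := ℝ) (f := W)
    (C := C * |r|) (fun y _ => (hW.differentiable two_ne_zero).differentiableAt)
    (fun y hy => (hC y ((abs_le.2 hy).trans hr)).trans
      (mul_le_mul_of_nonneg_left (abs_le.2 hy) hC0))
    (show (0 : ℝ) ∈ Set.Icc (-|r|) |r| by simp) (abs_le.1 le_rfl)
  rw [h0, sub_zero, sub_zero, mul_assoc] at this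
  simpa [sq, Real.norm_eq_abs] using this

namespace UniformlyCn

variable {ι : Type*} {n : ℕ} {f : ι → ℝ → ℝ} {W : ℝ → ℝ} {a : ι → ℝ}

/-- W(0) = 0 supplies the factor a for the sup bound; each derivative of W(a f) brings its own
factor a, so no inverse power remains after one differentiation. -/
theorem inv_mul_comp (hW : ContDiff ℝ ∞ W) (h0 : W 0 = 0) (ha : ∀ i, a i ≠ 0)
    (ha1 : ∀ i, |a i| ≤ 1) (hf : UniformlyCn n f) :
    UniformlyCn n fun i x => (a i)⁻¹ * W (a i * f i x) := by
  have haf : ∀ {n : ℕ} {f : ι → ℝ → ℝ}, UniformlyCn n f → UniformlyCn n fun i x => a i * f i x :=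
    fun hf => hf.const_mul ⟨1, ha1⟩
  have hb : ∃ C, ∀ i x, |(a i)⁻¹ * W (a i * f i x)| ≤ C := by
    obtain ⟨M, hM⟩ := hf.bounded
    obtain ⟨C, hC0, hC⟩ := exists_linear_bound (hW.of_le (by exact_mod_cast le_top)) h0 M
    refine ⟨C * M, fun i x => ?_⟩
    have hi : 0 < |a i| := abs_pos.2 (ha i)
    have h1 : |a i * f i x| ≤ M := by
      rw [abs_mul]
      exact (mul_le_of_le_one_left (abs_nonneg _) (ha1 i)).trans (hM i x)
    rw [abs_mul, abs_inv, inv_mul_le_iff₀ hi]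
    calc _ ≤ C * |a i * f i x| := hC _ h1
      _ = |a i| * (C * |f i x|) := by rw [abs_mul]; ring
      _ ≤ _ := by gcongr; exact hM i x
  cases n with
  | zero =>
    exact ⟨fun i => continuous_const.mul (hW.continuous.comp (continuous_const.mul (hf.1 i))), hb⟩
  | succ n =>
    have hf0 := hf.of_succ
    obtain ⟨-, f', hf', hfn⟩ := hf
    refine ⟨hb, fun i x => deriv W (a i * f i x) * f' i x, fun i x => ?_,
      (comp (contDiff_infty_iff_deriv.1 hW).2 (haf hf0)).mul hfn⟩
    have h1 := ((hW.differentiable (by simp)).differentiableAt.hasDerivAt (x := a i * f i x)).comp x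
      ((hf' i x).const_mul (a i))
    refine (h1.const_mul (a i)⁻¹).congr_deriv ?_
    have := ha i
    field_simp

/-- One differentiation leaves a⁻¹W'(a f) f', and W'(0) = 0 puts this under `inv_mul_comp`. -/
theorem inv_sq_mul_comp (hW : ContDiff ℝ ∞ W) (h0 : W 0 = 0) (h1 : deriv W 0 = 0)
    (ha : ∀ i, a i ≠ 0) (ha1 : ∀ i, |a i| ≤ 1) (hf : UniformlyCn n f) :
    UniformlyCn n fun i x => (a i ^ 2)⁻¹ * W (a i * f i x) := by
  have hb : ∃ C, ∀ i x, |(a i ^ 2)⁻¹ * W (a i * f i x)| ≤ C := by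
    obtain ⟨M, hM⟩ := hf.bounded
    obtain ⟨C, hC0, hC⟩ := exists_quadratic_bound (by exact_mod_cast contDiff_infty.1 hW 2) h0 h1 M
    refine ⟨C * M ^ 2, fun i x => ?_⟩
    have hi : 0 < |a i| := abs_pos.2 (ha i)
    have h1 : |a i * f i x| ≤ M := by
      rw [abs_mul]
      exact (mul_le_of_le_one_left (abs_nonneg _) (ha1 i)).trans (hM i x)
    rw [abs_mul, abs_inv, abs_pow, inv_mul_le_iff₀ (by positivity)]
    calc _ ≤ C * |a i * f i x| ^ 2 := hC _ h1
      _ = |a i| ^ 2 * (C * |f i x| ^ 2) := by rw [abs_mul]; ring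
      _ ≤ _ := by gcongr; exact hM i x
  cases n with
  | zero =>
    exact ⟨fun i => continuous_const.mul (hW.continuous.comp (continuous_const.mul (hf.1 i))), hb⟩
  | succ n =>
    have hf0 := hf.of_succ
    obtain ⟨-, f', hf', hfn⟩ := hf
    refine ⟨hb, fun i x => (a i)⁻¹ * deriv W (a i * f i x) * f' i x, fun i x => ?_,
      (inv_mul_comp (contDiff_infty_iff_deriv.1 hW).2 h1 ha ha1 hf0).mul hfn⟩
    have h1 := ((hW.differentiable (by simp)).differentiableAt.hasDerivAt (x := a i * f i x)).comp x
      ((hf' i x).const_mul (a i))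
    refine (h1.const_mul (a i ^ 2)⁻¹).congr_deriv ?_
    have := ha i
    field_simp

end UniformlyCn

namespace PerFun

theorem uniformlyCn_reMode {ι : Type*} (k : ℤ) {β : ι → ℂ} (hβ : ∃ C, ∀ i, ‖β i‖ ≤ C) (n : ℕ) :
    UniformlyCn n fun i (x : ℝ) => reMode k (β i) (x : Circ) := by
  have hb : ∀ {β : ι → ℂ}, (∃ C, ∀ i, ‖β i‖ ≤ C) →
      ∃ C, ∀ i (x : ℝ), |reMode k (β i) (x : Circ)| ≤ C := fun ⟨C, hC⟩ =>
    ⟨C, fun i x => (abs_lift_le _ x).trans ((norm_reMode_le _ _).trans (hC i))⟩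
  induction n generalizing β with
  | zero => exact ⟨fun i => continuous_lift _, hb hβ⟩
  | succ n ih =>
    refine ⟨hb hβ, _, fun i x => IsDeriv.reMode k (β i) x, ih ?_⟩
    obtain ⟨C, hC⟩ := hβ
    refine ⟨‖Complex.I * k‖ * C, fun i => ?_⟩
    rw [norm_mul]
    gcongr
    exact hC i

theorem norm_le_of_lift {u : PerFun} {C : ℝ} (h : ∀ x : ℝ, |u (x : Circ)| ≤ C) : ‖u‖ ≤ C := by
  rw [ContinuousMap.norm_le _ ((abs_nonneg _).trans (h 0))]
  intro x
  induction x using QuotientAddGroup.induction_on with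
  | H x => exact h x

/-- By Rolle, v has a zero within every period; the mean value inequality does the rest. -/
theorem abs_le_of_isDeriv {u v w : PerFun} (huv : IsDeriv u v) (hvw : IsDeriv v w) :
    ‖v‖ ≤ 2 * Real.pi * ‖w‖ := by
  refine norm_le_of_lift fun x => ?_
  obtain ⟨y, hy, hy0⟩ := exists_hasDerivAt_eq_zero (f := fun y : ℝ => u (y : Circ))
    (f' := fun y : ℝ => v (y : Circ)) (a := x) (b := x + 2 * Real.pi)
    (by linarith [Real.pi_pos]) (continuous_lift u).continuousOn
    (periodic_lift u x).symm fun z _ => huv z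
  have := (convex_univ : Convex ℝ (Set.univ : Set ℝ)).norm_image_sub_le_of_norm_hasDerivWithin_le
    (f := fun y : ℝ => v (y : Circ)) (f' := fun y : ℝ => w (y : Circ)) (C := ‖w‖)
    (fun z _ => (hvw z).hasDerivWithinAt) (fun z _ => abs_lift_le w z)
    (Set.mem_univ y) (Set.mem_univ x)
  rw [show v (y : Circ) = 0 from hy0, sub_zero] at this
  refine this.trans ?_
  rw [mul_comm]
  gcongr
  rw [Real.norm_eq_abs, abs_le]
  constructor <;> linarith [hy.1, hy.2, Real.pi_pos]

/-- Each derivative, itself periodic, contributes a factor ik to the coefficient. -/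
theorem exists_coeff_decay {ι : Type*} (n : ℕ) {u : ι → PerFun}
    (hu : UniformlyCn n fun i (x : ℝ) => u i (x : Circ)) :
    ∃ C, ∀ i (k : ℤ), |(k : ℝ)| ^ n * ‖coeff k (u i)‖ ≤ C := by
  induction n generalizing u with
  | zero =>
    obtain ⟨C, hC⟩ := hu.bounded
    refine ⟨C, fun i k => ?_⟩
    rw [pow_zero, one_mul]
    exact (norm_coeff_le k (u i)).trans (norm_le_of_lift (hC i))
  | succ n ih =>
    obtain ⟨-, g, hg, hn⟩ := hu
    have hp : ∀ i, Function.Periodic (g i) (2 * Real.pi) := by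
      intro i x
      have h1 := (hg i (x + 2 * Real.pi)).comp_add_const x (2 * Real.pi)
      have h2 : (fun y : ℝ => u i ((y + 2 * Real.pi : ℝ) : Circ)) = fun y : ℝ => u i (y : Circ) :=
        funext (periodic_lift (u i))
      rw [h2] at h1
      exact h1.unique (hg i x)
    have hgc : ∀ i, Continuous (g i) := fun i => (hn.contDiff i).continuous
    obtain ⟨C, hC⟩ := ih (u := fun i => ofPeriodic (g i) (hgc i) (hp i)) hn
    refine ⟨C, fun i k => ?_⟩
    have hd : IsDeriv (u i) (ofPeriodic (g i) (hgc i) (hp i)) := hg i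
    have := hC i k
    rw [hd.coeff_eq, norm_mul, norm_mul, Complex.norm_I, one_mul, Complex.norm_intCast] at this
    rw [pow_succ, mul_assoc]
    exact this

end PerFun

/-! ### Regularity bootstrap for the correction. -/

namespace Dimer

open PerFun

variable {m κ c Ω : ℝ}

/-- The forcing term stays in the modes ±1, so a sup bound controls all its derivatives. -/
theorem exists_detuning_criticalMode_eq (κ c Ω t r : ℝ) : ∃ β₁ β₂ : ℂ,
    r • detuning κ Ω t (criticalMode κ c Ω) = (reMode 1 β₁, reMode 1 β₂) := by
  rw [detuning_apply, criticalMode, linForce_reMode, linForce_reMode]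
  simp only [Prod.smul_mk, Prod.mk_sub_mk, ← map_smul, ← map_sub]
  exact ⟨_, _, rfl⟩

/-- Uniform bounds in all `C^n` for solutions of the traveling wave equation. -/
theorem uniformlyCn_correction {ι : Type*} {a ξ : ι → ℝ} {f : ι → PerFun × PerFun}
    {G : PerFun × PerFun →L[ℝ] PerFun × PerFun} {W₁ W₂ : C(ℝ, ℝ)} {K R : ℝ}
    (hΩ : 0 < Ω) (ha : ∀ i, a i ≠ 0) (ha1 : ∀ i, |a i| ≤ 1) (hξ : ∀ i, |a i * ξ i| ≤ Ω / 2)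
    (hR : ∀ i, ‖f i‖ ≤ R)
    (hK : ∀ i, ‖(a i)⁻¹ • detuning κ Ω (a i * ξ i) (criticalMode κ c Ω)‖ ≤ K)
    (hW₁ : ContDiff ℝ ∞ W₁) (hW₂ : ContDiff ℝ ∞ W₂) (hW₁0 : W₁ 0 = 0)
    (hW₂0 : W₂ 0 = 0) (hW₁1 : deriv W₁ 0 = 0) (hW₂1 : deriv W₂ 0 = 0)
    (hf : ∀ i, (a i)⁻¹ • detuning κ Ω (a i * ξ i) (criticalMode κ c Ω)
        + detuning κ Ω (a i * ξ i) (G (f i))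
        + (a i ^ 2 * (Ω + a i * ξ i) ^ 2)⁻¹ • force W₁ W₂ (Ω + a i * ξ i)
            (a i • criticalMode κ c Ω + a i ^ 2 • G (f i)) = f i)
    (hd : ∀ i, ∃ d : PerFun × PerFun, IsDeriv (G (f i)).1 d.1 ∧ IsDeriv (G (f i)).2 d.2 ∧
      IsDeriv d.1 ((c ^ 2)⁻¹ • ((f i).1 + (Ω ^ 2)⁻¹ • linForce₁ κ Ω (G (f i)))) ∧
      IsDeriv d.2 ((c ^ 2 * m)⁻¹ • ((f i).2 + (Ω ^ 2)⁻¹ • linForce₂ κ Ω (G (f i))))) (n : ℕ) :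
    (UniformlyCn n fun i (x : ℝ) => (G (f i)).1 (x : Circ)) ∧
      UniformlyCn n fun i (x : ℝ) => (G (f i)).2 (x : Circ) := by
  set ν := criticalMode κ c Ω with hν
  choose d hd₁ hd₂ hd₁' hd₂' using hd
  choose β₁ β₂ hβ using fun i => exists_detuning_criticalMode_eq κ c Ω (a i * ξ i) (a i)⁻¹
  set θ : ι → ℝ := fun i => Ω + a i * ξ i with hθ
  have hθpos : ∀ i, Ω / 2 ≤ θ i := fun i => by
    have := (abs_le.1 (hξ i)).1
    simp only [hθ]; linarith
  have hθinv : ∃ C, ∀ i, |(θ i ^ 2)⁻¹| ≤ C := ⟨((Ω / 2) ^ 2)⁻¹, fun i => by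
    have := hθpos i
    rw [abs_of_nonneg (by positivity)]
    gcongr⟩
  have habd : ∃ C, ∀ i, |a i| ≤ C := ⟨1, ha1⟩
  have hβ₁ : ∃ C, ∀ i, ‖β₁ i‖ ≤ C := ⟨2 * K, fun i => by
    have h1 : ‖reMode 1 (β₁ i)‖ ≤ K := by
      have := (norm_fst_le _).trans (hK i)
      rwa [hβ i] at this
    have h2 := (norm_coeff_le 1 _).trans h1
    rw [coeff_one_reMode, norm_div, Complex.norm_two] at h2
    linarith⟩
  have hβ₂ : ∃ C, ∀ i, ‖β₂ i‖ ≤ C := ⟨2 * K, fun i => by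
    have h1 : ‖reMode 1 (β₂ i)‖ ≤ K := by
      have := (norm_snd_le _).trans (hK i)
      rwa [hβ i] at this
    have h2 := (norm_coeff_le 1 _).trans h1
    rw [coeff_one_reMode, norm_div, Complex.norm_two] at h2
    linarith⟩
  set ψ₁ : ι → ℝ → ℝ := fun i x => (G (f i)).1 (x : Circ) with hψ₁
  set ψ₂ : ι → ℝ → ℝ := fun i x => (G (f i)).2 (x : Circ) with hψ₂
  -- σ₁ and σ₂ are the strains of φ divided by a, so that the nonlinearity takes the form a⁻²W(aσ).
  set σ₁ : ι → ℝ → ℝ := fun i x => (ν.2 ((x + θ i : ℝ) : Circ) + a i * ψ₂ i (x + θ i))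
    - (ν.1 (x : Circ) + a i * ψ₁ i x) with hσ₁
  set σ₂ : ι → ℝ → ℝ := fun i x => (ν.1 ((x + θ i : ℝ) : Circ) + a i * ψ₁ i (x + θ i))
    - (ν.2 (x : Circ) + a i * ψ₂ i x) with hσ₂
  have hbound : ∀ i, ‖G (f i)‖ ≤ ‖G‖ * R := fun i =>
    (G.le_opNorm _).trans (mul_le_mul_of_nonneg_left (hR i) (norm_nonneg _))
  -- ψ₁'' with f eliminated: the terms with spacing Ω cancel, and only translates of ψ, scaled
  -- nonlinearities and a single mode remain.
  set g₁ : ι → ℝ → ℝ := fun i x => (c ^ 2)⁻¹ * (reMode 1 (β₁ i) (x : Circ)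
    + (θ i ^ 2)⁻¹ * ((ψ₂ i (x + θ i) + κ * ψ₂ i (x + -θ i)) - (1 + κ) * ψ₁ i x)
    + (θ i ^ 2)⁻¹ * ((a i ^ 2)⁻¹ * W₁ (a i * σ₁ i x)
      - (a i ^ 2)⁻¹ * W₂ (a i * σ₂ i (x + -θ i)))) with hg₁
  set g₂ : ι → ℝ → ℝ := fun i x => (c ^ 2 * m)⁻¹ * (reMode 1 (β₂ i) (x : Circ)
    + (θ i ^ 2)⁻¹ * ((κ * ψ₁ i (x + θ i) + ψ₁ i (x + -θ i)) - (1 + κ) * ψ₂ i x)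
    + (θ i ^ 2)⁻¹ * ((a i ^ 2)⁻¹ * W₂ (a i * σ₂ i x)
      - (a i ^ 2)⁻¹ * W₁ (a i * σ₁ i (x + -θ i)))) with hg₂
  have hg₁eq : ∀ i (x : ℝ), ((c ^ 2)⁻¹ • ((f i).1 + (Ω ^ 2)⁻¹ • linForce₁ κ Ω (G (f i))))
      (x : Circ) = g₁ i x := by
    intro i x
    have h1 := congrArg (fun p : PerFun × PerFun => p.1 (x : Circ)) (hf i)
    have hne := ha i
    rw [hβ i] at h1
    simp only [detuning_apply, linForce_apply, force, Prod.fst_add, Prod.fst_sub, Prod.smul_fst,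
      ContinuousMap.add_apply, ContinuousMap.sub_apply, ContinuousMap.smul_apply, smul_eq_mul,
      shift_coe, nem_apply, linForce₁, strain₁, strain₂, Prod.snd_add, Prod.smul_snd] at h1
    have e₁ : ∀ y, ν.2 ((y + θ i : ℝ) : Circ) = ν.2 ((y + θ i : ℝ) : Circ) := fun _ => rfl
    have s₁ : ∀ y : ℝ, a i * ν.2 ((y + θ i : ℝ) : Circ) + a i ^ 2 * (G (f i)).2 ((y + θ i : ℝ) : Circ)
        - (a i * ν.1 (y : Circ) + a i ^ 2 * (G (f i)).1 (y : Circ)) = a i * σ₁ i y := fun y => by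
      simp only [hσ₁, hψ₁, hψ₂]; ring
    have s₂ : ∀ y : ℝ, a i * ν.1 ((y + θ i : ℝ) : Circ) + a i ^ 2 * (G (f i)).1 ((y + θ i : ℝ) : Circ)
        - (a i * ν.2 (y : Circ) + a i ^ 2 * (G (f i)).2 (y : Circ)) = a i * σ₂ i y := fun y => by
      simp only [hσ₂, hψ₁, hψ₂]; ring
    simp only [ContinuousMap.smul_apply, ContinuousMap.add_apply, smul_eq_mul, linForce₁,
      ContinuousMap.sub_apply, shift_coe]
    rw [s₁, s₂] at h1
    rw [← h1]
    simp only [hg₁, hψ₁, hψ₂, mul_inv]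
    ring
  have hg₂eq : ∀ i (x : ℝ), ((c ^ 2 * m)⁻¹ • ((f i).2 + (Ω ^ 2)⁻¹ • linForce₂ κ Ω (G (f i))))
      (x : Circ) = g₂ i x := by
    intro i x
    have h1 := congrArg (fun p : PerFun × PerFun => p.2 (x : Circ)) (hf i)
    have hne := ha i
    rw [hβ i] at h1
    simp only [detuning_apply, linForce_apply, force, Prod.fst_add, Prod.snd_sub, Prod.smul_fst,
      ContinuousMap.add_apply, ContinuousMap.sub_apply, ContinuousMap.smul_apply, smul_eq_mul,
      shift_coe, nem_apply, linForce₂, strain₁, strain₂, Prod.snd_add, Prod.smul_snd] at h1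
    have s₁ : ∀ y : ℝ, a i * ν.2 ((y + θ i : ℝ) : Circ) + a i ^ 2 * (G (f i)).2 ((y + θ i : ℝ) : Circ)
        - (a i * ν.1 (y : Circ) + a i ^ 2 * (G (f i)).1 (y : Circ)) = a i * σ₁ i y := fun y => by
      simp only [hσ₁, hψ₁, hψ₂]; ring
    have s₂ : ∀ y : ℝ, a i * ν.1 ((y + θ i : ℝ) : Circ) + a i ^ 2 * (G (f i)).1 ((y + θ i : ℝ) : Circ)
        - (a i * ν.2 (y : Circ) + a i ^ 2 * (G (f i)).2 (y : Circ)) = a i * σ₂ i y := fun y => by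
      simp only [hσ₂, hψ₁, hψ₂]; ring
    simp only [ContinuousMap.smul_apply, ContinuousMap.add_apply, smul_eq_mul, linForce₂,
      ContinuousMap.sub_apply, shift_coe]
    rw [s₁, s₂] at h1
    rw [← h1]
    simp only [hg₂, hψ₁, hψ₂, mul_inv]
    ring
  have hνC₁ : ∀ n, UniformlyCn n fun (_ : ι) (x : ℝ) => ν.1 (x : Circ) := fun n =>
    uniformlyCn_reMode 1 ⟨_, fun _ => le_rfl⟩ n
  have hνC₂ : ∀ n, UniformlyCn n fun (_ : ι) (x : ℝ) => ν.2 (x : Circ) := fun n =>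
    uniformlyCn_reMode 1 ⟨_, fun _ => le_rfl⟩ n
  have hstep : ∀ n, UniformlyCn n ψ₁ → UniformlyCn n ψ₂ →
      UniformlyCn n g₁ ∧ UniformlyCn n g₂ := by
    intro n h₁ h₂
    have hχ₁ := (hνC₁ n).add (h₁.const_mul habd)
    have hχ₂ := (hνC₂ n).add (h₂.const_mul habd)
    have hs₁ : UniformlyCn n σ₁ := (hχ₂.translate θ).sub hχ₁
    have hs₂ : UniformlyCn n σ₂ := (hχ₁.translate θ).sub hχ₂
    have hw₁ := UniformlyCn.inv_sq_mul_comp hW₁ hW₁0 hW₁1 ha ha1 hs₁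
    have hw₂ := UniformlyCn.inv_sq_mul_comp hW₂ hW₂0 hW₂1 ha ha1 hs₂
    constructor
    · exact (((uniformlyCn_reMode 1 hβ₁ n).add (((((h₂.translate θ).add
        ((h₂.translate fun i => -θ i).const_mul' κ)).sub (h₁.const_mul' (1 + κ)))).const_mul
        hθinv)).add ((hw₁.sub (hw₂.translate fun i => -θ i)).const_mul hθinv)).const_mul' _
    · exact (((uniformlyCn_reMode 1 hβ₂ n).add ((((((h₁.translate θ).const_mul' κ).add
        (h₁.translate fun i => -θ i)).sub (h₂.const_mul' (1 + κ)))).const_mul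
        hθinv)).add ((hw₂.sub (hw₁.translate fun i => -θ i)).const_mul hθinv)).const_mul' _
  have hzero₁ : UniformlyCn 0 ψ₁ := ⟨fun i => continuous_lift _, ‖G‖ * R, fun i x =>
    (abs_lift_le _ x).trans ((norm_fst_le _).trans (hbound i))⟩
  have hzero₂ : UniformlyCn 0 ψ₂ := ⟨fun i => continuous_lift _, ‖G‖ * R, fun i x =>
    (abs_lift_le _ x).trans ((norm_snd_le _).trans (hbound i))⟩
  -- The equation controls second derivatives only; the first ones are bounded through
  -- `abs_le_of_isDeriv`.
  have hderiv : ∀ {g : ι → ℝ → ℝ} {u v w : ι → PerFun}, UniformlyCn 0 g →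
      (∀ i, IsDeriv (u i) (v i)) → (∀ i, IsDeriv (v i) (w i)) →
      (∀ i (x : ℝ), w i (x : Circ) = g i x) → ∃ C, ∀ i (x : ℝ), |v i (x : Circ)| ≤ C := by
    intro g u v w ⟨_, C, hC⟩ huv hvw hwg
    refine ⟨2 * Real.pi * C, fun i x => (abs_lift_le _ x).trans
      ((abs_le_of_isDeriv (huv i) (hvw i)).trans ?_)⟩
    have := norm_le_of_lift (u := w i) (C := C) fun y => by rw [hwg]; exact hC i y
    gcongr
  have hb₁ := hderiv (hstep 0 hzero₁ hzero₂).1 hd₁ hd₁' hg₁eq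
  have hb₂ := hderiv (hstep 0 hzero₁ hzero₂).2 hd₂ hd₂' hg₂eq
  -- A bound for ψ in C^n gives one for ψ'' in C^n, hence for ψ' in C^{n+1}; C^n of this already
  -- lifts ψ to C^{n+1}.
  induction n with
  | zero => exact ⟨hzero₁, hzero₂⟩
  | succ n ih =>
    obtain ⟨hs₁, hs₂⟩ := hstep n ih.1 ih.2
    have hdn₁ : UniformlyCn (n + 1) fun i (x : ℝ) => (d i).1 (x : Circ) :=
      ⟨hb₁, g₁, fun i x => hg₁eq i x ▸ hd₁' i x, hs₁⟩
    have hdn₂ : UniformlyCn (n + 1) fun i (x : ℝ) => (d i).2 (x : Circ) :=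
      ⟨hb₂, g₂, fun i x => hg₂eq i x ▸ hd₂' i x, hs₂⟩
    exact ⟨⟨ih.1.bounded, _, fun i x => hd₁ i x, hdn₁.of_succ⟩,
      ⟨ih.2.bounded, _, fun i x => hd₂ i x, hdn₂.of_succ⟩⟩

end Dimer

/-! ### Sobolev bounds. -/

namespace PerFun

theorem exists_weighted_coeff_bound {ι : Type*} (n : ℕ) {u : ι → PerFun}
    (hu : ∀ n, UniformlyCn n fun i (x : ℝ) => u i (x : Circ)) :
    ∃ C, ∀ i (k : ℤ), (1 + (k : ℝ) ^ 2) ^ n * ‖coeff k (u i)‖ ^ 2 ≤ C := by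
  obtain ⟨C₀, hC₀⟩ := exists_coeff_decay 0 (hu 0)
  obtain ⟨C₁, hC₁⟩ := exists_coeff_decay n (hu n)
  refine ⟨2 ^ (n - 1) * (C₀ ^ 2 + C₁ ^ 2), fun i k => ?_⟩
  have h0 := hC₀ i k
  have h1 := hC₁ i k
  rw [pow_zero, one_mul] at h0
  have h2 : (1 + (k : ℝ) ^ 2) ^ n ≤ 2 ^ (n - 1) * (1 + (|(k : ℝ)| ^ n) ^ 2) := by
    have := add_pow_le (zero_le_one (α := ℝ)) (sq_nonneg (k : ℝ)) n
    rw [← sq_abs (k : ℝ)]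
    rwa [one_pow, ← sq_abs, ← pow_mul, mul_comm 2 n, pow_mul] at this
  calc _ ≤ 2 ^ (n - 1) * (1 + (|(k : ℝ)| ^ n) ^ 2) * ‖coeff k (u i)‖ ^ 2 := by gcongr
    _ = 2 ^ (n - 1) * (‖coeff k (u i)‖ ^ 2 + (|(k : ℝ)| ^ n * ‖coeff k (u i)‖) ^ 2) := by ring
    _ ≤ _ := by gcongr

end PerFun

theorem summable_int_inv_one_add_sq : Summable fun k : ℤ => (1 + (k : ℝ) ^ 2)⁻¹ := by
  refine Summable.of_norm_bounded_eventually
    ((Real.summable_one_div_int_pow (p := 2)).2 one_lt_two) ?_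
  filter_upwards [(Set.finite_singleton (0 : ℤ)).compl_mem_cofinite] with k hk
  have hk0 : (0 : ℝ) < (k : ℝ) ^ 2 := by
    have : (k : ℝ) ≠ 0 := by exact_mod_cast hk
    positivity
  rw [Real.norm_of_nonneg (by positivity), one_div]
  gcongr
  linarith

namespace Dimer

open PerFun

/-- The function `ℝ → ℝ²` with the given periodic components. -/
def profile (u : PerFun × PerFun) (x : ℝ) : Fin 2 → ℝ := ![u.1 (x : Circ), u.2 (x : Circ)]

theorem periodic_profile (u : PerFun × PerFun) : Function.Periodic (profile u) (2 * Real.pi) :=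
  fun x => congrArg₂ (fun y z : ℝ => ![y, z]) (periodic_lift u.1 x) (periodic_lift u.2 x)

theorem contDiff_profile {u : PerFun × PerFun} (h₁ : ContDiff ℝ ∞ fun x : ℝ => u.1 (x : Circ))
    (h₂ : ContDiff ℝ ∞ fun x : ℝ => u.2 (x : Circ)) : ContDiff ℝ ∞ (profile u) := by
  refine contDiff_pi.2 fun i => ?_
  fin_cases i
  · exact h₁
  · exact h₂

/-- The factor 2π reconciles the normalizations 1/√(2π) and 1/(2π). -/
theorem norm_fourierPer_sq {φ : ℝ → Fin 2 → ℝ} {i : Fin 2} {u : PerFun}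
    (hu : ∀ x, φ x i = u (x : Circ)) (k : ℤ) :
    ‖fourierPer φ k i‖ ^ 2 = 2 * Real.pi * ‖coeff k u‖ ^ 2 := by
  have hπ := Real.pi_pos
  rw [coeff_eq_integral, fourierPer]
  simp_rw [hu]
  rw [norm_mul, norm_smul, mul_pow, mul_pow, norm_div, norm_one, Complex.norm_real,
    Real.norm_of_nonneg (Real.sqrt_nonneg _), div_pow, Real.sq_sqrt (by positivity),
    Real.norm_of_nonneg (by positivity)]
  field_simp

theorem exists_sobolevNorm_profile_le {ι : Type*} {u : ι → PerFun × PerFun}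
    (h₁ : ∀ n, UniformlyCn n fun i (x : ℝ) => (u i).1 (x : Circ))
    (h₂ : ∀ n, UniformlyCn n fun i (x : ℝ) => (u i).2 (x : Circ)) (r : ℝ) :
    ∃ C : ℝ, ∀ i, sobolevNorm r (profile (u i)) ≤ ENNReal.ofReal C := by
  -- One power of 1 + k² beyond r is kept to make the series converge.
  obtain ⟨n, hn⟩ := exists_nat_ge (r + 1)
  obtain ⟨C₁, hC₁⟩ := exists_weighted_coeff_bound n h₁
  obtain ⟨C₂, hC₂⟩ := exists_weighted_coeff_bound n h₂
  set D := 2 * Real.pi * (C₁ + C₂) with hD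
  have hterm : ∀ i (k : ℤ), (1 + (k : ℝ) ^ 2) ^ r * ∑ j, ‖fourierPer (profile (u i)) k j‖ ^ 2 ≤
      D * (1 + (k : ℝ) ^ 2)⁻¹ := by
    intro i k
    have hk : 1 ≤ 1 + (k : ℝ) ^ 2 := by nlinarith
    have hw : (1 + (k : ℝ) ^ 2) ^ r ≤ (1 + (k : ℝ) ^ 2) ^ n * (1 + (k : ℝ) ^ 2)⁻¹ := by
      calc _ ≤ (1 + (k : ℝ) ^ 2) ^ ((n : ℝ) - 1) :=
            Real.rpow_le_rpow_of_exponent_le hk (by linarith)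
        _ = _ := by rw [Real.rpow_sub_one (by positivity), Real.rpow_natCast, div_eq_mul_inv]
    rw [Fin.sum_univ_two, norm_fourierPer_sq (u := (u i).1) (fun _ => rfl),
      norm_fourierPer_sq (u := (u i).2) (fun _ => rfl)]
    have hπ := Real.pi_pos
    calc _ ≤ (1 + (k : ℝ) ^ 2) ^ n * (1 + (k : ℝ) ^ 2)⁻¹ *
          (2 * Real.pi * ‖coeff k (u i).1‖ ^ 2 + 2 * Real.pi * ‖coeff k (u i).2‖ ^ 2) := by gcongr
      _ = 2 * Real.pi * ((1 + (k : ℝ) ^ 2) ^ n * ‖coeff k (u i).1‖ ^ 2 +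
          (1 + (k : ℝ) ^ 2) ^ n * ‖coeff k (u i).2‖ ^ 2) * (1 + (k : ℝ) ^ 2)⁻¹ := by ring
      _ ≤ _ := by
        rw [hD]
        gcongr
        exacts [hC₁ i k, hC₂ i k]
  set S := ∑' k : ℤ, D * (1 + (k : ℝ) ^ 2)⁻¹ with hS
  refine ⟨S ^ (1 / 2 : ℝ), fun i => ?_⟩
  have hpos : ∀ k : ℤ, 0 ≤ D * (1 + (k : ℝ) ^ 2)⁻¹ := fun k =>
    le_trans (by positivity) (hterm i k)
  rw [sobolevNorm, ← ENNReal.ofReal_rpow_of_nonneg (tsum_nonneg hpos) (by norm_num)]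
  gcongr
  rw [ENNReal.ofReal_tsum_of_nonneg hpos (summable_int_inv_one_add_sq.mul_left D)]
  exact ENNReal.tsum_le_tsum fun k => ENNReal.ofReal_le_ofReal (hterm i k)

end Dimer

/-! ### From periodic profiles to the lattice. -/

/-- The quadratic term is o(r), so its coefficient plays no part in the linearization. -/
theorem flat_of_isBigO {U : ℝ → ℝ} {κ β : ℝ}
    (h : (fun r : ℝ => U r - (κ * r + β * r ^ 2)) =O[𝓝 0] fun r : ℝ => r ^ 3) :
    U 0 = 0 ∧ HasDerivAt U κ 0 := by
  have h0 : U 0 = 0 := by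
    obtain ⟨C, hC⟩ := h.bound
    simpa using hC.self_of_nhds
  refine ⟨h0, ?_⟩
  rw [hasDerivAt_iff_isLittleO_nhds_zero]
  have h1 : (fun r : ℝ => r ^ 3) =o[𝓝 0] fun r : ℝ => r := by
    simpa using Asymptotics.isLittleO_pow_pow (𝕜 := ℝ) (show 1 < 3 by norm_num)
  have h2 : (fun r : ℝ => r ^ 2) =o[𝓝 0] fun r : ℝ => r := by
    simpa using Asymptotics.isLittleO_pow_pow (𝕜 := ℝ) (show 1 < 2 by norm_num)
  refine ((h.trans_isLittleO h1).add (h2.const_mul_left β)).congr_left fun r => ?_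
  simp only [zero_add, h0, smul_eq_mul]
  ring

namespace PerFun

theorem IsDeriv.iteratedDeriv_two_comp_mul {u v w : PerFun} (huv : IsDeriv u v)
    (hvw : IsDeriv v w) (θ X : ℝ) :
    iteratedDeriv 2 (fun Y : ℝ => u ((θ * Y : ℝ) : Circ)) X =
      θ ^ 2 * w ((θ * X : ℝ) : Circ) := by
  have hl : ∀ X : ℝ, HasDerivAt (fun Y : ℝ => θ * Y) θ X := fun X => by
    simpa using (hasDerivAt_id X).const_mul θ
  have h1 : deriv (fun Y : ℝ => u ((θ * Y : ℝ) : Circ)) =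
      fun Y : ℝ => v ((θ * Y : ℝ) : Circ) * θ :=
    funext fun Y => ((huv (θ * Y)).comp Y (hl Y)).deriv
  rw [iteratedDeriv_succ, iteratedDeriv_one, h1]
  have h2 := (((hvw (θ * X)).comp X (hl X)).mul_const θ).deriv
  simp only [Function.comp_def] at h2
  rw [h2]
  ring

end PerFun

namespace Dimer

open PerFun

variable {m κ c Ω β : ℝ} {mass : ℤ → ℝ} {V : ℤ → ℝ → ℝ}

theorem IsDimer.potential_odd (h : IsDimer m κ β mass V) {j : ℤ} (hj : Odd j) : V j = V 1 := by
  obtain ⟨k, rfl⟩ := hj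
  have hp : Function.Periodic V 2 := h.periodic
  have := hp.int_mul k 1
  rwa [Int.cast_id, mul_comm, add_comm] at this

theorem IsDimer.potential_even (h : IsDimer m κ β mass V) {j : ℤ} (hj : Even j) : V j = V 2 := by
  obtain ⟨k, rfl⟩ := hj
  have hp : Function.Periodic V 2 := h.periodic
  have := hp.int_mul (k - 1) 2
  rwa [Int.cast_id, show 2 + (k - 1) * 2 = k + k by ring] at this

theorem iteratedDeriv_two_travel (q : ℝ → ℝ) (s c t : ℝ) :
    iteratedDeriv 2 (fun t => q (s - c * t)) t = c ^ 2 * iteratedDeriv 2 q (s - c * t) := by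
  have h1 : ∀ q : ℝ → ℝ, deriv (fun t => q (s - c * t)) = fun t => -c * deriv q (s - c * t) := by
    intro q
    funext t
    have := deriv_comp_mul_left c (fun y => q (s - y)) t
    rw [deriv_comp_const_sub] at this
    rw [this, smul_eq_mul]
    ring
  rw [iteratedDeriv_succ, iteratedDeriv_one, iteratedDeriv_succ, iteratedDeriv_one, h1,
    deriv_const_mul_field, h1]
  ring

theorem IsDimer.equationsOfMotion (h : IsDimer m κ β mass V) {p : ℝ → Fin 2 → ℝ}
    (hp : TravelingWaveSystem m (V 1) (V 2) c p) :
    EquationsOfMotion mass V (travelingWave c p) := by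
  intro j t
  have e1 : ((j + 1 : ℤ) : ℝ) - c * t = j - c * t + 1 := by push_cast; ring
  have e2 : ((j - 1 : ℤ) : ℝ) - c * t = j - c * t - 1 := by push_cast; ring
  rcases Int.even_or_odd j with hj | hj
  · have hj0 : ¬ Odd j := Int.not_odd_iff_even.2 hj
    have hj1 : Odd (j + 1) := hj.add_one
    have hj2 : Odd (j - 1) := hj.sub_odd odd_one
    have hu : travelingWave c p j = fun t => (fun Y => p Y 1) (j - c * t) :=
      funext fun t => if_neg hj0
    rw [h.mass_even j hj, h.potential_even hj, h.potential_odd hj2, hu, iteratedDeriv_two_travel fun Y => p Y 1]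
    simp only [travelingWave, if_pos hj1, if_pos hj2, e1, e2]
    rw [← (hp _).2]
    ring
  · have hj1 : ¬ Odd (j + 1) := Int.not_odd_iff_even.2 hj.add_one
    have hj2 : ¬ Odd (j - 1) := Int.not_odd_iff_even.2 (hj.sub_odd odd_one)
    have hu : travelingWave c p j = fun t => (fun Y => p Y 0) (j - c * t) :=
      funext fun t => if_pos hj
    rw [h.mass_odd j hj, h.potential_odd hj, h.potential_even (Int.not_odd_iff_even.1 hj2), hu,
      iteratedDeriv_two_travel fun Y => p Y 0]
    simp only [travelingWave, if_neg hj1, if_neg hj2, e1, e2]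
    rw [← (hp _).1]
    ring

theorem travelingWaveSystem_profile {V₁ V₂ : ℝ → ℝ} {U₁ U₂ : C(ℝ, ℝ)} (hU₁ : deriv V₁ = U₁)
    (hU₂ : deriv V₂ = U₂) (hm : 0 < m) (hc : 0 < c ^ 2) {θ : ℝ} (hθ : θ ≠ 0)
    {φ d : PerFun × PerFun} (hd₁ : IsDeriv φ.1 d.1) (hd₂ : IsDeriv φ.2 d.2)
    (hd₁' : IsDeriv d.1 ((c ^ 2)⁻¹ • (θ ^ 2)⁻¹ • (force U₁ U₂ θ φ).1))
    (hd₂' : IsDeriv d.2 ((c ^ 2 * m)⁻¹ • (θ ^ 2)⁻¹ • (force U₁ U₂ θ φ).2)) :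
    TravelingWaveSystem m V₁ V₂ c fun X => profile φ (θ * X) := by
  intro X
  have hc0 : c ≠ 0 := by simpa using hc.ne'
  have e1 : θ * (X + 1) = θ * X + θ := by ring
  have e2 : θ * (X - 1) = θ * X + -θ := by ring
  have e3 : θ * X + -θ + θ = θ * X := by ring
  have h1 := hd₁.iteratedDeriv_two_comp_mul hd₁' θ X
  have h2 := hd₂.iteratedDeriv_two_comp_mul hd₂' θ X
  simp only [profile, Matrix.cons_val_zero, Matrix.cons_val_one, Matrix.cons_val_fin_one, hU₁, hU₂,
    h1, h2, e1, e2]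
  simp only [force, strain₁, strain₂, ContinuousMap.smul_apply, ContinuousMap.sub_apply, nem_apply,
    shift_coe, smul_eq_mul, e3]
  constructor <;> field_simp

theorem travelingWaveSystem_zero (m c : ℝ) {V₁ V₂ : ℝ → ℝ} (h₁ : deriv V₁ 0 = 0)
    (h₂ : deriv V₂ 0 = 0) : TravelingWaveSystem m V₁ V₂ c fun _ => 0 := by
  intro X
  simp [h₁, h₂]

theorem profile_criticalMode (κ c Ω : ℝ) : profile (criticalMode κ c Ω) = nu1 κ c Ω := by
  funext x
  have hcos : ∀ r y : ℝ, (r * Complex.exp (Complex.I * y)).re = r * Real.cos y := fun r y => by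
    rw [mul_comm Complex.I, Complex.re_ofReal_mul, Complex.exp_ofReal_mul_I_re]
  simp only [profile, nu1, criticalMode, reMode_coe]
  congr 1
  · rw [show 2 / (nuNorm κ c Ω : ℂ) * coupling κ Ω * Complex.exp (Complex.I * (1 : ℤ) * x) =
        ((2 / nuNorm κ c Ω : ℝ) : ℂ) * Complex.exp (Complex.I * (x + Ω : ℝ)) +
        ((2 / nuNorm κ c Ω * κ : ℝ) : ℂ) * Complex.exp (Complex.I * (x - Ω : ℝ)) by
      rw [coupling]
      push_cast
      rw [mul_add Complex.I, mul_sub Complex.I, Complex.exp_add, Complex.exp_sub, Complex.exp_neg]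
      ring_nf]
    rw [Complex.add_re, hcos, hcos]
    ring
  · rw [show 2 / (nuNorm κ c Ω : ℂ) * ((1 + κ - c ^ 2 * Ω ^ 2 : ℝ) : ℂ) *
        Complex.exp (Complex.I * (1 : ℤ) * x) =
        ((2 / nuNorm κ c Ω * (1 + κ - c ^ 2 * Ω ^ 2) : ℝ) : ℂ) *
          Complex.exp (Complex.I * (x : ℝ)) by
      push_cast; ring_nf]
    rw [hcos, mul_assoc]

theorem contDiff_nu1 (κ c Ω : ℝ) : ContDiff ℝ ∞ (nu1 κ c Ω) := by
  refine contDiff_pi.2 fun i => ?_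
  fin_cases i
  · simp only [nu1, Fin.zero_eta, Matrix.cons_val_zero]
    fun_prop
  · simp only [nu1, Fin.mk_one, Matrix.cons_val_one, Matrix.cons_val_fin_one]
    fun_prop

theorem innerPer_nu1_profile {u : PerFun × PerFun}
    (hu : coupling κ (-Ω) * coeff 1 u.1 + ((1 + κ - c ^ 2 * Ω ^ 2 : ℝ) : ℂ) * coeff 1 u.2 = 0) :
    innerPer (nu1 κ c Ω) (profile u) = 0 := by
  have hi : ∀ v w : PerFun, IntervalIntegrable (fun x : ℝ => v (x : Circ) * w (x : Circ))
      MeasureTheory.volume (-Real.pi) Real.pi := fun v w =>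
    ((continuous_lift v).mul (continuous_lift w)).intervalIntegrable _ _
  have hconj := congrArg (starRingEnd ℂ) hu
  rw [map_add, map_mul, map_mul, conj_coupling, neg_neg, ← coeff_neg, ← coeff_neg, map_zero,
    Complex.conj_ofReal] at hconj
  rw [innerPer, ← profile_criticalMode]
  simp only [Fin.sum_univ_two, profile, Matrix.cons_val_zero, Matrix.cons_val_one,
    Matrix.cons_val_fin_one]
  rw [intervalIntegral.integral_add (hi _ _) (hi _ _), criticalMode, integral_reMode_mul,
    integral_reMode_mul, ← mul_add, ← Complex.add_re, mul_assoc (2 / _ : ℂ), mul_assoc (2 / _ : ℂ), ← mul_add, hconj]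
  simp

theorem sobolevNorm_zero (r : ℝ) : sobolevNorm r (fun _ => 0) = 0 := by
  simp [sobolevNorm, fourierPer]

end Dimer

/-! ### Assembling the branch. -/

namespace Dimer

open PerFun

variable {m κ c Ω : ℝ}

/-- A branch of solutions of the traveling wave system, bounded in every `C^n`. -/
theorem IsCriticalFrequency.exists_branch (h : IsCriticalFrequency m κ c Ω)
    (hm : 0 < m) (hκ : 0 < κ) (hhet : 1 / m > 1 ∨ κ > 1) (hc : |c| > soundSpeed m κ)
    {V₁ V₂ : ℝ → ℝ} (hV₁ : ContDiff ℝ ∞ V₁) (hV₂ : ContDiff ℝ ∞ V₂)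
    (h₁0 : deriv V₁ 0 = 0) (h₁1 : HasDerivAt (deriv V₁) 1 0)
    (h₂0 : deriv V₂ 0 = 0) (h₂1 : HasDerivAt (deriv V₂) κ 0) :
    ∃ ac > 0, ∃ Ξ : ℝ, ∃ (ξ : {a : ℝ // a ≠ 0 ∧ |a| ≤ ac} → ℝ)
      (ψ : {a : ℝ // a ≠ 0 ∧ |a| ≤ ac} → PerFun × PerFun), (∀ a, |ξ a| ≤ Ξ) ∧
      (∀ a : {a : ℝ // a ≠ 0 ∧ |a| ≤ ac}, TravelingWaveSystem m V₁ V₂ c fun X =>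
        profile ((a : ℝ) • criticalMode κ c Ω + (a : ℝ) ^ 2 • ψ a) ((Ω + a * ξ a) * X)) ∧
      (∀ a, innerPer (nu1 κ c Ω) (profile (ψ a)) = 0) ∧
      (∀ n, UniformlyCn n fun a (x : ℝ) => (ψ a).1 (x : Circ)) ∧
      ∀ n, UniformlyCn n fun a (x : ℝ) => (ψ a).2 (x : Circ) := by
  have hΩ := h.1
  have hs₁ : ContDiff ℝ ∞ (deriv V₁) := (contDiff_infty_iff_deriv.1 hV₁).2
  have hs₂ : ContDiff ℝ ∞ (deriv V₂) := (contDiff_infty_iff_deriv.1 hV₂).2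
  let U₁ : C(ℝ, ℝ) := ⟨deriv V₁, hs₁.continuous⟩
  let U₂ : C(ℝ, ℝ) := ⟨deriv V₂, hs₂.continuous⟩
  let W₁ : C(ℝ, ℝ) := ⟨fun r => deriv V₁ r - r, hs₁.continuous.sub continuous_id⟩
  let W₂ : C(ℝ, ℝ) := ⟨fun r => deriv V₂ r - κ * r, hs₂.continuous.sub (by fun_prop)⟩
  have hW₁ : ContDiff ℝ ∞ W₁ := hs₁.sub contDiff_id
  have hW₂ : ContDiff ℝ ∞ W₂ := hs₂.sub (contDiff_const.mul contDiff_id)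
  have hW₁0 : W₁ 0 = 0 := by simp [W₁, h₁0]
  have hW₂0 : W₂ 0 = 0 := by simp [W₂, h₂0]
  have hW₁1 : deriv W₁ 0 = 0 := by
    exact (h₁1.sub (hasDerivAt_id (0 : ℝ))).deriv.trans (sub_self _)
  have hW₂1 : deriv W₂ 0 = 0 := by
    exact (h₂1.sub ((hasDerivAt_id (0 : ℝ)).const_mul κ)).deriv.trans (by ring)
  obtain ⟨G, hG, hG₁, hG₂⟩ := h.exists_generalizedInverse hm hκ hhet hc
  obtain ⟨Ξ, R, hsol⟩ := h.exists_projected_solutions hm hκ hhet hc hG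
    (contDiff_infty.1 hW₁ 2) (contDiff_infty.1 hW₂ 2)
    hW₁0 hW₂0 hW₁1 hW₂1
  set D := ‖deriv (fun t => detuning κ Ω t (criticalMode κ c Ω)) 0‖ + 1 with hD
  have hD0 : 0 ≤ D := by positivity
  have hclose : ∀ᶠ t in 𝓝 (0 : ℝ), |t| ≤ Ω / 2 :=
    (continuous_abs.tendsto' (0 : ℝ) 0 abs_zero).eventually (ge_mem_nhds (by positivity))
  have hone : ∀ᶠ a in 𝓝 (0 : ℝ), |a| ≤ 1 :=
    (continuous_abs.tendsto' (0 : ℝ) 0 abs_zero).eventually (ge_mem_nhds one_pos)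
  have hdet : ∀ᶠ a in 𝓝 (0 : ℝ), ∀ ξ ∈ Set.Icc (-Ξ) Ξ, |a * ξ| ≤ Ω / 2 ∧
      ‖detuning κ Ω (a * ξ) (criticalMode κ c Ω)‖ ≤ D * |a * ξ| :=
    Filter.Eventually.forall_mul_mem_Icc (P := fun _ t => |t| ≤ Ω / 2 ∧
      ‖detuning κ Ω t (criticalMode κ c Ω)‖ ≤ D * |t|)
      ((continuous_snd.tendsto ((0 : ℝ), (0 : ℝ))).eventually
        (hclose.and (eventually_norm_detuning_criticalMode_le κ c hΩ.ne'))) Ξ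
  obtain ⟨ε, hε, hball⟩ := Metric.eventually_nhds_iff.1 (hsol.and (hone.and hdet))
  -- Half the radius: the closed condition |a| ≤ ε/2 has to fit into an open ball.
  have hball' : ∀ a : {a : ℝ // a ≠ 0 ∧ |a| ≤ ε / 2}, dist (a : ℝ) 0 < ε := fun a => by
    rw [Real.dist_eq, sub_zero]
    linarith [a.2.2]
  choose ξ hξ f hfR hf hf₁ using fun a : {a : ℝ // a ≠ 0 ∧ |a| ≤ ε / 2} =>
    (hball (hball' a)).1 a.2.1
  have hξΩ := fun a : {a : ℝ // a ≠ 0 ∧ |a| ≤ ε / 2} => ((hball (hball' a)).2.2 (ξ a) (abs_le.1 (hξ a))).1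
  have hθ : ∀ a : {a : ℝ // a ≠ 0 ∧ |a| ≤ ε / 2}, Ω + a * ξ a ≠ 0 := fun a => by
    have := (abs_le.1 (hξΩ a)).1
    linarith
  have hDV : ∀ {V : ℝ → ℝ}, ContDiff ℝ ∞ V → ∀ r, HasDerivAt V (deriv V r) r := fun hV r =>
    (hV.differentiable (by simp) r).hasDerivAt
  have hreg := fun a : {a : ℝ // a ≠ 0 ∧ |a| ≤ ε / 2} => h.isDeriv_of_projected hm hκ hhet hc hG₁ hG₂
    (V₁ := ⟨V₁, hV₁.continuous⟩) (V₂ := ⟨V₂, hV₂.continuous⟩) (U₁ := U₁) (U₂ := U₂)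
    (hDV hV₁) (hDV hV₂) (fun r => (add_sub_cancel r _).symm)
    (fun r => (add_sub_cancel (κ * r) _).symm) a.2.1 (hθ a) (hf a) (hf₁ a)
  have hK : ∀ a : {a : ℝ // a ≠ 0 ∧ |a| ≤ ε / 2},
      ‖(a : ℝ)⁻¹ • detuning κ Ω (a * ξ a) (criticalMode κ c Ω)‖ ≤ D * Ξ := fun a => by
    have ha : 0 < |(a : ℝ)| := abs_pos.2 a.2.1
    rw [norm_smul, norm_inv, Real.norm_eq_abs, inv_mul_le_iff₀ ha]
    calc _ ≤ D * |a * ξ a| := ((hball (hball' a)).2.2 (ξ a) (abs_le.1 (hξ a))).2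
      _ = |(a : ℝ)| * (D * |ξ a|) := by rw [abs_mul]; ring
      _ ≤ _ := by
        gcongr
        exact hξ a
  have hC := uniformlyCn_correction hΩ (fun a => a.2.1) (fun a => (hball (hball' a)).2.1) hξΩ hfR
    hK hW₁ hW₂ hW₁0 hW₂0 hW₁1 hW₂1 hf fun a => (hreg a).1
  refine ⟨ε / 2, by positivity, Ξ, ξ, fun a => G (f a), hξ, fun a => ?_, fun a =>
    innerPer_nu1_profile (hG₁ (f a)), fun n => (hC n).1, fun n => (hC n).2⟩
  obtain ⟨d, hd₁, hd₂, hd₁', hd₂'⟩ := (hreg a).2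
  exact travelingWaveSystem_profile (U₁ := U₁) (U₂ := U₂) rfl rfl hm (speed_sq_pos hc) (hθ a)
    hd₁ hd₂ hd₁' hd₂'

theorem profile_add_smul (a b : ℝ) (u v : PerFun × PerFun) (x : ℝ) :
    profile (a • u + b • v) x = a • profile u x + b • profile v x := by
  simp [profile]

end Dimer

end

theorem theorem1p1 (m κ β : ℝ) (mass : ℤ → ℝ) (V : ℤ → ℝ → ℝ)
    (hm : 0 < m) (hκ : 0 < κ) (hdimer : Dimer.IsDimer m κ β mass V)
    (hhet : 1 / m > 1 ∨ κ > 1)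
    (c : ℝ) (hc : |c| > Dimer.soundSpeed m κ) :
    ∃ Ωc : ℝ, Dimer.IsCriticalFrequency m κ c Ωc ∧
      ContDiff ℝ ∞ (Dimer.nu1 κ c Ωc) ∧
      Function.Periodic (Dimer.nu1 κ c Ωc) (2 * Real.pi) ∧
      ∃ ac : ℝ, 0 < ac ∧
        ∃ (p ψ : ℝ → ℝ → Fin 2 → ℝ) (Ω ξ : ℝ → ℝ),
          (∀ a : ℝ, |a| ≤ ac →
            (∀ X : ℝ, p a X = a • Dimer.nu1 κ c Ωc (Ω a * X) + a ^ 2 • ψ a (Ω a * X)) ∧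
            Dimer.TravelingWaveSystem m (V 1) (V 2) c (p a) ∧
            Dimer.EquationsOfMotion mass V (Dimer.travelingWave c (p a)) ∧
            ContDiff ℝ ∞ (ψ a) ∧
            Function.Periodic (ψ a) (2 * Real.pi) ∧
            Dimer.innerPer (Dimer.nu1 κ c Ωc) (ψ a) = 0 ∧
            Ω a = Ωc + a * ξ a) ∧
          (∀ r : ℝ, 0 ≤ r → ∃ C : ℝ, ∀ a : ℝ, |a| ≤ ac →
            Dimer.sobolevNorm r (ψ a) ≤ ENNReal.ofReal C) ∧
          (∃ C : ℝ, ∀ a : ℝ, |a| ≤ ac → |ξ a| ≤ C) := by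
  obtain ⟨Ωc, h⟩ := Dimer.exists_criticalFrequency hm hκ hhet hc
  have hf₁ : deriv (V 1) 0 = 0 ∧ HasDerivAt (deriv (V 1)) 1 0 :=
    flat_of_isBigO (β := 1) (by simpa using hdimer.force_odd 1 odd_one)
  have hf₂ := flat_of_isBigO (hdimer.force_even 2 even_two)
  obtain ⟨ac, hac, Ξ, ξ, ψ, hξ, hsys, horth, hC₁, hC₂⟩ := h.exists_branch hm hκ hhet hc
    (hdimer.smooth 1) (hdimer.smooth 2) hf₁.1 hf₁.2 hf₂.1 hf₂.2
  refine ⟨Ωc, h, Dimer.contDiff_nu1 κ c Ωc, ?_, ac, hac, ?_⟩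
  · rw [← Dimer.profile_criticalMode]
    exact Dimer.periodic_profile _
  classical
  -- At a = 0 the profile is identically zero, and the default values ξ = 0, ψ = 0 satisfy all the
  -- claims.
  let ξ' : ℝ → ℝ := fun a => if ha : a ≠ 0 ∧ |a| ≤ ac then ξ ⟨a, ha⟩ else 0
  let ψ' : ℝ → ℝ → Fin 2 → ℝ := fun a =>
    if ha : a ≠ 0 ∧ |a| ≤ ac then Dimer.profile (ψ ⟨a, ha⟩) else fun _ => 0
  let Ω : ℝ → ℝ := fun a => Ωc + a * ξ' a
  -- The bound is |Ξ| because the default value at a = 0 calls for a nonnegative one.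
  refine ⟨fun a X => a • Dimer.nu1 κ c Ωc (Ω a * X) + a ^ 2 • ψ' a (Ω a * X), ψ', Ω, ξ',
    fun a ha => ?_, fun r _ => ?_, |Ξ|, fun a ha => ?_⟩
  · have key : Dimer.TravelingWaveSystem m (V 1) (V 2) c
          (fun X => a • Dimer.nu1 κ c Ωc (Ω a * X) + a ^ 2 • ψ' a (Ω a * X)) ∧
        ContDiff ℝ ∞ (ψ' a) ∧ Function.Periodic (ψ' a) (2 * Real.pi) ∧
        Dimer.innerPer (Dimer.nu1 κ c Ωc) (ψ' a) = 0 := by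
      by_cases ha0 : a = 0
      · have hψ : ψ' a = fun _ => 0 := dif_neg fun hne => hne.1 ha0
        rw [hψ]
        refine ⟨?_, contDiff_const, fun _ => rfl, by simp [Dimer.innerPer]⟩
        simp only [ha0, zero_smul, smul_zero, add_zero]
        exact Dimer.travelingWaveSystem_zero m c hf₁.1 hf₂.1
      · have hψ : ψ' a = Dimer.profile (ψ ⟨a, ha0, ha⟩) := dif_pos ⟨ha0, ha⟩
        have hξ' : ξ' a = ξ ⟨a, ha0, ha⟩ := dif_pos ⟨ha0, ha⟩
        rw [hψ]
        refine ⟨?_, Dimer.contDiff_profile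
          (contDiff_infty.2 fun n => (hC₁ n).contDiff _)
          (contDiff_infty.2 fun n => (hC₂ n).contDiff _), Dimer.periodic_profile _, horth _⟩
        have := hsys ⟨a, ha0, ha⟩
        simp only [Dimer.profile_add_smul, Dimer.profile_criticalMode] at this
        simpa only [Ω, hξ'] using this
    exact ⟨fun _ => rfl, key.1, hdimer.equationsOfMotion key.1, key.2.1, key.2.2.1, key.2.2.2, rfl⟩
  · obtain ⟨C, hC⟩ := Dimer.exists_sobolevNorm_profile_le hC₁ hC₂ r
    refine ⟨C, fun a ha => ?_⟩
    by_cases ha0 : a = 0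
    · rw [show ψ' a = fun _ => 0 from dif_neg fun hne => hne.1 ha0, Dimer.sobolevNorm_zero]
      exact zero_le
    · rw [show ψ' a = Dimer.profile (ψ ⟨a, ha0, ha⟩) from dif_pos ⟨ha0, ha⟩]
      exact hC _
  · by_cases ha0 : a = 0
    · rw [show ξ' a = 0 from dif_neg fun hne => hne.1 ha0, abs_zero]
      exact abs_nonneg Ξ
    · rw [show ξ' a = ξ ⟨a, ha0, ha⟩ from dif_pos ⟨ha0, ha⟩]
      exact (hξ _).trans (le_abs_self Ξ)
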